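/- **Setting.** Let $\phi,\psi\in L^2(\mathbb R)$ be real-valued and write $\hat g(\xi)=\int g(t)e^{-i\xi t}\,dt$. For an integer $M\ge 1$ and a real $\alpha>1$, consider the assumptions: (W-1) $\phi,\psi$ are compactly supported and integrable, $\int\phi=1$ and $\int\psi^2=1$; (W-2) $\sup_\xi|\hat\psi(\xi)|(1+|\xi|)^\alpha<\infty$; (W-3) $\int t^m\psi(t)\,dt=0$ for $m=0,\dots,M-1$; (W-4) for $m=0,\dots,M-1$, the function $t\mapsto\sum_{k\in\mathbb Z}k^m\phi(t-k)$ is (almost everywhere) a polynomial of degree $m$. Fix an integer $T\ge1$ such that $\phi$ vanishes outside $(-T,0)$ and $\psi$ vanishes outside $(0,T)$; $T$ is regarded as part of the data $(\phi,\psi)$. Assume moreover that for every integer $j\ge0$ the trigonometric polynomial $H_j(\lambda)=\sum_{l\in\mathbb Z}h_{j,l}e^{-i\lambda l}$, with $h_{j,l}=2^{-j/2}\int\phi(t+l)\psi(2^{-j}t)\,dt$, is not identically zero. For a real sequence $X=(X_k)_{k\in\mathbb Z}$ put $W_{j,k}=\int\big(\sum_{l\in\mathbb Z}X_l\,\phi(t-l)\big)\,2^{-j/2}\psi(2^{-j}t-k)\,dt$.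 For a sample size $n$ put $n_j=[2^{-j}(n-T+1)-T+1]$, $J(n)=[\log_2(n-T+1)-\log_2T]$ and $\hat\sigma_j^2=n_j^{-1}\sum_{k=0}^{n_j-1}W_{j,k}^2$. Let $\ell\ge1$ and let $\mathbf w=(w_0,\dots,w_\ell)$ be a real vector with $\sum_iw_i=0$ and $2\log(2)\sum_i i\,w_i=1$. For $0\le J_0\le J(n)-\ell$ put $$\hat d_n(J_0,\mathbf w)=\sum_{j=J_0}^{J_0+\ell}w_{j-J_0}\log\hat\sigma_j^2,\qquad m=\sum_{j=J_0}^{J_0+\ell}n_j .$$ For $\beta\in(0,2]$ and $L>0$, $\mathcal H(\beta,L)$ is the set of even nonnegative functions $g$ on $[-\pi,\pi]$ with $|g(\lambda)-g(0)|\le L\,g(0)\,|\lambda|^\beta$ for all $\lambda\in[-\pi,\pi]$. A process $X$ has memory parameter $d\in\mathbb R$ and short-memory part $f^*$ ($f^*$ nonnegative, symmetric and bounded on $(-\pi,\pi)$, and bounded away from zero near $0$) if, for every integer $K\ge0$ with $K>d-1/2$, its $K$-th order difference $\Delta^KX$ is weakly stationary with spectral density $|1-e^{-i\lambda}|^{2(K-d)}f^*(\lambda)$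 on $(-\pi,\pi)$. **Theorem.** Let $d_{\min}<d_{\max}$. There is a finite constant $C>0$, depending only on $\mathbf w,\beta,L,d_{\min},d_{\max},\phi,\psi$, such that the following holds whenever (W-1)–(W-4) hold with some $M\ge1$ and $\alpha>1$ for which $[d_{\min},d_{\max}]\subset((1+\beta)/2-\alpha,\,M]$. (i) For all $n$, all $J_0\in\{0,\dots,J(n)-\ell\}$, all $d\in[d_{\min},d_{\max}]$, all $f^*\in\mathcal H(\beta,L)$ with $f^*(0)>0$, and every Gaussian process $X$ with memory parameter $d$ and short-memory part $f^*$ such that $\Delta^MX$ has mean zero, the estimator $\hat d_n(J_0,\mathbf w)$ is square integrable and $$\big|\mathbb E[\hat d_n(J_0,\mathbf w)]-d\big|\le C\Big\{\Big(\frac mn\Big)^{\beta}+\frac1m\Big\},$$ $$\mathrm{Var}[\hat d_n(J_0,\mathbf w)]\le C\Big\{\frac1m+\mathbf 1\Big(\frac mn\ge C^{-1}\Big)\Big\},$$ $$\mathbb E\big[(\hat d_n(J_0,\mathbf w)-d)^2\big]\le C\Big\{\Big(\frac mn\Big)^{2\beta}+\frac1m\Big\}.$$ (ii) If $(J_0(n))_n$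 is a sequence of nonnegative integers with $2^{J_0(n)}\asymp n^{1/(1+2\beta)}$ as $n\to\infty$, then $J_0(n)+\ell\le J(n)$ for all large $n$ and $$\limsup_{n\to\infty}\ \sup\ n^{2\beta/(1+2\beta)}\,\mathbb E\big[(\hat d_n(J_0(n),\mathbf w)-d)^2\big]<\infty,$$ where the supremum is over all $d\in[d_{\min},d_{\max}]$, all $f^*\in\mathcal H(\beta,L)$ with $f^*(0)>0$, and all processes $X$ as in (i). -/

import Mathlib

open MeasureTheory ProbabilityTheory

namespace LogScaleRegression

noncomputable section

/-! ### Wavelets -/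

/-- The Fourier transform `∫ g(t) e^{-iξt} dt`. -/
def fourier (g : ℝ → ℝ) (ξ : ℝ) : ℂ :=
  ∫ t : ℝ, (g t : ℂ) * Complex.exp (-(Complex.I * (ξ : ℂ) * (t : ℂ)))

/-- The assumptions (W-1)-(W-4) on the scaling function `φ` and the wavelet `ψ`, with `M` vanishing
moments and Fourier decay exponent `α`. As `φ` is an element of `L²(ℝ)`, the polynomial identity
(W-4) is an identity almost everywhere. -/
structure WaveletAssumptions (φ ψ : ℝ → ℝ) (M : ℕ) (α : ℝ) : Prop where
  memLp_scaling : MemLp φ 2 volume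
  memLp_wavelet : MemLp ψ 2 volume
  compact_scaling : HasCompactSupport φ
  compact_wavelet : HasCompactSupport ψ
  integrable_scaling : Integrable φ volume
  integrable_wavelet : Integrable ψ volume
  integral_scaling : ∫ t, φ t = 1
  integral_sq_wavelet : ∫ t, ψ t ^ 2 = 1
  one_lt_exponent : 1 < α
  fourier_decay : BddAbove (Set.range fun ξ : ℝ => ‖fourier ψ ξ‖ * (1 + |ξ|) ^ α)
  vanishing_moments : ∀ m : ℕ, m < M → ∫ t, t ^ m * ψ t = 0
  polynomial_reproduction : ∀ m : ℕ, m < M → ∃ p : Polynomial ℝ, p.degree = (m : WithBot ℕ) ∧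
    ∀ᵐ t : ℝ, ∑' k : ℤ, (k : ℝ) ^ m * φ (t - k) = p.eval t

/-- `ψ_{j,k}(t) = 2^{-j/2} ψ(2^{-j} t - k)`. -/
def dilated (ψ : ℝ → ℝ) (j : ℕ) (k : ℤ) (t : ℝ) : ℝ :=
  (2 : ℝ) ^ (-(j : ℝ) / 2) * ψ (t / 2 ^ j - k)

/-- The continuous-time function `𝐱(t) = ∑_{k ∈ ℤ} x_k φ(t - k)` attached to a sequence `x`. -/
def interpolate (φ : ℝ → ℝ) (x : ℤ → ℝ) (t : ℝ) : ℝ :=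
  ∑' k : ℤ, x k * φ (t - k)

/-- The wavelet coefficient `W_{j,k} = ∫ 𝐱(t) ψ_{j,k}(t) dt`. -/
def waveletCoeff (φ ψ : ℝ → ℝ) (x : ℤ → ℝ) (j : ℕ) (k : ℤ) : ℝ :=
  ∫ t : ℝ, interpolate φ x t * dilated ψ j k t

/-- The filter coefficient `h_{j,l} = 2^{-j/2} ∫ φ(t + l) ψ(2^{-j} t) dt`. -/
def filterCoeff (φ ψ : ℝ → ℝ) (j : ℕ) (l : ℤ) : ℝ :=
  (2 : ℝ) ^ (-(j : ℝ) / 2) * ∫ t : ℝ, φ (t + l) * ψ (t / 2 ^ j)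

/-- The transfer function `H_j(λ) = ∑_{l ∈ ℤ} h_{j,l} e^{-iλl}` (a trigonometric polynomial). -/
def transferFunction (φ ψ : ℝ → ℝ) (j : ℕ) (lam : ℝ) : ℂ :=
  ∑' l : ℤ, (filterCoeff φ ψ j l : ℂ) * Complex.exp (-(Complex.I * (lam : ℂ) * (l : ℂ)))

/-! ### Processes with memory parameter `d` -/

/-- The first order difference `(Δ X)_k = X_k - X_{k-1}`. -/
def diff {Ω : Type*} (X : ℤ → Ω → ℝ) : ℤ → Ω → ℝ :=
  fun k ω => X k ω - X (k - 1) ω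

/-- The `K`-th order difference `Δ^K X`. -/
def iterDiff {Ω : Type*} (K : ℕ) (X : ℤ → Ω → ℝ) : ℤ → Ω → ℝ :=
  diff^[K] X

/-- `Y` is weakly stationary under `P`, with spectral density `f` on `(-π, π)`, normalised by
`Cov(Y_k, Y_l) = ∫_{-π}^{π} e^{iλ(k-l)} f(λ) dλ`. -/
structure HasSpectralDensity {Ω : Type*} [MeasurableSpace Ω] (Y : ℤ → Ω → ℝ) (P : Measure Ω)
    (f : ℝ → ℝ) : Prop where
  memLp : ∀ k, MemLp (Y k) 2 P
  mean : ∀ k l, ∫ ω, Y k ω ∂P = ∫ ω, Y l ω ∂P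
  integrable : IntegrableOn f (Set.Ioo (-Real.pi) Real.pi)
  cov : ∀ k l : ℤ, ((cov[Y k, Y l; P] : ℝ) : ℂ) =
    ∫ lam in Set.Ioo (-Real.pi) Real.pi,
      Complex.exp (Complex.I * (lam : ℂ) * ((k : ℂ) - (l : ℂ))) * (f lam : ℂ)

/-- `X` has memory parameter `d` with short-memory part `fstar`: for every integer
`K > d - 1/2` (`K ≥ 0`), `Δ^K X` is weakly stationary with spectral density
`|1 - e^{-iλ}|^{2(K-d)} fstar(λ)`, where `fstar` is nonnegative, symmetric and bounded on `(-π, π)`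
and bounded away from zero near the origin. -/
structure HasMemoryParameter {Ω : Type*} [MeasurableSpace Ω] (X : ℤ → Ω → ℝ) (P : Measure Ω)
    (d : ℝ) (fstar : ℝ → ℝ) : Prop where
  nonneg : ∀ lam ∈ Set.Ioo (-Real.pi) Real.pi, 0 ≤ fstar lam
  symm : ∀ lam ∈ Set.Ioo (-Real.pi) Real.pi, fstar (-lam) = fstar lam
  bounded : ∃ B : ℝ, ∀ lam ∈ Set.Ioo (-Real.pi) Real.pi, fstar lam ≤ B
  away_from_zero : ∃ c > 0, ∃ ε > 0, ∀ lam : ℝ, |lam| < ε → c ≤ fstar lam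
  spectral : ∀ K : ℕ, d - 1 / 2 < K → HasSpectralDensity (iterDiff K X) P fun lam =>
    ‖1 - Complex.exp (-(Complex.I * (lam : ℂ)))‖ ^ (2 * ((K : ℝ) - d)) * fstar lam

/-- The class `H(β, L)` of even nonnegative functions `g` on `[-π, π]` such that
`|g(λ) - g(0)| ≤ L g(0) |λ|^β`. (Values outside `[-π, π]` are irrelevant.) -/
def HolderClass (β L : ℝ) : Set (ℝ → ℝ) :=
  {g | ∀ lam ∈ Set.Icc (-Real.pi) Real.pi,
    0 ≤ g lam ∧ g (-lam) = g lam ∧ |g lam - g 0| ≤ L * g 0 * |lam| ^ β}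

/-! ### The log-scale regression estimator -/

/-- The number `n_j = [2^{-j}(n - T + 1) - T + 1]` of available coefficients at scale `j`
(set to `0` when this is negative). -/
def numCoeff (T n j : ℕ) : ℕ :=
  ⌊((n : ℝ) - T + 1) / 2 ^ j - T + 1⌋₊

/-- The maximal scale `J(n) = [log₂(n - T + 1) - log₂ T]`. -/
def maxScale (T n : ℕ) : ℤ :=
  ⌊Real.logb 2 ((n : ℝ) - T + 1) - Real.logb 2 T⌋

/-- The empirical variance `n_j⁻¹ ∑_{k=0}^{n_j-1} W_{j,k}²` of the sequence `x`. -/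
def empiricalVariance (φ ψ : ℝ → ℝ) (T n : ℕ) (x : ℤ → ℝ) (j : ℕ) : ℝ :=
  (numCoeff T n j : ℝ)⁻¹ * ∑ k ∈ Finset.range (numCoeff T n j), waveletCoeff φ ψ x j (k : ℤ) ^ 2

/-- The regression estimator
`∑_{j=J₀}^{J₀+ℓ} w_{j-J₀} log(empirical variance at scale j)`, as a random variable. -/
def estimator {Ω : Type*} (φ ψ : ℝ → ℝ) (T : ℕ) {ℓ : ℕ} (w : Fin (ℓ + 1) → ℝ) (n J₀ : ℕ)
    (X : ℤ → Ω → ℝ) (ω : Ω) : ℝ :=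
  ∑ i : Fin (ℓ + 1), w i * Real.log (empiricalVariance φ ψ T n (fun k => X k ω) (J₀ + i))

/-- The number `m = ∑_{j=J₀}^{J₀+ℓ} n_j` of wavelet coefficients used by the estimator. -/
def totalCoeff (T ℓ n J₀ : ℕ) : ℕ :=
  ∑ j ∈ Finset.Icc J₀ (J₀ + ℓ), numCoeff T n j

end

end LogScaleRegression

/-! At a fixed scale `j` the wavelet coefficients form a centred stationary Gaussian vector. The
filter `H_j` vanishes to order `M` at the origin, so the coefficients are finite linear functionals
of `Δ^M X`, which is stationary because `d ≤ M`. The variance of `∑ x_k W_{j,k}` is therefore the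
integral of `|p(2^j y)|²` against `|H_j(y)|² |1 - e^{-iy}|^{-2d} f*(y)`, where `p` is the
trigonometric polynomial with coefficients `x`.

Bias. By Parseval on the circle and the Strang-Fix conditions, `H_j(y)` is close to `2^{j/2} φ̂(y)
conj ψ̂(2^j y)`. Moreover `|φ̂(y)|² = 1 + O(y²)`, `|1 - e^{-iy}| = |y| (1 + O(y²))` and `f*(y) =
f*(0) (1 + O(|y|^β))` with `β ≤ 2`. Every error is at most a constant times `2^{-βj} (1 + 2^j
|y|)^β` relative to an envelope, and `(1 + 2^j |y|)^{-(2α + 2 dmin - β)}` is still integrable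
because `dmin > (1 + β)/2 - α`. Hence `Var W_{j,k} = f*(0) K(d) 2^{2dj} (1 + O(2^{-βj}))`, with
`K(d)` the integral of `|ψ̂(ξ)|² |ξ|^{-2d}`. Its logarithm is affine in `j` with slope `2 d log 2`
up to `O(2^{-βj})`. The weights annihilate the intercept and normalise the slope, and `2^{-J₀}` is
of the order of `m/n` (`exists_spectral_comparison`, `exists_log_variance_bounds`).

Fluctuation. The same envelope bounds the spectral radius of the covariance matrix at scale `j` by a
constant times the variance. After diagonalisation the normalised empirical variance `Z` satisfies
`E(Z - 1)⁴ = O(n_j⁻²)`. Since `E(Z - 1) = 0`, a second order expansion gives `O(1/n_j)` for both `|E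
log Z|` and `E (log Z)²`. Small values of `Z` are controlled by concavity: `log Z` is at least minus
the average of the `|log (W_i² / s)|`, whose fourth moment is bounded (`log_mean_square_bounds`).
The scales are combined by Cauchy-Schwarz, without independence.

Uniformity. Minorants independent of `d` bound the variances from below; the finitely many small
scales use that `H_j` is not identically zero. The degree of the filter at scale 0 forces `M ≤ 2T`,
so only finitely many `M` matter. For each of them one admissible `α` suffices, since the conclusion
does not involve `α`. -/

namespace LogScaleRegression

/-! ### Moments of sums of independent centred variables -/

section FourthMoment

variable {Ω : Type*} [MeasurableSpace Ω] {P : Measure Ω}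

/-- A product of four functions in `L⁴` is integrable. -/
lemma integrable_prod_four {f g h k : Ω → ℝ} (hf : MemLp f 4 P) (hg : MemLp g 4 P)
    (hh : MemLp h 4 P) (hk : MemLp k 4 P) : Integrable (fun ω => f ω * g ω * (h ω * k ω)) P := by
  have : ENNReal.HolderTriple 4 4 2 := by
    constructor
    rw [← two_mul, show (4 : ENNReal) = 2 * 2 by norm_num, ENNReal.mul_inv (by simp) (by simp),
      ← mul_assoc, ENNReal.mul_inv_cancel (by simp) (by simp), one_mul]
  have h1 : MemLp (fun ω => f ω * g ω) 2 P := MemLp.mul' hg hf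
  have h2 : MemLp (fun ω => h ω * k ω) 2 P := MemLp.mul' hk hh
  exact h1.integrable_mul h2

lemma memLp_four_two [IsProbabilityMeasure P] {f : Ω → ℝ} (hf : MemLp f 4 P) : MemLp f 2 P :=
  hf.mono_exponent (by norm_num)

/-- The second and fourth moment of a sum of independent centred random variables. -/
lemma moments_sum_le [IsProbabilityMeasure P] {ι : Type*} {U : ι → Ω → ℝ} {l : ι → ℝ} {a b : ℝ}
    (hL : ∀ i, MemLp (U i) 4 P) (hI : iIndepFun U P) (h0 : ∀ i, ∫ ω, U i ω ∂P = 0)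
    (ha : 0 ≤ a) (hb : 0 ≤ b)
    (h2 : ∀ i, ∫ ω, U i ω ^ 2 ∂P ≤ a * l i ^ 2) (h4 : ∀ i, ∫ ω, U i ω ^ 4 ∂P ≤ b * (l i ^ 2) ^ 2)
    (s : Finset ι) :
    ∫ ω, (∑ i ∈ s, U i ω) ^ 2 ∂P ≤ a * ∑ i ∈ s, l i ^ 2 ∧
    ∫ ω, (∑ i ∈ s, U i ω) ^ 4 ∂P ≤ (3 * a ^ 2 + b) * (∑ i ∈ s, l i ^ 2) ^ 2 := by
  classical
  induction s using Finset.induction_on with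
  | empty => simp
  | insert j s hj ih =>
    obtain ⟨ih2, ih4⟩ := ih
    set S : Ω → ℝ := fun ω => ∑ i ∈ s, U i ω with hS
    have hSL : MemLp S 4 P := memLp_finsetSum s fun i _ => hL i
    have hind : IndepFun S (U j) P := by
      have := hI.indepFun_finsetSum_of_notMem₀ (fun i => (hL i).aestronglyMeasurable.aemeasurable) hj
      convert! this using 1
      ext ω
      simp [hS]
    have hS0 : ∫ ω, S ω ∂P = 0 := by
      rw [hS, integral_finsetSum _ fun i _ => (hL i).integrable (by norm_num)]
      simp [h0]
    have e11 : ∫ ω, S ω * U j ω ∂P = 0 := by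
      rw [hind.integral_fun_mul_eq_mul_integral hSL.aestronglyMeasurable
        (hL j).aestronglyMeasurable, hS0, zero_mul]
    have e31 : ∫ ω, S ω ^ 3 * U j ω ∂P = 0 := by
      have := (hind.comp (φ := fun x => x ^ 3) (ψ := id) (by fun_prop) measurable_id)
      have := this.integral_fun_mul_eq_mul_integral (hSL.aestronglyMeasurable.pow 3)
        (hL j).aestronglyMeasurable
      simpa [h0] using this
    have e13 : ∫ ω, S ω * U j ω ^ 3 ∂P = 0 := by
      have := (hind.comp (φ := id) (ψ := fun x => x ^ 3) measurable_id (by fun_prop))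
      have := this.integral_fun_mul_eq_mul_integral hSL.aestronglyMeasurable
        ((hL j).aestronglyMeasurable.pow 3)
      simpa [hS0] using this
    have e22 : ∫ ω, S ω ^ 2 * U j ω ^ 2 ∂P = (∫ ω, S ω ^ 2 ∂P) * ∫ ω, U j ω ^ 2 ∂P := by
      have := (hind.comp (φ := fun x => x ^ 2) (ψ := fun x => x ^ 2) (by fun_prop) (by fun_prop))
      exact this.integral_fun_mul_eq_mul_integral (hSL.aestronglyMeasurable.pow 2)
        ((hL j).aestronglyMeasurable.pow 2)
    have i2S : Integrable (fun ω => S ω ^ 2) P := (memLp_four_two hSL).integrable_sq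
    have i2U : Integrable (fun ω => U j ω ^ 2) P := (memLp_four_two (hL j)).integrable_sq
    have i11 : Integrable (fun ω => S ω * U j ω) P :=
      (memLp_four_two hSL).integrable_mul (memLp_four_two (hL j))
    have i4S : Integrable (fun ω => S ω ^ 4) P :=
      (integrable_prod_four hSL hSL hSL hSL).congr (.of_forall fun ω => by simp only; ring)
    have i4U : Integrable (fun ω => U j ω ^ 4) P :=
      (integrable_prod_four (hL j) (hL j) (hL j) (hL j)).congr
        (.of_forall fun ω => by simp only; ring)
    have i31 : Integrable (fun ω => S ω ^ 3 * U j ω) P :=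
      (integrable_prod_four hSL hSL hSL (hL j)).congr (.of_forall fun ω => by simp only; ring)
    have i13 : Integrable (fun ω => S ω * U j ω ^ 3) P :=
      (integrable_prod_four hSL (hL j) (hL j) (hL j)).congr (.of_forall fun ω => by simp only; ring)
    have i22 : Integrable (fun ω => S ω ^ 2 * U j ω ^ 2) P :=
      (integrable_prod_four hSL hSL (hL j) (hL j)).congr (.of_forall fun ω => by simp only; ring)
    have q2 : ∫ ω, (∑ i ∈ insert j s, U i ω) ^ 2 ∂P
        = ∫ ω, S ω ^ 2 ∂P + ∫ ω, U j ω ^ 2 ∂P := by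
      have : ∀ ω, (∑ i ∈ insert j s, U i ω) ^ 2 = S ω ^ 2 + U j ω ^ 2 + 2 * (S ω * U j ω) := by
        intro ω; rw [Finset.sum_insert hj]; ring
      simp_rw [this]
      have iA : Integrable (fun ω => S ω ^ 2 + U j ω ^ 2) P := i2S.add i2U
      rw [integral_add iA (i11.const_mul 2), integral_add i2S i2U, integral_const_mul,
        e11, mul_zero, add_zero]
    have q4 : ∫ ω, (∑ i ∈ insert j s, U i ω) ^ 4 ∂P
        = ∫ ω, S ω ^ 4 ∂P + ∫ ω, U j ω ^ 4 ∂P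
          + 6 * ((∫ ω, S ω ^ 2 ∂P) * ∫ ω, U j ω ^ 2 ∂P) := by
      have : ∀ ω, (∑ i ∈ insert j s, U i ω) ^ 4 = S ω ^ 4 + U j ω ^ 4
          + 6 * (S ω ^ 2 * U j ω ^ 2) + 4 * (S ω ^ 3 * U j ω) + 4 * (S ω * U j ω ^ 3) := by
        intro ω; rw [Finset.sum_insert hj]; ring
      simp_rw [this]
      have iA : Integrable (fun ω => S ω ^ 4 + U j ω ^ 4) P := i4S.add i4U
      have iB : Integrable (fun ω => S ω ^ 4 + U j ω ^ 4 + 6 * (S ω ^ 2 * U j ω ^ 2)) P :=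
        iA.add (i22.const_mul 6)
      have iC : Integrable (fun ω => S ω ^ 4 + U j ω ^ 4 + 6 * (S ω ^ 2 * U j ω ^ 2)
          + 4 * (S ω ^ 3 * U j ω)) P := iB.add (i31.const_mul 4)
      rw [integral_add iC (i13.const_mul 4), integral_add iB (i31.const_mul 4),
        integral_add iA (i22.const_mul 6), integral_add i4S i4U,
        integral_const_mul, integral_const_mul, integral_const_mul, e31, e13, e22]
      ring
    have hl : 0 ≤ ∑ i ∈ s, l i ^ 2 := Finset.sum_nonneg fun i _ => sq_nonneg _
    rw [q2, q4, Finset.sum_insert hj]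
    refine ⟨by linarith [h2 j], ?_⟩
    -- The mixed term `6 E S² E U²` is at most `6 a²` times the cross product of the `l` sums. The
    -- square on the right contributes twice `3 a²` times the same product, whence the constant 3.
    have hm : (∫ ω, S ω ^ 2 ∂P) * ∫ ω, U j ω ^ 2 ∂P ≤ (a * ∑ i ∈ s, l i ^ 2) * (a * l j ^ 2) :=
      mul_le_mul ih2 (h2 j) (integral_nonneg fun ω => sq_nonneg _) (by positivity)
    have := h4 j
    have hx : 0 ≤ l j ^ 2 := sq_nonneg _
    have : 0 ≤ a ^ 2 * (l j ^ 2) ^ 2 := by positivity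
    have : 0 ≤ b * (l j ^ 2 * ∑ i ∈ s, l i ^ 2) := by positivity
    nlinarith

end FourthMoment

/-! ### Gaussian vectors and their diagonalisation -/

section Gaussian

/-- Moments of a centred Gaussian variable are obtained from the standard one by scaling. -/
lemma integral_gaussianReal_scale (v : ℝ) (hv : 0 ≤ v) (f : ℝ → ℝ) (hf : Measurable f) :
    ∫ x, f x ∂(gaussianReal 0 v.toNNReal) = ∫ x, f (√v * x) ∂(gaussianReal 0 1) := by
  have : gaussianReal 0 v.toNNReal = (gaussianReal 0 1).map (√v * ·) := by
    rw [gaussianReal_map_const_mul]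
    congr 1
    · simp
    · ext; simp [Real.sq_sqrt hv, hv]
  rw [this, integral_map (by fun_prop) hf.aestronglyMeasurable]

lemma integral_comp_of_hasGaussianLaw {Ω : Type*} [MeasurableSpace Ω] {P : Measure Ω}
    {Y : Ω → ℝ} (hY : HasGaussianLaw Y P) (h0 : ∫ ω, Y ω ∂P = 0) (f : ℝ → ℝ) (hf : Measurable f) :
    ∫ ω, f (Y ω) ∂P = ∫ x, f (√(Var[Y; P]) * x) ∂(gaussianReal 0 1) := by
  rw [← integral_gaussianReal_scale _ (variance_nonneg _ _) f hf]
  have := hY.map_eq_gaussianReal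
  rw [h0] at this
  rw [← this, integral_map hY.aemeasurable hf.aestronglyMeasurable]

/-- Diagonalisation of a centred Gaussian vector: its squared norm is a sum of squares of
independent Gaussian variables. -/
lemma exists_independent_coordinates {Ω : Type*} [MeasurableSpace Ω] {P : Measure Ω}
    {n : ℕ} {W : Fin n → Ω → ℝ}
    (hW : HasGaussianLaw (fun ω i => W i ω) P) (h0 : ∀ i, ∫ ω, W i ω ∂P = 0)
    {Λ : ℝ} (hΛ : ∀ x : Fin n → ℝ, Var[fun ω => ∑ i, x i * W i ω; P] ≤ Λ * ∑ i, x i ^ 2) :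
    ∃ Y : Fin n → Ω → ℝ, (∀ i, HasGaussianLaw (Y i) P) ∧ (∀ i, ∫ ω, Y i ω ∂P = 0) ∧
      iIndepFun Y P ∧ (∀ i, Var[Y i; P] ≤ Λ) ∧ ∀ ω, ∑ i, Y i ω ^ 2 = ∑ i, W i ω ^ 2 := by
  classical
  have hP : IsProbabilityMeasure P := hW.isProbabilityMeasure
  have hWL : ∀ i, MemLp (W i) 2 P := fun i => (hW.eval i).memLp_two
  let G : Matrix (Fin n) (Fin n) ℝ := Matrix.of fun i j => cov[W i, W j; P]
  have hG : G.IsHermitian := by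
    ext i j
    simp [G, covariance_comm]
  let u := hG.eigenvectorBasis
  let Y : Fin n → Ω → ℝ := fun k ω => ∑ i, u k i * W i ω
  have hYg : HasGaussianLaw (fun ω k => Y k ω) P := by
    let L : (Fin n → ℝ) →L[ℝ] (Fin n → ℝ) :=
      ContinuousLinearMap.pi fun k => ∑ i, (u k i) • ContinuousLinearMap.proj i
    have := hW.map L
    convert! this using 1
    ext ω k
    simp [L, Y]
  have hYcov : ∀ k l, cov[Y k, Y l; P] = ∑ i, ∑ j, u k i * u l j * G i j := by
    intro k l
    have : cov[Y k, Y l; P] = cov[fun ω => ∑ i, u k i * W i ω, fun ω => ∑ i, u l i * W i ω; P] := rfl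
    rw [this, covariance_fun_sum_fun_sum (fun i => (hWL i).const_mul _)
      (fun i => (hWL i).const_mul _)]
    refine Finset.sum_congr rfl fun i _ => Finset.sum_congr rfl fun j _ => ?_
    rw [covariance_const_mul_left, covariance_const_mul_right]
    simp [G]; ring
  have horth : ∀ k l, ∑ i, u k i * u l i = if k = l then 1 else 0 := by
    intro k l
    have := (orthonormal_iff_ite.mp u.orthonormal) k l
    rw [← this, PiLp.inner_apply]
    simp [mul_comm]
  refine ⟨Y, fun i => hYg.eval i, ?_, ?_, ?_, ?_⟩
  · intro k
    simp only [Y]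
    rw [integral_finsetSum _ fun i _ => ((hWL i).integrable (by norm_num)).const_mul _]
    simp [integral_const_mul, h0]
  -- Jointly Gaussian variables are independent once uncorrelated, and the covariance of two
  -- coordinates is an eigenvalue times the inner product of two eigenvectors.
  · refine HasGaussianLaw.iIndepFun_of_covariance_eq_zero hYg fun k l hkl => ?_
    rw [hYcov]
    have h1 : ∀ i, ∑ j, u l j * G i j = hG.eigenvalues l * u l i := by
      intro i
      have := congrFun (hG.mulVec_eigenvectorBasis l) i
      simp only [Matrix.mulVec, dotProduct, Pi.smul_apply, smul_eq_mul] at this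
      rw [← this]
      exact Finset.sum_congr rfl fun j _ => mul_comm _ _
    have h2 : ∀ i, ∑ j, u k i * u l j * G i j = hG.eigenvalues l * (u k i * u l i) := by
      intro i
      simp_rw [mul_assoc]
      rw [← Finset.mul_sum, h1]; ring
    simp_rw [h2]
    rw [← Finset.mul_sum, horth, if_neg hkl, mul_zero]
  -- The hypothesis on `Λ` is tested on the unit vector `u k`.
  · intro k
    have := hΛ (fun i => u k i)
    have h1 := horth k k
    simp only [if_true] at h1
    simp_rw [sq] at this
    rw [h1, mul_one] at this
    exact this
  · intro ω
    have h1 := u.sum_sq_norm_inner_right (WithLp.toLp 2 fun i => W i ω)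
    rw [EuclideanSpace.norm_sq_eq] at h1
    simp only [PiLp.inner_apply, Real.norm_eq_abs, sq_abs] at h1
    rw [← h1]
    refine Finset.sum_congr rfl fun k _ => ?_
    simp only [Y]
    congr 1
    refine Finset.sum_congr rfl fun i _ => ?_
    simp [mul_comm]

end Gaussian

/-! ### Pointwise and moment bounds for logarithms -/

section LogMoments

/-- For `z ≥ 1/2` the bounds `1 - z⁻¹ ≤ log z ≤ z - 1` differ by `z⁻¹ (z - 1)² ≤ 2 (z - 1)²`. For `z
< 1/2` no expansion is available, but then `4 (z - 1)² ≥ 1`, so the crude bound `v` may be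
multiplied by this factor. -/
lemma log_taylor_bounds {z v : ℝ} (hz : 0 < z) (hv0 : 0 ≤ v) (hv : -v ≤ Real.log z) :
    |Real.log z - (z - 1)| ≤ 8 * ((1 + v ^ 2) * (z - 1) ^ 2) ∧
    Real.log z ^ 2 ≤ 8 * ((1 + v ^ 2) * (z - 1) ^ 2) := by
  have h1 := Real.log_le_sub_one_of_pos hz
  have h2 := Real.one_sub_inv_le_log_of_pos hz
  have hq : 0 ≤ v ^ 2 * (z - 1) ^ 2 := by positivity
  have hq' := sq_nonneg (z - 1)
  rw [abs_sub_comm, abs_of_nonneg (by linarith)]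
  rcases le_or_gt (1 / 2) z with hz2 | hz2
  · have hi : z⁻¹ ≤ 2 := by
      rw [inv_le_comm₀ hz (by norm_num)]; linarith
    have h3 : z - 1 - (1 - z⁻¹) = z⁻¹ * (z - 1) ^ 2 := by field_simp
    have h4 : z⁻¹ * (z - 1) ^ 2 ≤ 2 * (z - 1) ^ 2 := by gcongr
    refine ⟨by nlinarith, ?_⟩
    have h5 : 1 - z⁻¹ = z⁻¹ * (z - 1) := by field_simp
    have h6 : |Real.log z| ≤ 2 * |z - 1| := by
      rw [abs_le]
      have h7 : |z⁻¹ * (z - 1)| ≤ 2 * |z - 1| := by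
        rw [abs_mul, abs_of_pos (inv_pos.mpr hz)]; gcongr
      have := neg_abs_le (z⁻¹ * (z - 1))
      have := le_abs_self (z - 1)
      have := abs_nonneg (z - 1)
      constructor <;> linarith
    have h8 : Real.log z ^ 2 ≤ (2 * |z - 1|) ^ 2 := by
      rw [← sq_abs (Real.log z)]; gcongr
    rw [mul_pow, sq_abs] at h8
    nlinarith
  · have h3 : 1 ≤ 4 * (z - 1) ^ 2 := by nlinarith
    have h5 : v ^ 2 ≤ v ^ 2 * (4 * (z - 1) ^ 2) := le_mul_of_one_le_right (sq_nonneg v) h3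
    have h7 : Real.log z ^ 2 ≤ v ^ 2 := by
      have : Real.log z ≤ 0 := by linarith
      nlinarith
    refine ⟨?_, by nlinarith⟩
    have : v ≤ 1 + v ^ 2 := by nlinarith [sq_nonneg (v - 1)]
    nlinarith

/-- The logarithm of an average dominates the average of the logarithms. -/
lemma neg_mean_abs_log_le_log_mean {n : ℕ} (hn : n ≠ 0) (y : Fin n → ℝ) (hy : ∀ i, 0 < y i) :
    -((n : ℝ)⁻¹ * ∑ i, |Real.log (y i)|) ≤ Real.log ((n : ℝ)⁻¹ * ∑ i, y i) := by
  have hn' : (n : ℝ) ≠ 0 := by exact_mod_cast hn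
  have h := strictConcaveOn_log_Ioi.concaveOn.le_map_sum (t := Finset.univ)
    (w := fun _ : Fin n => (n : ℝ)⁻¹) (p := y) (fun _ _ => by positivity)
    (by simp [hn']) (fun i _ => hy i)
  simp only [smul_eq_mul, ← Finset.mul_sum] at h
  refine le_trans ?_ h
  rw [← mul_neg, ← Finset.sum_neg_distrib]
  gcongr
  exact neg_abs_le _

lemma mean_pow_four_le {n : ℕ} (hn : n ≠ 0) (y : Fin n → ℝ) (hy : ∀ i, 0 ≤ y i) :
    ((n : ℝ)⁻¹ * ∑ i, y i) ^ 4 ≤ (n : ℝ)⁻¹ * ∑ i, y i ^ 4 := by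
  have hn' : (n : ℝ) ≠ 0 := by exact_mod_cast hn
  have h := Real.pow_arith_mean_le_arith_mean_pow Finset.univ
    (fun _ : Fin n => (n : ℝ)⁻¹) y (fun _ _ => by positivity)
    (by simp [hn']) (fun i _ => hy i) 4
  simpa only [← Finset.mul_sum] using h

/-- With `u = |x|^{1/8}`, the logarithm is at most `u` or `u⁻¹` in absolute value. The exponent 1/8
makes the fourth power cost only `|x|^{±1/2}`, and both powers have a finite Gaussian mean. -/
lemma abs_log_sq_pow_four_le {x : ℝ} (hx : x ≠ 0) :
    |Real.log (x ^ 2)| ^ 4 ≤ 16 ^ 4 * (|x| ^ (1 / 2 : ℝ) + |x| ^ (-(1 / 2) : ℝ)) := by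
  have hx' : 0 < |x| := abs_pos.mpr hx
  have h0 : Real.log (x ^ 2) = 16 * Real.log (|x| ^ (1 / 8 : ℝ)) := by
    rw [Real.log_rpow hx', Real.log_pow, Real.log_abs]; push_cast; ring
  set u := |x| ^ (1 / 8 : ℝ) with hu
  have hu0 : 0 < u := Real.rpow_pos_of_pos hx' _
  have e1 : |x| ^ (1 / 2 : ℝ) = u ^ 4 := by
    rw [hu, ← Real.rpow_natCast, ← Real.rpow_mul hx'.le]; norm_num
  have e2 : |x| ^ (-(1 / 2) : ℝ) = u⁻¹ ^ 4 := by
    rw [hu, ← Real.rpow_neg hx'.le, ← Real.rpow_natCast, ← Real.rpow_mul hx'.le]; norm_num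
  rw [h0, e1, e2, abs_mul, mul_pow, abs_of_pos (by norm_num : (0 : ℝ) < 16)]
  gcongr
  have hi : 0 < u⁻¹ := inv_pos.mpr hu0
  have h1 := Real.log_le_sub_one_of_pos hu0
  have h2 := Real.log_le_sub_one_of_pos hi
  rw [Real.log_inv] at h2
  rcases abs_cases (Real.log u) with ⟨h, h'⟩ | ⟨h, h'⟩
  · have : |Real.log u| ^ 4 ≤ u ^ 4 := by gcongr; linarith
    have : 0 ≤ u⁻¹ ^ 4 := by positivity
    linarith
  · have : |Real.log u| ^ 4 ≤ u⁻¹ ^ 4 := by gcongr; linarith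
    have : 0 ≤ u ^ 4 := by positivity
    linarith

lemma integrable_abs_rpow_gaussianReal {s : ℝ} (hs : -1 < s) :
    Integrable (fun x : ℝ => |x| ^ s) (gaussianReal 0 1) := by
  rw [gaussianReal_of_var_ne_zero _ (by simp)]
  rw [integrable_withDensity_iff (measurable_gaussianPDF _ _) (.of_forall fun _ => gaussianPDF_lt_top)]
  simp only [toReal_gaussianPDF]
  have h := integrable_rpow_mul_exp_neg_mul_sq (b := 1 / 2) (by norm_num) hs
  -- For negative `x` the real power `x ^ s` is not `|x| ^ s`. One of `x ^ s` and `(-x) ^ s` always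
  -- is, so the sum of their norms dominates.
  have h3 : Integrable (fun x : ℝ => |x| ^ s * Real.exp (-(1 / 2) * x ^ 2)) := by
    refine (h.norm.add h.comp_neg.norm).mono' (by fun_prop) (.of_forall fun x => ?_)
    simp only [norm_mul, Real.norm_eq_abs, Real.abs_exp, Pi.add_apply, even_two.neg_pow]
    rw [← add_mul]
    gcongr
    rw [abs_of_nonneg (by positivity)]
    rcases abs_choice x with hx | hx <;> rw [hx]
    · exact (le_abs_self _).trans (le_add_of_nonneg_right (abs_nonneg _))
    · exact (le_abs_self _).trans (le_add_of_nonneg_left (abs_nonneg _))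
  refine (h3.const_mul (√(2 * Real.pi))⁻¹).congr (.of_forall fun x => ?_)
  simp only [gaussianPDFReal, NNReal.coe_one, mul_one, sub_zero]
  rw [show -(1 / 2) * x ^ 2 = -x ^ 2 / 2 by ring]
  ring

lemma integrable_log_sq_pow_four :
    Integrable (fun x : ℝ => |Real.log (x ^ 2)| ^ 4) (gaussianReal 0 1) := by
  have h : Integrable (fun x : ℝ => 16 ^ 4 * (|x| ^ (1 / 2 : ℝ) + |x| ^ (-(1 / 2) : ℝ)))
      (gaussianReal 0 1) :=
    ((integrable_abs_rpow_gaussianReal (by norm_num)).add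
      (integrable_abs_rpow_gaussianReal (by norm_num))).const_mul _
  have hm : Measurable (fun x : ℝ => |Real.log (x ^ 2)| ^ 4) :=
    (Real.measurable_log.comp (measurable_id.pow_const 2)).norm.pow_const 4
  refine h.mono' hm.aestronglyMeasurable (.of_forall fun x => ?_)
  rw [Real.norm_eq_abs, abs_of_nonneg (by positivity)]
  rcases eq_or_ne x 0 with rfl | hx
  · norm_num
  · exact abs_log_sq_pow_four_le hx

end LogMoments

/-! ### The logarithm of a Gaussian empirical variance -/

section LogMeanSquare

/-- Bias and second moment of the logarithm of the normalised mean square of a stationary Gaussian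
vector whose covariance matrix has bounded spectral radius. -/
theorem log_mean_square_bounds (c : ℝ) :
    ∃ D : ℝ, 0 < D ∧ ∀ (Ω : Type*) [MeasurableSpace Ω] (P : Measure Ω) (n : ℕ) (W : Fin n → Ω → ℝ)
      (s : ℝ), n ≠ 0 → 0 < s → HasGaussianLaw (fun ω i => W i ω) P →
      (∀ i, ∫ ω, W i ω ∂P = 0) → (∀ i, Var[W i; P] = s) →
      (∀ x : Fin n → ℝ, Var[fun ω => ∑ i, x i * W i ω; P] ≤ c * s * ∑ i, x i ^ 2) →
      MemLp (fun ω => Real.log ((n : ℝ)⁻¹ * ∑ i, W i ω ^ 2)) 2 P ∧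
      (∀ᵐ ω ∂P, 0 < (n : ℝ)⁻¹ * ∑ i, W i ω ^ 2) ∧
      |∫ ω, (Real.log ((n : ℝ)⁻¹ * ∑ i, W i ω ^ 2) - Real.log s) ∂P| ≤ D / n ∧
      ∫ ω, (Real.log ((n : ℝ)⁻¹ * ∑ i, W i ω ^ 2) - Real.log s) ^ 2 ∂P ≤ D / n := by
  classical
  set a := ∫ x, (x ^ 2 - 1) ^ 2 ∂(gaussianReal 0 1) with ha_def
  set b := ∫ x, (x ^ 2 - 1) ^ 4 ∂(gaussianReal 0 1) with hb_def
  set q := ∫ x, |Real.log (x ^ 2)| ^ 4 ∂(gaussianReal 0 1) with hq_def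
  have ha : 0 ≤ a := integral_nonneg fun x => by positivity
  have hb : 0 ≤ b := integral_nonneg fun x => by positivity
  have hq : 0 ≤ q := integral_nonneg fun x => by positivity
  -- This is `n` times a bound for the mean of the majorant `R` below, obtained from `E V⁴ ≤ q` and
  -- `E (Z - 1)⁴ ≤ (3a² + b)(c/n)²`.
  refine ⟨4 * (2 + 2 * q + (3 * a ^ 2 + b) * c ^ 2), by positivity, ?_⟩
  intro Ω _ P n W s hn hs hW h0 hvar hop
  have hP : IsProbabilityMeasure P := hW.isProbabilityMeasure
  have hn' : (0 : ℝ) < n := by exact_mod_cast Nat.pos_of_ne_zero hn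
  obtain ⟨Y, hY, hY0, hYi, hYv, hYs⟩ := exists_independent_coordinates hW h0 hop
  have hWL : ∀ i p, p ≠ ⊤ → MemLp (W i) p P := fun i p hp => (hW.eval i).memLp hp
  have hWsq : ∀ i, ∫ ω, W i ω ^ 2 ∂P = s := fun i => by
    rw [← variance_of_integral_eq_zero (hWL i 2 (by simp)).aestronglyMeasurable.aemeasurable (h0 i),
      hvar i]
  have hYsq : ∀ i, ∫ ω, Y i ω ^ 2 ∂P = Var[Y i; P] := fun i => by
    rw [variance_of_integral_eq_zero (hY i).aemeasurable (hY0 i)]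
  have hYL : ∀ i p, p ≠ ⊤ → MemLp (Y i) p P := fun i p hp => (hY i).memLp hp
  have hns : 0 < n * s := mul_pos hn' hs
  -- the normalised variances
  set l : Fin n → ℝ := fun i => Var[Y i; P] / (n * s) with hl
  have hl0 : ∀ i, 0 ≤ l i := fun i => div_nonneg (variance_nonneg _ _) hns.le
  have hlc : ∀ i, l i ≤ c / n := fun i => by
    rw [hl, div_le_div_iff₀ hns hn']
    nlinarith [hYv i]
  have hl1 : ∑ i, l i = 1 := by
    simp only [hl, ← Finset.sum_div]
    rw [div_eq_one_iff_eq hns.ne']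
    simp_rw [← hYsq]
    rw [← integral_finsetSum _ fun i _ => (hYL i 2 (by simp)).integrable_sq]
    simp_rw [hYs]
    rw [integral_finsetSum _ fun i _ => (hWL i 2 (by simp)).integrable_sq]
    simp [hWsq]
  set Z : Ω → ℝ := fun ω => (n : ℝ)⁻¹ * ∑ i, W i ω ^ 2 / s with hZ
  have hZY : ∀ ω, Z ω - 1 = ∑ i, (Y i ω ^ 2 / (n * s) - l i) := by
    intro ω
    rw [Finset.sum_sub_distrib, hl1]
    simp only [hZ, ← Finset.sum_div, hYs]
    field_simp
  have hUL : ∀ i, MemLp (fun ω => Y i ω ^ 2 / (n * s) - l i) 4 P := by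
    intro i
    have : ENNReal.HolderTriple 8 8 4 := by
      constructor
      rw [← two_mul, show (8 : ENNReal) = 2 * 4 by norm_num, ENNReal.mul_inv (by simp) (by simp),
        ← mul_assoc, ENNReal.mul_inv_cancel (by simp) (by simp), one_mul]
    have h2 : MemLp (fun ω => Y i ω * Y i ω) 4 P :=
      MemLp.mul' (hYL i 8 (by simp)) (hYL i 8 (by simp))
    have h3 := (h2.const_mul (n * s)⁻¹).sub (memLp_const (l i))
    refine h3.ae_eq (.of_forall fun ω => ?_)
    simp only [Pi.sub_apply]
    rw [sq, div_eq_inv_mul]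
  have hUm : ∀ (i : Fin n) (k : ℕ), ∫ ω, (Y i ω ^ 2 / (n * s) - l i) ^ k ∂P
      = l i ^ k * ∫ x, (x ^ 2 - 1) ^ k ∂(gaussianReal 0 1) := by
    intro i k
    rw [integral_comp_of_hasGaussianLaw (hY i) (hY0 i) (fun x => (x ^ 2 / (n * s) - l i) ^ k)
      (by fun_prop), ← integral_const_mul]
    refine integral_congr_ae (.of_forall fun x => ?_)
    simp only
    rw [mul_pow, Real.sq_sqrt (variance_nonneg _ _), ← mul_pow]
    congr 1
    simp only [hl]; ring
  have hU0 : ∀ i, ∫ ω, (Y i ω ^ 2 / (n * s) - l i) ∂P = 0 := by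
    intro i
    rw [integral_sub ((hYL i 2 (by simp)).integrable_sq.div_const _) (integrable_const _),
      integral_div, hYsq]
    simp [hl]
  have hUi : iIndepFun (fun i ω => Y i ω ^ 2 / (n * s) - l i) P :=
    hYi.comp (fun i x => x ^ 2 / (n * s) - l i) (fun i => by fun_prop)
  -- Each summand of `Z - 1` has the law of `l i * (x² - 1)` with `x` standard Gaussian, so `l`
  -- plays the role of the scale factors.
  have hmom := moments_sum_le (l := l) hUL hUi hU0 ha hb (fun i => by rw [hUm i 2, ← ha_def, mul_comm])
    (fun i => by rw [hUm i 4, ← hb_def]; exact le_of_eq (by ring)) Finset.univ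
  simp_rw [← hZY] at hmom
  have hZ4L : MemLp (fun ω => Z ω - 1) 4 P := by
    simp_rw [hZY]
    exact memLp_finsetSum _ fun i _ => hUL i
  have hZ1 : ∫ ω, (Z ω - 1) ∂P = 0 := by
    simp_rw [hZY]
    rw [integral_finsetSum _ fun i _ => (hUL i).integrable (by norm_num)]
    simp [hU0]
  -- The only use of the spectral radius: the weights `l i` sum to 1 and none exceeds `c / n`.
  have hl2 : ∑ i, l i ^ 2 ≤ c / n := by
    calc ∑ i, l i ^ 2 ≤ ∑ i, c / n * l i :=
          Finset.sum_le_sum fun i _ => by rw [sq]; exact mul_le_mul_of_nonneg_right (hlc i) (hl0 i)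
      _ = c / n := by rw [← Finset.mul_sum, hl1, mul_one]
  have hl2' : 0 ≤ ∑ i, l i ^ 2 := Finset.sum_nonneg fun i _ => sq_nonneg _
  have hZ4 : ∫ ω, (Z ω - 1) ^ 4 ∂P ≤ (3 * a ^ 2 + b) * (c / n) ^ 2 := by
    refine hmom.2.trans ?_
    gcongr
  have hZ4i : Integrable (fun ω => (Z ω - 1) ^ 4) P :=
    (integrable_prod_four hZ4L hZ4L hZ4L hZ4L).congr (.of_forall fun ω => by simp only; ring)
  -- the lower bound of the logarithm
  set V : Ω → ℝ := fun ω => (n : ℝ)⁻¹ * ∑ i, |Real.log (W i ω ^ 2 / s)| with hV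
  have hlogm : Measurable (fun x : ℝ => |Real.log (x ^ 2 / s)| ^ 4) :=
    (Real.measurable_log.comp ((measurable_id.pow_const 2).div_const s)).norm.pow_const 4
  have hlogm' : Measurable (fun x : ℝ => Real.log (x ^ 2 / s)) :=
    Real.measurable_log.comp ((measurable_id.pow_const 2).div_const s)
  have hlaw : ∀ i, P.map (W i) = (gaussianReal 0 1).map (√s * ·) := by
    intro i
    rw [(hW.eval i).map_eq_gaussianReal, h0 i, hvar i, gaussianReal_map_const_mul]
    congr 1
    · simp
    · ext; simp [Real.sq_sqrt hs.le, hs.le]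
  have hcancel : ∀ x : ℝ, (√s * x) ^ 2 / s = x ^ 2 := fun x => by
    rw [mul_pow, Real.sq_sqrt hs.le]; field_simp
  have hLi : ∀ i, Integrable (fun ω => |Real.log (W i ω ^ 2 / s)| ^ 4) P := by
    intro i
    have h1 : Integrable (fun x : ℝ => |Real.log (x ^ 2 / s)| ^ 4) (P.map (W i)) := by
      rw [hlaw i, integrable_map_measure hlogm.aestronglyMeasurable (by fun_prop)]
      refine integrable_log_sq_pow_four.congr (.of_forall fun x => ?_)
      simp [hcancel]
    exact (integrable_map_measure hlogm.aestronglyMeasurable (hW.eval i).aemeasurable).mp h1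
  have hLq : ∀ i, ∫ ω, |Real.log (W i ω ^ 2 / s)| ^ 4 ∂P = q := by
    intro i
    rw [integral_comp_of_hasGaussianLaw (hW.eval i) (h0 i) _ hlogm, hvar i, hq_def]
    simp_rw [hcancel]
  -- Jensen's inequality for the logarithm needs positive entries, and `Real.log 0 = 0` would make
  -- it fail. A Gaussian law of positive variance has no atom at 0.
  have hne : ∀ᵐ ω ∂P, ∀ i, W i ω ≠ 0 := by
    rw [ae_all_iff]
    intro i
    have h1 : ∀ᵐ x ∂(P.map (W i)), x ≠ 0 := by
      have hm : MeasurableSet {x : ℝ | x ≠ 0} := (measurableSet_singleton (0 : ℝ)).compl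
      rw [hlaw i, ae_map_iff (f := fun x : ℝ => √s * x) (by fun_prop) hm]
      have hna : NullSingletonClass (gaussianReal 0 1) :=
        nullSingletonClass_gaussianReal one_ne_zero
      filter_upwards [Measure.ae_ne (gaussianReal 0 1) (0 : ℝ)] with x hx
      exact mul_ne_zero (Real.sqrt_pos.mpr hs).ne' hx
    exact ae_of_ae_map (hW.eval i).aemeasurable h1
  have hVm : AEStronglyMeasurable V P := by
    have : AEMeasurable V P := by
      refine AEMeasurable.const_mul (Finset.aemeasurable_fun_sum _ fun i _ => ?_) _
      exact (hlogm'.comp_aemeasurable (hW.eval i).aemeasurable).norm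
    exact this.aestronglyMeasurable
  have hV4le : ∀ ω, V ω ^ 4 ≤ (n : ℝ)⁻¹ * ∑ i, |Real.log (W i ω ^ 2 / s)| ^ 4 := fun ω =>
    mean_pow_four_le hn _ fun i => abs_nonneg _
  have hSi : Integrable (fun ω => (n : ℝ)⁻¹ * ∑ i, |Real.log (W i ω ^ 2 / s)| ^ 4) P :=
    (integrable_finsetSum _ fun i _ => hLi i).const_mul _
  have hV4i : Integrable (fun ω => V ω ^ 4) P := by
    refine hSi.mono' (hVm.pow 4) (.of_forall fun ω => ?_)
    rw [Real.norm_eq_abs, abs_of_nonneg (by positivity)]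
    exact hV4le ω
  have hV4 : ∫ ω, V ω ^ 4 ∂P ≤ q := by
    refine (integral_mono hV4i hSi hV4le).trans ?_
    rw [integral_const_mul, integral_finsetSum _ fun i _ => hLi i]
    simp [hLq, hn'.ne']
  have hZpos : ∀ᵐ ω ∂P, 0 < Z ω := by
    filter_upwards [hne] with ω hω
    have : Nonempty (Fin n) := ⟨⟨0, Nat.pos_of_ne_zero hn⟩⟩
    refine mul_pos (inv_pos.mpr hn') (Finset.sum_pos (fun i _ => ?_) Finset.univ_nonempty)
    have := hω i
    positivity
  -- Young's inequality with weight `n` separates the product `(1 + V²)(Z - 1)²` of the Taylor bound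
  -- into two terms whose means are both `O(1/n)`.
  set R : Ω → ℝ := fun ω => 4 * ((2 + 2 * V ω ^ 4) / n + n * (Z ω - 1) ^ 4) with hR
  have hRi : Integrable R P :=
    ((((integrable_const (2 : ℝ)).add (hV4i.const_mul 2)).div_const _).add
      (hZ4i.const_mul _)).const_mul 4
  have hRle : ∫ ω, R ω ∂P ≤ 4 * (2 + 2 * q + (3 * a ^ 2 + b) * c ^ 2) / n := by
    have i1 : Integrable (fun ω => 2 + 2 * V ω ^ 4) P :=
      (integrable_const (2 : ℝ)).add (hV4i.const_mul 2)
    simp only [hR]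
    rw [integral_const_mul, integral_add (i1.div_const _) (hZ4i.const_mul _), integral_div,
      integral_add (integrable_const _) (hV4i.const_mul 2), integral_const_mul, integral_const_mul]
    have e : 4 * (2 + 2 * q + (3 * a ^ 2 + b) * c ^ 2) / n
        = 4 * ((2 + 2 * q) / n + n * ((3 * a ^ 2 + b) * (c / n) ^ 2)) := by
      field_simp
    rw [e]
    simp only [integral_const, probReal_univ, smul_eq_mul, one_mul]
    gcongr
  have hZlog : ∀ᵐ ω ∂P, Real.log ((n : ℝ)⁻¹ * ∑ i, W i ω ^ 2) - Real.log s = Real.log (Z ω) := by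
    filter_upwards [hZpos] with ω hω
    have : (n : ℝ)⁻¹ * ∑ i, W i ω ^ 2 = Z ω * s := by
      simp only [hZ, ← Finset.sum_div]; field_simp
    rw [this, Real.log_mul hω.ne' hs.ne']; ring
  have hbd : ∀ᵐ ω ∂P, |Real.log (Z ω) - (Z ω - 1)| ≤ R ω ∧ Real.log (Z ω) ^ 2 ≤ R ω := by
    filter_upwards [hne, hZpos] with ω hω hz
    have hlow : -V ω ≤ Real.log (Z ω) := by
      refine neg_mean_abs_log_le_log_mean hn (fun i => W i ω ^ 2 / s) fun i => ?_
      have := hω i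
      positivity
    have hV0 : 0 ≤ V ω := by simp only [hV]; positivity
    obtain ⟨h1, h2⟩ := log_taylor_bounds hz hV0 hlow
    have h3 : 8 * ((1 + V ω ^ 2) * (Z ω - 1) ^ 2) ≤ R ω := by
      have h4 : 2 * ((1 + V ω ^ 2) * (Z ω - 1) ^ 2)
          ≤ (1 + V ω ^ 2) ^ 2 / n + n * ((Z ω - 1) ^ 2) ^ 2 := by
        have := div_nonneg (sq_nonneg ((1 + V ω ^ 2) - n * (Z ω - 1) ^ 2)) hn'.le
        have e : ((1 + V ω ^ 2) - n * (Z ω - 1) ^ 2) ^ 2 / n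
          = (1 + V ω ^ 2) ^ 2 / n + n * ((Z ω - 1) ^ 2) ^ 2
            - 2 * ((1 + V ω ^ 2) * (Z ω - 1) ^ 2) := by field_simp; ring
        linarith
      have h5 : (1 + V ω ^ 2) ^ 2 / n ≤ (2 + 2 * V ω ^ 4) / n := by
        gcongr
        nlinarith [sq_nonneg (V ω ^ 2 - 1)]
      simp only [hR]
      have e : ((Z ω - 1) ^ 2) ^ 2 = (Z ω - 1) ^ 4 := by ring
      rw [e] at h4
      linarith
    exact ⟨h1.trans h3, h2.trans h3⟩
  have hlogmeas : AEStronglyMeasurable (fun ω => Real.log (Z ω)) P := by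
    have : AEMeasurable Z P := by
      have := hZ4L.aestronglyMeasurable.aemeasurable.add_const 1
      simpa using this
    exact (Real.measurable_log.comp_aemeasurable this).aestronglyMeasurable
  have hsqi : Integrable (fun ω => Real.log (Z ω) ^ 2) P := by
    refine hRi.mono' (hlogmeas.pow 2) ?_
    filter_upwards [hbd] with ω hω
    rw [Real.norm_eq_abs, abs_of_nonneg (sq_nonneg _)]
    exact hω.2
  have hlog2 : MemLp (fun ω => Real.log (Z ω)) 2 P :=
    (memLp_two_iff_integrable_sq hlogmeas).mpr hsqi
  refine ⟨?_, ?_, ?_, ?_⟩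
  · refine (hlog2.add (memLp_const (Real.log s))).ae_eq ?_
    filter_upwards [hZlog] with ω hω
    simp [← hω]
  · filter_upwards [hZpos] with ω hω
    have : (n : ℝ)⁻¹ * ∑ i, W i ω ^ 2 = Z ω * s := by
      simp only [hZ, ← Finset.sum_div]; field_simp
    rw [this]; positivity
  · rw [integral_congr_ae hZlog]
    have i1 : Integrable (fun ω => Real.log (Z ω)) P := hlog2.integrable (by norm_num)
    have i2 : Integrable (fun ω => Z ω - 1) P := hZ4L.integrable (by norm_num)
    -- The linear term has mean zero, so the bias only sees the second order remainder.
    have e : ∫ ω, Real.log (Z ω) ∂P = ∫ ω, (Real.log (Z ω) - (Z ω - 1)) ∂P := by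
      rw [integral_sub i1 i2, hZ1, sub_zero]
    rw [e]
    refine le_trans (abs_integral_le_integral_abs) (le_trans ?_ hRle)
    refine integral_mono_ae (i1.sub i2).abs hRi ?_
    filter_upwards [hbd] with ω hω using hω.1
  · have : ∫ ω, (Real.log ((n : ℝ)⁻¹ * ∑ i, W i ω ^ 2) - Real.log s) ^ 2 ∂P
        = ∫ ω, Real.log (Z ω) ^ 2 ∂P :=
      integral_congr_ae (by filter_upwards [hZlog] with ω hω; rw [hω])
    rw [this]
    refine le_trans ?_ hRle
    refine integral_mono_ae hsqi hRi ?_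
    filter_upwards [hbd] with ω hω using hω.2

end LogMeanSquare

/-! ### Zeros of Fourier transforms and vanishing moments -/

section FourierTransform

lemma norm_exp_neg_I_mul (x y : ℝ) : ‖Complex.exp (-(Complex.I * (x : ℂ) * (y : ℂ)))‖ = 1 := by
  rw [Complex.norm_exp]
  simp

lemma integrable_mul_exp {g : ℝ → ℂ} (hg : Integrable g) (x : ℝ) :
    Integrable (fun t : ℝ => g t * Complex.exp (-(Complex.I * (x : ℂ) * (t : ℂ)))) :=
  hg.mul_bdd (c := 1) (by fun_prop) (.of_forall fun t => (norm_exp_neg_I_mul x t).le)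

/-- If the first `M` moments of `g` at the frequency `η` vanish, the Fourier transform of `g` has
a zero of order `M` at `η`, with explicit constants. -/
lemma norm_fourier_add_le {g : ℝ → ℝ} (hg : Integrable g) {B : ℝ}
    (hs : ∀ t, g t ≠ 0 → |t| ≤ B) (M : ℕ) (η : ℝ)
    (hm : ∀ m < M, ∫ t : ℝ, (g t : ℂ) * (t : ℂ) ^ m *
      Complex.exp (-(Complex.I * (η : ℂ) * (t : ℂ))) = 0) {A x : ℝ} (hx : |x| ≤ A) :
    ‖fourier g (η + x)‖ ≤ B ^ M * Real.exp (A * B) * (∫ t, |g t|) * |x| ^ M := by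
  have hgc : Integrable (fun t => (g t : ℂ)) := hg.ofReal
  have hgm : ∀ m : ℕ, Integrable (fun t : ℝ => (g t : ℂ) * (t : ℂ) ^ m) := by
    intro m
    refine (hg.norm.const_mul (|B| ^ m)).mono' ?_ (.of_forall fun t => ?_)
    · exact hgc.aestronglyMeasurable.mul (by fun_prop)
    · rw [norm_mul, Complex.norm_real, norm_pow, Complex.norm_real, Real.norm_eq_abs t, mul_comm]
      rcases eq_or_ne (g t) 0 with h | h
      · simp [h]
      · have := (hs t h).trans (le_abs_self B)
        gcongr
  have hE := fun m : ℕ => integrable_mul_exp (hgm m) η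
  -- Taylor polynomial of `e^{-ixt}` of degree less than `M` in `t`. The moment conditions make its
  -- contribution vanish, and the remainder is at most `|xt|^M e^{|xt|}`.
  set S : ℝ → ℂ := fun t => ∑ m ∈ Finset.range M, (-(Complex.I * x * t)) ^ m / m.factorial with hS
  have h1 : ∫ t : ℝ, (g t : ℂ) * Complex.exp (-(Complex.I * (η : ℂ) * (t : ℂ))) * S t = 0 := by
    have : ∀ t : ℝ, (g t : ℂ) * Complex.exp (-(Complex.I * (η : ℂ) * (t : ℂ))) * S t
        = ∑ m ∈ Finset.range M, ((-(Complex.I * x)) ^ m / m.factorial) *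
          ((g t : ℂ) * (t : ℂ) ^ m * Complex.exp (-(Complex.I * (η : ℂ) * (t : ℂ)))) := by
      intro t
      rw [hS, Finset.mul_sum]
      refine Finset.sum_congr rfl fun m _ => ?_
      rw [← neg_mul (Complex.I * (x : ℂ)), mul_pow]; ring
    simp_rw [this]
    rw [integral_finsetSum _ fun m _ => (hE m).const_mul _]
    refine Finset.sum_eq_zero fun m hmM => ?_
    rw [integral_const_mul, hm m (Finset.mem_range.mp hmM), mul_zero]
  have hI1 : Integrable (fun t : ℝ =>
      (g t : ℂ) * Complex.exp (-(Complex.I * (η : ℂ) * (t : ℂ))) * S t) := by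
    have : Integrable (fun t : ℝ => ∑ m ∈ Finset.range M, ((-(Complex.I * x)) ^ m / m.factorial) *
          ((g t : ℂ) * (t : ℂ) ^ m * Complex.exp (-(Complex.I * (η : ℂ) * (t : ℂ))))) :=
      integrable_finsetSum _ fun m _ => (hE m).const_mul _
    refine this.congr (.of_forall fun t => ?_)
    simp only [hS, Finset.mul_sum]
    refine Finset.sum_congr rfl fun m _ => ?_
    rw [← neg_mul (Complex.I * (x : ℂ)), mul_pow]; ring
  have hsplit : ∀ t : ℝ, Complex.exp (-(Complex.I * ((η + x : ℝ) : ℂ) * (t : ℂ)))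
      = Complex.exp (-(Complex.I * (η : ℂ) * (t : ℂ))) * Complex.exp (-(Complex.I * x * t)) := by
    intro t
    rw [← Complex.exp_add]; congr 1; push_cast; ring
  have h2 : fourier g (η + x) = ∫ t : ℝ, (g t : ℂ) *
      Complex.exp (-(Complex.I * (η : ℂ) * (t : ℂ))) * (Complex.exp (-(Complex.I * x * t)) - S t) := by
    simp_rw [mul_sub]
    rw [integral_sub _ hI1, h1, sub_zero, fourier]
    · refine integral_congr_ae (.of_forall fun t => ?_)
      simp only
      rw [hsplit]; ring
    · refine (integrable_mul_exp hgc (η + x)).congr (.of_forall fun t => ?_)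
      simp only
      rw [hsplit]; ring
  rw [h2]
  have hbound : ∀ t : ℝ, ‖(g t : ℂ) *
      Complex.exp (-(Complex.I * (η : ℂ) * (t : ℂ))) * (Complex.exp (-(Complex.I * x * t)) - S t)‖
      ≤ B ^ M * Real.exp (A * B) * |x| ^ M * |g t| := by
    intro t
    rw [norm_mul, norm_mul, norm_exp_neg_I_mul, mul_one, Complex.norm_real, Real.norm_eq_abs,
      mul_comm]
    rcases eq_or_ne (g t) 0 with h | h
    · simp [h]
    · gcongr
      have hz : ‖-(Complex.I * (x : ℂ) * (t : ℂ))‖ = |x| * |t| := by simp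
      refine (Complex.norm_exp_sub_sum_le_norm_mul_exp _ M).trans ?_
      rw [hz, mul_pow]
      have ht := hs t h
      have hB := (abs_nonneg t).trans ht
      calc |x| ^ M * |t| ^ M * Real.exp (|x| * |t|) ≤ |x| ^ M * B ^ M * Real.exp (A * B) := by
            gcongr
            exact (abs_nonneg x).trans hx
        _ = _ := by ring
  refine (norm_integral_le_of_norm_le (hg.norm.const_mul _) (.of_forall hbound)).trans ?_
  rw [integral_const_mul]
  simp only [Real.norm_eq_abs]
  exact le_of_eq (by ring)

lemma norm_fourier_le {g : ℝ → ℝ} (x : ℝ) : ‖fourier g x‖ ≤ ∫ t, |g t| := by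
  refine (norm_integral_le_integral_norm _).trans (le_of_eq ?_)
  refine integral_congr_ae (.of_forall fun t => ?_)
  simp only [norm_mul, norm_exp_neg_I_mul, mul_one, Complex.norm_real, Real.norm_eq_abs]

lemma continuous_fourier {g : ℝ → ℝ} (hg : Integrable g) : Continuous (fourier g) := by
  refine continuous_of_dominated (bound := fun t => |g t|) (fun x => ?_) (fun x => ?_) hg.norm ?_
  · exact (integrable_mul_exp hg.ofReal x).aestronglyMeasurable
  · refine .of_forall fun t => ?_
    rw [norm_mul, norm_exp_neg_I_mul, mul_one, Complex.norm_real, Real.norm_eq_abs]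
  · exact .of_forall fun t => by fun_prop

end FourierTransform

/-! ### Periodization and Parseval's identity -/

section Periodization

/-- The integral of a compactly supported function as the integral of its periodization. -/
lemma integral_eq_sum_unit {F : ℝ → ℂ} (hF : Integrable F) {N : ℕ}
    (hs : ∀ t, F t ≠ 0 → |t| ≤ N) :
    ∫ t, F t = ∫ x in (0 : ℝ)..1, ∑ n ∈ Finset.Icc (-(N : ℤ) - 1) N, F (x + n) := by
  rw [intervalIntegral.integral_finsetSum (f := fun (n : ℤ) (x : ℝ) => F (x + n)) fun n _ =>
    (hF.comp_add_right (n : ℝ)).intervalIntegrable]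
  have h := hF.hasSum_intervalIntegral_comp_add_int
  refine h.unique (hasSum_sum_of_ne_finset_zero fun n hn => ?_)
  refine intervalIntegral.integral_zero_ae (.of_forall fun x hx => ?_)
  rw [Set.uIoc_of_le zero_le_one] at hx
  by_contra hne
  have h1 := abs_le.mp (hs _ hne)
  apply hn
  rw [Finset.mem_Icc]
  have h2 : -(N : ℝ) - 1 ≤ n := by linarith [hx.2, h1.1]
  have h3 : (n : ℝ) ≤ N := by linarith [hx.1, h1.2]
  exact ⟨by exact_mod_cast h2, by exact_mod_cast h3⟩

/-- Parseval's identity on the unit interval. -/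
lemma hasSum_parseval {f g : ℝ → ℂ} (hf : MemLp f 2 (volume.restrict (Set.Ioc 0 1)))
    (hg : MemLp g 2 (volume.restrict (Set.Ioc 0 1))) :
    HasSum (fun k : ℤ =>
      (∫ x in (0 : ℝ)..1, f x * Complex.exp (-(Complex.I * ((2 * Real.pi * k : ℝ) : ℂ) * (x : ℂ)))) *
      ∫ x in (0 : ℝ)..1, g x * Complex.exp (Complex.I * ((2 * Real.pi * k : ℝ) : ℂ) * (x : ℂ)))
      (∫ x in (0 : ℝ)..1, f x * g x) := by
  have : Fact ((0 : ℝ) < 1) := ⟨one_pos⟩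
  have hf' : MemLp f 2 (volume.restrict (Set.Ioc (0 : ℝ) (0 + 1))) := by simpa using hf
  -- Conjugating `g` turns the sesquilinear inner product of `L²` into the bilinear integral of `f
  -- g`, and the coefficients of `g` appear at frequency `-k`.
  have hg' : MemLp (fun x => star (g x)) 2 (volume.restrict (Set.Ioc (0 : ℝ) (0 + 1))) := by
    rw [zero_add]; exact hg.star
  have hF := hf'.memLp_liftIoc.haarAddCircle
  have hG := hg'.memLp_liftIoc.haarAddCircle
  have hcoef : ∀ (u : ℝ → ℂ) (k : ℤ), fourierCoeff (AddCircle.liftIoc 1 0 u) k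
      = ∫ x in (0 : ℝ)..1, u x *
        Complex.exp (-(Complex.I * ((2 * Real.pi * k : ℝ) : ℂ) * (x : ℂ))) := by
    intro u k
    rw [fourierCoeff_liftIoc_eq, fourierCoeffOn_eq_integral]
    simp only [zero_add, sub_zero, one_div, inv_one, one_smul]
    refine intervalIntegral.integral_congr fun x _ => ?_
    rw [_root_.fourier_coe_apply, smul_eq_mul, mul_comm]
    congr 2
    push_cast
    ring
  have h := (fourierBasis (T := (1 : ℝ))).hasSum_inner_mul_inner (hG.toLp _) (hF.toLp _)
  have e : ∀ k : ℤ, inner ℂ (hG.toLp _) (fourierBasis (T := (1 : ℝ)) k) *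
      inner ℂ (fourierBasis (T := (1 : ℝ)) k) (hF.toLp _)
      = (∫ x in (0 : ℝ)..1, f x *
          Complex.exp (-(Complex.I * ((2 * Real.pi * k : ℝ) : ℂ) * (x : ℂ)))) *
      ∫ x in (0 : ℝ)..1, g x * Complex.exp (Complex.I * ((2 * Real.pi * k : ℝ) : ℂ) * (x : ℂ)) := by
    intro k
    rw [← inner_conj_symm, ← HilbertBasis.repr_apply_apply, ← HilbertBasis.repr_apply_apply,
      fourierBasis_repr, fourierBasis_repr, fourierCoeff_congr_ae hG.coeFn_toLp,
      fourierCoeff_congr_ae hF.coeFn_toLp, hcoef, hcoef, mul_comm]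
    congr 1
    rw [intervalIntegral.integral_of_le zero_le_one, intervalIntegral.integral_of_le zero_le_one,
      ← integral_conj]
    refine integral_congr_ae (.of_forall fun x => ?_)
    simp only
    rw [map_mul, ← Complex.exp_conj]
    congr 1
    · simp
    · congr 1
      simp only [map_neg, map_mul, Complex.conj_I, Complex.conj_ofReal]
      ring
  simp_rw [e] at h
  convert! h using 1
  rw [L2.inner_def]
  have e2 : ∀ᵐ t ∂(AddCircle.haarAddCircle (T := (1 : ℝ))),
      inner ℂ ((hG.toLp _ : Lp ℂ 2 (AddCircle.haarAddCircle (T := (1 : ℝ)))) t)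
        ((hF.toLp _ : Lp ℂ 2 (AddCircle.haarAddCircle (T := (1 : ℝ)))) t)
      = AddCircle.liftIoc 1 0 (fun x => f x * g x) t := by
    filter_upwards [hG.coeFn_toLp, hF.coeFn_toLp] with t h1 h2
    rw [h1, h2]
    simp [AddCircle.liftIoc]
  rw [integral_congr_ae e2, AddCircle.integral_haarAddCircle,
    AddCircle.integral_liftIoc_eq_intervalIntegral]
  simp

end Periodization

/-! ### Polynomial reproduction and the Strang-Fix conditions -/

section StrangFix

lemma finite_support_shift {φ : ℝ → ℝ} {T : ℕ} (hφ : Function.support φ ⊆ Set.Ioo (-(T : ℝ)) 0)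
    (t : ℝ) : {k : ℤ | φ (t - k) ≠ 0}.Finite := by
  refine (Set.finite_Icc ⌊t⌋ ⌈t + T⌉).subset fun k hk => ?_
  have := hφ hk
  simp only [Set.mem_Ioo] at this
  constructor
  · exact_mod_cast (Int.floor_le t).trans (by linarith [this.2] : t ≤ (k : ℝ))
  · have := (by linarith [this.1] : (k : ℝ) ≤ t + T).trans (Int.le_ceil _)
    exact_mod_cast this

lemma summable_mul_shift {φ : ℝ → ℝ} {T : ℕ} (hφ : Function.support φ ⊆ Set.Ioo (-(T : ℝ)) 0)
    (t : ℝ) (c : ℤ → ℝ) : Summable fun k : ℤ => c k * φ (t - k) := by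
  refine summable_of_hasFiniteSupport ((finite_support_shift hφ t).subset fun k hk => ?_)
  exact right_ne_zero_of_mul hk

/-- The shifts of `φ` reproduce polynomials, so the periodizations of `t ^ m φ(t)` are constant. -/
lemma exists_const_periodization {φ : ℝ → ℝ} {T M : ℕ}
    (hφ : Function.support φ ⊆ Set.Ioo (-(T : ℝ)) 0)
    (hp : ∀ m : ℕ, m < M → ∃ p : Polynomial ℝ, p.degree = (m : WithBot ℕ) ∧
      ∀ᵐ t : ℝ, ∑' k : ℤ, (k : ℝ) ^ m * φ (t - k) = p.eval t) {m : ℕ} (hm : m < M) :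
    ∃ c : ℝ, ∀ᵐ t : ℝ, ∑' k : ℤ, (t - k) ^ m * φ (t - k) = c := by
  choose! p _ hp using hp
  set q : Polynomial ℝ := ∑ i ∈ Finset.range (m + 1),
    Polynomial.X ^ i * (Polynomial.C ((-1) ^ (m - i) * (m.choose i : ℝ)) * p (m - i)) with hq
  set u : ℝ → ℝ := fun t => ∑' k : ℤ, (t - k) ^ m * φ (t - k) with hu
  -- The sum `u` is 1-periodic by construction, and a polynomial almost everywhere by the binomial
  -- expansion. A polynomial with these properties is constant.
  have hper : ∀ (t : ℝ) (n : ℤ), u (t + n) = u t := by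
    intro t n
    simp only [hu]
    rw [← (Equiv.addRight n).tsum_eq]
    refine tsum_congr fun k => ?_
    simp
  have huq : ∀ᵐ t : ℝ, u t = q.eval t := by
    have hall : ∀ᵐ t : ℝ, ∀ i ≤ m, ∑' k : ℤ, (k : ℝ) ^ i * φ (t - k) = (p i).eval t := by
      rw [ae_all_iff]
      intro i
      by_cases hi : i ≤ m
      · filter_upwards [hp i (by omega)] with t ht _ using ht
      · exact .of_forall fun t h => absurd h hi
    filter_upwards [hall] with t ht
    simp only [hu, hq, Polynomial.eval_finsetSum, Polynomial.eval_mul, Polynomial.eval_pow,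
      Polynomial.eval_X, Polynomial.eval_C]
    have e : ∀ k : ℤ, (t - k) ^ m * φ (t - k) = ∑ i ∈ Finset.range (m + 1),
        (t ^ i * ((-1) ^ (m - i) * (m.choose i : ℝ)) * (k : ℝ) ^ (m - i)) * φ (t - k) := by
      intro k
      rw [sub_eq_add_neg, add_pow, ← Finset.sum_mul, ← sub_eq_add_neg]
      congr 1
      refine Finset.sum_congr rfl fun i _ => ?_
      rw [neg_pow]; ring
    simp_rw [e]
    rw [Summable.tsum_finsetSum fun i _ => summable_mul_shift hφ t _]
    refine Finset.sum_congr rfl fun i _ => ?_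
    rw [← ht (m - i) (by omega), ← tsum_mul_left, ← tsum_mul_left]
    refine tsum_congr fun k => ?_
    ring
  -- The identity with `q` holds only almost everywhere; a single point `t₀` good for all its
  -- integer translates gives infinitely many points where `q` takes one value.
  have hall : ∀ᵐ t : ℝ, ∀ n : ℤ, u (t + n) = q.eval (t + n) := by
    rw [ae_all_iff]
    intro n
    exact (measurePreserving_add_right volume (n : ℝ)).quasiMeasurePreserving.ae huq
  obtain ⟨t₀, h₀⟩ := hall.exists
  have hconst : q = Polynomial.C (q.eval t₀) := by
    have h1 := h₀ 0
    simp only [Int.cast_zero, add_zero] at h1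
    refine Polynomial.eq_of_infinite_eval_eq _ _ ?_
    refine (Set.infinite_range_of_injective (f := fun n : ℤ => t₀ + n) ?_).mono ?_
    · intro a b hab; simpa using hab
    · rintro _ ⟨n, rfl⟩
      simp only [Set.mem_ofPred_eq, Polynomial.eval_C]
      rw [← h₀ n, hper, h1]
  refine ⟨q.eval t₀, ?_⟩
  filter_upwards [huq] with t ht
  refine ht.trans ?_
  rw [hconst]; simp

/-- The Strang-Fix conditions. -/
lemma strang_fix {φ : ℝ → ℝ} {T M : ℕ} (hφi : Integrable φ)
    (hφ : Function.support φ ⊆ Set.Ioo (-(T : ℝ)) 0)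
    (hp : ∀ m : ℕ, m < M → ∃ p : Polynomial ℝ, p.degree = (m : WithBot ℕ) ∧
      ∀ᵐ t : ℝ, ∑' k : ℤ, (k : ℝ) ^ m * φ (t - k) = p.eval t) {m : ℕ} (hm : m < M)
    {k : ℤ} (hk : k ≠ 0) :
    ∫ t : ℝ, (φ t : ℂ) * (t : ℂ) ^ m *
      Complex.exp (-(Complex.I * ((2 * Real.pi * k : ℝ) : ℂ) * (t : ℂ))) = 0 := by
  obtain ⟨c, hc⟩ := exists_const_periodization hφ hp hm
  have hs : ∀ t, φ t ≠ 0 → |t| ≤ T := fun t ht => by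
    have := hφ ht
    rw [abs_le]; constructor <;> linarith [this.1, this.2, (Nat.cast_nonneg T : (0 : ℝ) ≤ T)]
  have hFi : Integrable (fun t : ℝ => (φ t : ℂ) * (t : ℂ) ^ m) := by
    refine (hφi.norm.const_mul ((T : ℝ) ^ m)).mono' ?_ (.of_forall fun t => ?_)
    · exact hφi.ofReal.aestronglyMeasurable.mul (by fun_prop)
    · rw [norm_mul, Complex.norm_real, norm_pow, Complex.norm_real, Real.norm_eq_abs t, mul_comm]
      rcases eq_or_ne (φ t) 0 with h | h
      · simp [h]
      · have := hs t h
        gcongr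
  have hint := integrable_mul_exp hFi (2 * Real.pi * k)
  -- The integral is the `k`-th Fourier coefficient of the periodization of `t^m φ(t)`. That
  -- periodization is the constant `c`, so the coefficient vanishes for `k ≠ 0`.
  rw [integral_eq_sum_unit (N := T) hint fun t ht => hs t fun h0 => ht (by simp [h0])]
  have hexp : ∀ (x : ℝ) (n : ℤ), Complex.exp (-(Complex.I * ((2 * Real.pi * k : ℝ) : ℂ) *
      ((x + n : ℝ) : ℂ))) = Complex.exp (-(Complex.I * ((2 * Real.pi * k : ℝ) : ℂ) * (x : ℂ))) := by
    intro x n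
    rw [Complex.exp_eq_exp_iff_exists_int]
    exact ⟨-(k * n), by push_cast; ring⟩
  have hae : ∀ᵐ x : ℝ, x ∈ Set.uIoc (0 : ℝ) 1 →
      ∑ n ∈ Finset.Icc (-(T : ℤ) - 1) T, ((φ (x + n) : ℂ) * ((x + n : ℝ) : ℂ) ^ m *
        Complex.exp (-(Complex.I * ((2 * Real.pi * k : ℝ) : ℂ) * ((x + n : ℝ) : ℂ)))) =
      (c : ℂ) * Complex.exp (-(Complex.I * ((2 * Real.pi * k : ℝ) : ℂ)) * (x : ℂ)) := by
    filter_upwards [hc] with x hx hx01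
    simp_rw [hexp, ← Finset.sum_mul, neg_mul]
    congr 1
    rw [← hx]
    rw [← (Equiv.neg ℤ).tsum_eq, tsum_eq_sum (s := Finset.Icc (-(T : ℤ) - 1) T)]
    · push_cast
      refine Finset.sum_congr rfl fun n _ => ?_
      simp [mul_comm]
    · intro n hn
      rw [Set.uIoc_of_le zero_le_one] at hx01
      by_contra hne
      have h1 := abs_le.mp (hs _ (right_ne_zero_of_mul hne))
      simp only [Equiv.neg_apply, Int.cast_neg, sub_neg_eq_add] at h1
      apply hn
      rw [Finset.mem_Icc]
      have h2 : -(T : ℝ) - 1 ≤ n := by linarith [hx01.2, h1.1]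
      have h3 : (n : ℝ) ≤ T := by linarith [hx01.1, h1.2]
      exact ⟨by exact_mod_cast h2, by exact_mod_cast h3⟩
  rw [intervalIntegral.integral_congr_ae hae, intervalIntegral.integral_const_mul,
    integral_exp_mul_complex]
  · have e : Complex.exp (-(Complex.I * ((2 * Real.pi * k : ℝ) : ℂ)) * ((1 : ℝ) : ℂ)) = 1 := by
      rw [Complex.exp_eq_one_iff]
      exact ⟨-k, by push_cast; ring⟩
    rw [e]
    simp
  · have := Real.pi_ne_zero
    simp [hk]

end StrangFix

/-! ### Aliasing expansion of the transfer functions -/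

section TransferFunction

/-- Expansion of the transfer functions in terms of the Fourier transforms of `φ` and `ψ`. -/
lemma hasSum_transferFunction {φ ψ : ℝ → ℝ} {T : ℕ} (hφ2 : MemLp φ 2) (hψ2 : MemLp ψ 2)
    (hφi : Integrable φ) (hψi : Integrable ψ)
    (hφ : Function.support φ ⊆ Set.Ioo (-(T : ℝ)) 0) (hψ : Function.support ψ ⊆ Set.Ioo 0 (T : ℝ))
    (j : ℕ) (x : ℝ) :
    HasSum (fun k : ℤ => fourier φ (x + 2 * Real.pi * k) *
      ((((2 : ℝ) ^ j : ℝ) : ℂ) * starRingEnd ℂ (fourier ψ (2 ^ j * (x + 2 * Real.pi * k)))))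
      ((((2 : ℝ) ^ ((j : ℝ) / 2) : ℝ) : ℂ) * transferFunction φ ψ j x) := by
  set N : ℕ := 2 ^ j * T with hN
  have h2j : (0 : ℝ) < 2 ^ j := by positivity
  have hsφ : ∀ t, φ t ≠ 0 → -(T : ℝ) < t ∧ t < 0 := fun t ht => hφ ht
  have hsψ : ∀ t, ψ (t / 2 ^ j) ≠ 0 → 0 < t ∧ t < N := fun t ht => by
    obtain ⟨h1, h2⟩ := hψ ht
    rw [div_lt_iff₀ h2j] at h2
    refine ⟨by simpa [h2j] using h1, ?_⟩
    rw [hN]; push_cast; linarith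
  have hψd2 : MemLp (fun t => ψ (t / 2 ^ j)) 2 :=
    (memLp_two_iff_integrable_sq (hψi.comp_div h2j.ne').aestronglyMeasurable).mpr
      (hψ2.integrable_sq.comp_div h2j.ne')
  -- The functions `f` and `g` agree on `(0, 1]` with the periodizations of `φ(t) e^{-ixt}` and
  -- `ψ(2^{-j} t) e^{ixt}`. Their Fourier coefficients are values of `φ̂` and `conj ψ̂`, and
  -- Parseval's identity for `f g` is the claim.
  set f : ℝ → ℂ := fun t => ∑ l ∈ Finset.Icc (-(T : ℤ) - 1) T,
    (φ (t + l) : ℂ) * Complex.exp (-(Complex.I * (x : ℂ) * ((t + l : ℝ) : ℂ))) with hf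
  set g : ℝ → ℂ := fun t => ∑ n ∈ Finset.Icc (-(N : ℤ) - 1) N,
    (ψ ((t + n) / 2 ^ j) : ℂ) * Complex.exp (-(Complex.I * ((-x : ℝ) : ℂ) * ((t + n : ℝ) : ℂ)))
    with hg
  have hmul : ∀ (u : ℝ → ℝ) (y : ℝ), MemLp u 2 → MemLp (fun t : ℝ => (u t : ℂ) *
      Complex.exp (-(Complex.I * (y : ℂ) * (t : ℂ)))) 2 := by
    intro u y hu
    have huc : MemLp (fun t => (u t : ℂ)) 2 := hu.ofReal
    refine huc.of_le (huc.aestronglyMeasurable.mul (by fun_prop)) (.of_forall fun t => ?_)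
    rw [norm_mul, norm_exp_neg_I_mul, mul_one]
  have hf2 : MemLp f 2 (volume.restrict (Set.Ioc 0 1)) := by
    refine memLp_finsetSum _ fun l _ => MemLp.restrict _ ?_
    exact (hmul φ x hφ2).comp_measurePreserving (measurePreserving_add_right volume (l : ℝ))
  have hg2 : MemLp g 2 (volume.restrict (Set.Ioc 0 1)) := by
    refine memLp_finsetSum _ fun l _ => MemLp.restrict _ ?_
    exact (hmul _ (-x) hψd2).comp_measurePreserving (measurePreserving_add_right volume (l : ℝ))
  have hexp : ∀ (y : ℝ) (k n : ℤ), Complex.exp (-(Complex.I * ((2 * Real.pi * k : ℝ) : ℂ) *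
      ((y + n : ℝ) : ℂ))) = Complex.exp (-(Complex.I * ((2 * Real.pi * k : ℝ) : ℂ) * (y : ℂ))) := by
    intro x k n
    rw [Complex.exp_eq_exp_iff_exists_int]
    exact ⟨-(k * n), by push_cast; ring⟩
  have hf1 : ∀ k : ℤ, ∫ t in (0 : ℝ)..1, f t *
      Complex.exp (-(Complex.I * ((2 * Real.pi * k : ℝ) : ℂ) * (t : ℂ)))
      = fourier φ (x + 2 * Real.pi * k) := by
    intro k
    have hφc : Integrable (fun t => (φ t : ℂ)) := hφi.ofReal
    rw [fourier, integral_eq_sum_unit (N := T) (integrable_mul_exp hφc (x + 2 * Real.pi * k))]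
    · refine intervalIntegral.integral_congr fun t _ => ?_
      simp only [hf]
      rw [Finset.sum_mul]
      refine Finset.sum_congr rfl fun l _ => ?_
      rw [← hexp t k l, mul_assoc, ← Complex.exp_add]
      congr 2
      push_cast; ring
    · intro t ht
      have h0 : φ t ≠ 0 := fun h0 => ht (by simp [h0])
      obtain ⟨h1, h2⟩ := hsφ t h0
      rw [abs_le]; constructor <;> linarith
  have hg1 : ∀ k : ℤ, ∫ t in (0 : ℝ)..1, g t *
      Complex.exp (Complex.I * ((2 * Real.pi * k : ℝ) : ℂ) * (t : ℂ))
      = (((2 : ℝ) ^ j : ℝ) : ℂ) * starRingEnd ℂ (fourier ψ (2 ^ j * (x + 2 * Real.pi * k))) := by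
    intro k
    have hψc : Integrable (fun t => (ψ (t / 2 ^ j) : ℂ)) := (hψi.comp_div h2j.ne').ofReal
    have hi := integrable_mul_exp hψc (-(x + 2 * Real.pi * k))
    have e1 : starRingEnd ℂ (fourier ψ (2 ^ j * (x + 2 * Real.pi * k)))
        = ∫ t : ℝ, (ψ t : ℂ) * Complex.exp (-(Complex.I *
          ((-(x + 2 * Real.pi * k) : ℝ) : ℂ) * ((t * 2 ^ j : ℝ) : ℂ))) := by
      rw [fourier, ← integral_conj]
      refine integral_congr_ae (.of_forall fun t => ?_)
      simp only
      rw [map_mul, ← Complex.exp_conj, Complex.conj_ofReal]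
      congr 2
      simp only [map_neg, map_mul, Complex.conj_I, Complex.conj_ofReal]
      push_cast; ring
    have e2 := Measure.integral_comp_div (fun t : ℝ => (ψ t : ℂ) * Complex.exp (-(Complex.I *
          ((-(x + 2 * Real.pi * k) : ℝ) : ℂ) * ((t * 2 ^ j : ℝ) : ℂ)))) ((2 : ℝ) ^ j)
    rw [abs_of_pos h2j] at e2
    rw [e1, ← Complex.real_smul, ← e2]
    simp_rw [div_mul_cancel₀ _ h2j.ne']
    rw [integral_eq_sum_unit (N := N) hi]
    · refine intervalIntegral.integral_congr fun t _ => ?_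
      simp only [hg]
      rw [Finset.sum_mul]
      refine Finset.sum_congr rfl fun l _ => ?_
      have := hexp t (-k) l
      have e3 : Complex.exp (Complex.I * ((2 * Real.pi * k : ℝ) : ℂ) * (t : ℂ))
        = Complex.exp (-(Complex.I * ((2 * Real.pi * (-k : ℤ) : ℝ) : ℂ) * (t : ℂ))) := by
        congr 1; push_cast; ring
      rw [e3, ← this, mul_assoc, ← Complex.exp_add]
      congr 2
      push_cast; ring
    · intro t ht
      have h0 : ψ (t / 2 ^ j) ≠ 0 := fun h0 => ht (by simp [h0])
      obtain ⟨h1, h2⟩ := hsψ t h0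
      rw [abs_le]; constructor <;> linarith
  have hP := hasSum_parseval hf2 hg2
  simp_rw [hf1, hg1] at hP
  convert! hP using 1
  -- The lags at which the supports of `φ(· + l)` and of the dilated wavelet can meet.
  set D : Finset ℤ := Finset.Icc (-(N : ℤ) - T) 0 with hD
  have hDout : ∀ t : ℝ, ∀ l : ℤ, l ∉ D → φ (t + l) * ψ (t / 2 ^ j) = 0 := by
    intro t l hl
    by_contra hne
    obtain ⟨h1, h2⟩ := hsφ _ (left_ne_zero_of_mul hne)
    obtain ⟨h3, h4⟩ := hsψ _ (right_ne_zero_of_mul hne)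
    apply hl
    rw [hD, Finset.mem_Icc]
    have h5 : -(N : ℝ) - T ≤ l := by linarith
    have h6 : (l : ℝ) ≤ 0 := by linarith
    exact ⟨by exact_mod_cast h5, by exact_mod_cast h6⟩
  set G : ℤ → ℝ → ℂ := fun l t => ((φ (t + l) * ψ (t / 2 ^ j) : ℝ) : ℂ) *
    Complex.exp (-(Complex.I * (x : ℂ) * (l : ℂ))) with hG
  have hGi : ∀ l, Integrable (G l) := fun l =>
    (((hφ2.comp_measurePreserving (measurePreserving_add_right volume (l : ℝ))).integrable_mul
      hψd2).ofReal).mul_const _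
  -- In the double sum over two translations only the difference `l` affects the phase. Summing over
  -- the common translation `n` recovers the integral over the line that defines `h_{j,l}`.
  have hfg : ∀ t ∈ Set.uIcc (0 : ℝ) 1, t ∈ Set.Ioc (0 : ℝ) 1 → f t * g t =
      ∑ l ∈ D, ∑ n ∈ Finset.Icc (-(N : ℤ) - 1) N, G l (t + n) := by
    intro t _ ht
    have hfe : f t = ∑' l : ℤ,
        (φ (t + l) : ℂ) * Complex.exp (-(Complex.I * (x : ℂ) * ((t + l : ℝ) : ℂ))) := by
      rw [tsum_eq_sum (s := Finset.Icc (-(T : ℤ) - 1) T)]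
      intro l hl
      by_contra hne
      have h0 : φ (t + l) ≠ 0 := fun h0 => hne (by simp [h0])
      obtain ⟨h1, h2⟩ := hsφ _ h0
      apply hl
      rw [Finset.mem_Icc]
      have h3 : -(T : ℝ) - 1 ≤ l := by linarith [ht.2]
      have h4 : (l : ℝ) ≤ T := by linarith [ht.1, (Nat.cast_nonneg T : (0 : ℝ) ≤ T)]
      exact ⟨by exact_mod_cast h3, by exact_mod_cast h4⟩
    rw [Finset.sum_comm]
    simp only [hg]
    rw [Finset.mul_sum]
    refine Finset.sum_congr rfl fun n _ => ?_
    rw [hfe, ← (Equiv.addRight n).tsum_eq, ← tsum_mul_right, tsum_eq_sum (s := D)]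
    · refine Finset.sum_congr rfl fun l _ => ?_
      simp only [hG, Equiv.coe_addRight]
      have e1 : t + ((l + n : ℤ) : ℝ) = t + n + l := by push_cast; ring
      rw [e1, mul_mul_mul_comm, ← Complex.exp_add]
      push_cast
      congr 2
      ring
    · intro l hl
      have := hDout (t + n) l hl
      have e1 : t + ((l + n : ℤ) : ℝ) = t + n + l := by push_cast; ring
      simp only [Equiv.coe_addRight]
      rw [e1, mul_mul_mul_comm, ← Complex.ofReal_mul, this]
      simp
  have hfg' : ∫ t in (0 : ℝ)..1, f t * g t = ∑ l ∈ D, ∫ t, G l t := by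
    have e : ∀ l ∈ D, ∫ t, G l t = ∫ t in (0 : ℝ)..1, ∑ n ∈ Finset.Icc (-(N : ℤ) - 1) N,
        G l (t + n) := by
      intro l _
      rw [integral_eq_sum_unit (N := N) (hGi l)]
      intro t ht
      have h0 : ψ (t / 2 ^ j) ≠ 0 := fun h0 => ht (by simp [hG, h0])
      obtain ⟨h1, h2⟩ := hsψ t h0
      rw [abs_le]; constructor <;> linarith
    rw [Finset.sum_congr rfl e, ← intervalIntegral.integral_finsetSum]
    · refine intervalIntegral.integral_congr_ae (.of_forall fun t ht => ?_)
      rw [Set.uIoc_of_le zero_le_one] at ht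
      exact hfg t (by rw [Set.uIcc_of_le zero_le_one]; exact Set.Ioc_subset_Icc_self ht) ht
    · intro l _
      refine Integrable.intervalIntegrable (integrable_finsetSum _ fun n _ => ?_)
      exact (hGi l).comp_add_right (n : ℝ)
  rw [hfg', transferFunction, tsum_eq_sum (s := D), Finset.mul_sum]
  · refine Finset.sum_congr rfl fun l _ => ?_
    simp only [hG]
    rw [integral_mul_const, integral_complex_ofReal, filterCoeff, ← mul_assoc, ← Complex.ofReal_mul,
      ← mul_assoc, ← Real.rpow_add (by norm_num)]
    congr 2
    rw [neg_div, add_neg_cancel, Real.rpow_zero, one_mul]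
  · intro l hl
    simp only [filterCoeff]
    simp [hDout _ l hl]

end TransferFunction

/-! ### Bounds for `φ̂`, `ψ̂` and the transfer functions -/

section Decay

lemma abs_le_of_support_neg {φ : ℝ → ℝ} {T : ℕ} (hφ : Function.support φ ⊆ Set.Ioo (-(T : ℝ)) 0) :
    ∀ t, φ t ≠ 0 → |t| ≤ T := fun t ht => by
  have := hφ ht
  rw [abs_le]; constructor <;> linarith [this.1, this.2, (Nat.cast_nonneg T : (0 : ℝ) ≤ T)]

lemma abs_le_of_support_pos {ψ : ℝ → ℝ} {T : ℕ} (hψ : Function.support ψ ⊆ Set.Ioo 0 (T : ℝ)) :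
    ∀ t, ψ t ≠ 0 → |t| ≤ T := fun t ht => by
  have := hψ ht
  rw [abs_le]; constructor <;> linarith [this.1, this.2, (Nat.cast_nonneg T : (0 : ℝ) ≤ T)]

variable {φ ψ : ℝ → ℝ} {T M : ℕ} {α : ℝ}

lemma WaveletAssumptions.exists_decay (h : WaveletAssumptions φ ψ M α) :
    ∃ C : ℝ, 0 < C ∧ ∀ ξ, ‖fourier ψ ξ‖ ≤ C * (1 + |ξ|) ^ (-α) := by
  obtain ⟨C, hC⟩ := h.fourier_decay
  refine ⟨max C 1, by positivity, fun ξ => ?_⟩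
  have h1 : ‖fourier ψ ξ‖ * (1 + |ξ|) ^ α ≤ C := hC ⟨ξ, rfl⟩
  have h2 : 0 < (1 + |ξ|) ^ α := Real.rpow_pos_of_pos (by positivity) _
  rw [Real.rpow_neg (by positivity), ← div_eq_mul_inv, le_div_iff₀ h2]
  exact h1.trans (le_max_left _ _)

/-- The Fourier transform of the wavelet has a zero of order `M` at the origin and decays. -/
lemma WaveletAssumptions.exists_wavelet_bound (h : WaveletAssumptions φ ψ M α)
    (hψ : Function.support ψ ⊆ Set.Ioo 0 (T : ℝ)) :
    ∃ C : ℝ, 0 < C ∧ ∀ ξ, ‖fourier ψ ξ‖ ≤ C * (|ξ| ^ M * (1 + |ξ|) ^ (-(α + M))) := by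
  obtain ⟨C₁, hC₁, h1⟩ := h.exists_decay
  have hα := h.one_lt_exponent
  set C₂ : ℝ := (T : ℝ) ^ M * Real.exp (1 * T) * ∫ t, |ψ t| with hC₂
  have hC₂0 : 0 ≤ C₂ := by
    have : 0 ≤ ∫ t, |ψ t| := integral_nonneg fun t => abs_nonneg _
    positivity
  refine ⟨C₁ * 2 ^ M + C₂ * 2 ^ (α + M), by positivity, fun ξ => ?_⟩
  have hpos : 0 < 1 + |ξ| := by positivity
  -- For `|ξ| ≤ 1` the vanishing moments give `|ξ|^M` and the other factor is bounded below. For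
  -- `|ξ| > 1` the decay suffices, because `|ξ|/(1 + |ξ|) ≥ 1/2`.
  rcases le_or_gt |ξ| 1 with hξ | hξ
  · have h2 := norm_fourier_add_le h.integrable_wavelet (abs_le_of_support_pos hψ) M 0
      (fun m hm => by
        have := h.vanishing_moments m hm
        have e : ∀ t : ℝ, (ψ t : ℂ) * (t : ℂ) ^ m *
          Complex.exp (-(Complex.I * ((0 : ℝ) : ℂ) * (t : ℂ))) = ((t ^ m * ψ t : ℝ) : ℂ) := by
          intro t; push_cast; simp [mul_comm]
        simp_rw [e]
        rw [integral_complex_ofReal, this, Complex.ofReal_zero]) hξ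
    rw [zero_add, ← hC₂] at h2
    have h3 : (2 : ℝ) ^ (-(α + M)) ≤ (1 + |ξ|) ^ (-(α + M)) :=
      Real.rpow_le_rpow_of_nonpos hpos (by linarith) (by
        have : (0 : ℝ) ≤ M := Nat.cast_nonneg M
        linarith)
    have h4 : (2 : ℝ) ^ (α + M) * 2 ^ (-(α + M)) = 1 := by
      rw [← Real.rpow_add (by norm_num)]; simp
    calc ‖fourier ψ ξ‖ ≤ C₂ * |ξ| ^ M := h2
      _ = C₂ * 2 ^ (α + M) * (|ξ| ^ M * 2 ^ (-(α + M))) := by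
          linear_combination -C₂ * |ξ| ^ M * h4
      _ ≤ C₂ * 2 ^ (α + M) * (|ξ| ^ M * (1 + |ξ|) ^ (-(α + M))) := by gcongr
      _ ≤ _ := by
          rw [add_mul]
          have : 0 ≤ C₁ * 2 ^ M * (|ξ| ^ M * (1 + |ξ|) ^ (-(α + M))) := by positivity
          linarith
  · have h3 : 1 ≤ 2 ^ M * (|ξ| ^ M * (1 + |ξ|) ^ (-(M : ℝ))) := by
      rw [Real.rpow_neg hpos.le, Real.rpow_natCast, ← mul_assoc, ← mul_pow, ← inv_pow, ← mul_pow]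
      refine one_le_pow₀ ?_
      rw [← div_eq_mul_inv, le_div_iff₀ hpos]; linarith
    calc ‖fourier ψ ξ‖ ≤ C₁ * (1 + |ξ|) ^ (-α) := h1 ξ
      _ ≤ C₁ * (1 + |ξ|) ^ (-α) * (2 ^ M * (|ξ| ^ M * (1 + |ξ|) ^ (-(M : ℝ)))) :=
          le_mul_of_one_le_right (by positivity) h3
      _ = C₁ * 2 ^ M * (|ξ| ^ M * (1 + |ξ|) ^ (-(α + M))) := by
          rw [neg_add, Real.rpow_add hpos]; ring
      _ ≤ _ := by
          rw [add_mul]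
          have : 0 ≤ C₂ * 2 ^ (α + M) * (|ξ| ^ M * (1 + |ξ|) ^ (-(α + M))) := by positivity
          linarith

/-- By Strang-Fix `φ̂` has a zero of order `M` at each `2πk`, `k ≠ 0`. The Taylor bound uses only
the support and the `L¹` norm of `φ`, so one constant serves all `k`. -/
lemma WaveletAssumptions.exists_scaling_zero (h : WaveletAssumptions φ ψ M α)
    (hφ : Function.support φ ⊆ Set.Ioo (-(T : ℝ)) 0) :
    ∃ C : ℝ, 0 ≤ C ∧ ∀ (k : ℤ) (x : ℝ), k ≠ 0 → |x| ≤ Real.pi →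
      ‖fourier φ (x + 2 * Real.pi * k)‖ ≤ C * |x| ^ M := by
  refine ⟨(T : ℝ) ^ M * Real.exp (Real.pi * T) * ∫ t, |φ t|, ?_, fun k x hk hx => ?_⟩
  · have : 0 ≤ ∫ t, |φ t| := integral_nonneg fun t => abs_nonneg _
    positivity
  · rw [add_comm]
    exact norm_fourier_add_le h.integrable_scaling (abs_le_of_support_neg hφ) M _
      (fun m hm => strang_fix h.integrable_scaling hφ h.polynomial_reproduction hm hk) hx

/-- The transfer function is close to its continuous-time counterpart. -/
lemma WaveletAssumptions.exists_transfer_approx (h : WaveletAssumptions φ ψ M α)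
    (hφ : Function.support φ ⊆ Set.Ioo (-(T : ℝ)) 0) (hψ : Function.support ψ ⊆ Set.Ioo 0 (T : ℝ)) :
    ∃ C : ℝ, 0 ≤ C ∧ ∀ (j : ℕ) (x : ℝ), |x| ≤ Real.pi →
      ‖transferFunction φ ψ j x - (((2 : ℝ) ^ ((j : ℝ) / 2) : ℝ) : ℂ) * (fourier φ x *
        starRingEnd ℂ (fourier ψ (2 ^ j * x)))‖
      ≤ C * ((2 : ℝ) ^ ((j : ℝ) / 2) * (((2 : ℝ) ^ j) ^ (-α) * |x| ^ M)) := by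
  obtain ⟨C₁, hC₁, h1⟩ := h.exists_decay
  obtain ⟨C₂, hC₂, h2⟩ := h.exists_scaling_zero hφ
  have hα := h.one_lt_exponent
  have hsum : Summable fun k : ℤ => |(k : ℝ)| ^ (-α) := Real.summable_abs_int_rpow hα
  set S : ℝ := ∑' k : ℤ, |(k : ℝ)| ^ (-α) with hS
  have hS0 : 0 ≤ S := tsum_nonneg fun k => by positivity
  refine ⟨C₂ * C₁ * S, by positivity, fun j x hx => ?_⟩
  have hH := hasSum_transferFunction h.memLp_scaling h.memLp_wavelet h.integrable_scaling
    h.integrable_wavelet hφ hψ j x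
  set a : ℤ → ℂ := fun k : ℤ => fourier φ (x + 2 * Real.pi * k) *
      ((((2 : ℝ) ^ j : ℝ) : ℂ) * starRingEnd ℂ (fourier ψ (2 ^ j * (x + 2 * Real.pi * k)))) with ha
  -- Only the aliased terms `k ≠ 0` remain. The factor `φ̂` contributes `|x|^M` and `ψ̂` contributes
  -- `(2^j |k|)^{-α}`, summable in `k` since `α > 1`.
  have hd := hH.sub (hasSum_ite_eq (0 : ℤ) (a 0))
  have hbound : ∀ k : ℤ, ‖a k - (if k = 0 then a 0 else 0)‖
      ≤ C₂ * C₁ * (2 ^ j * (((2 : ℝ) ^ j) ^ (-α) * |x| ^ M)) * |(k : ℝ)| ^ (-α) := by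
    intro k
    by_cases hk : k = 0
    · subst hk
      simp only [if_true, sub_self, norm_zero]
      positivity
    · rw [if_neg hk, sub_zero, ha]
      simp only [norm_mul, RCLike.norm_conj, Complex.norm_real, Real.norm_eq_abs]
      have hk1 : (1 : ℝ) ≤ |(k : ℝ)| := by exact_mod_cast Int.one_le_abs hk
      -- For `|x| ≤ π` and `|k| ≥ 1`, `|x + 2πk| ≥ 2π|k| - π ≥ |k|`.
      have hlow : |(k : ℝ)| ≤ |x + 2 * Real.pi * k| := by
        have e1 : |2 * Real.pi * k| = 2 * Real.pi * |(k : ℝ)| := by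
          rw [abs_mul, abs_of_pos (by positivity)]
        have e2 : |2 * Real.pi * (k : ℝ)| ≤ |x + 2 * Real.pi * k| + |x| := by
          have := abs_sub (x + 2 * Real.pi * k) x
          simpa using this
        nlinarith [Real.pi_gt_three]
      have h3 : (1 + |2 ^ j * (x + 2 * Real.pi * k)|) ^ (-α)
          ≤ ((2 : ℝ) ^ j) ^ (-α) * |(k : ℝ)| ^ (-α) := by
        rw [← Real.mul_rpow (by positivity) (by positivity)]
        refine Real.rpow_le_rpow_of_nonpos (by positivity) ?_ (by linarith)
        rw [abs_mul, abs_of_pos (by positivity : (0 : ℝ) < 2 ^ j)]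
        have : (2 : ℝ) ^ j * |(k : ℝ)| ≤ 2 ^ j * |x + 2 * Real.pi * k| := by gcongr
        linarith
      rw [abs_of_pos (by positivity : (0 : ℝ) < 2 ^ j)]
      calc ‖fourier φ (x + 2 * Real.pi * k)‖ *
            (2 ^ j * ‖fourier ψ (2 ^ j * (x + 2 * Real.pi * k))‖)
          ≤ C₂ * |x| ^ M * (2 ^ j * (C₁ * (((2 : ℝ) ^ j) ^ (-α) * |(k : ℝ)| ^ (-α)))) := by
            gcongr
            · exact h2 k x hk hx
            · exact (h1 _).trans (by gcongr)
        _ = _ := by ring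
  have hn := tsum_of_norm_bounded (hsum.hasSum.mul_left
    (C₂ * C₁ * (2 ^ j * (((2 : ℝ) ^ j) ^ (-α) * |x| ^ M)))) hbound
  rw [hd.tsum_eq] at hn
  set r : ℝ := (2 : ℝ) ^ ((j : ℝ) / 2) with hr
  have hr0 : 0 < r := Real.rpow_pos_of_pos (by norm_num) _
  have hrr : (2 : ℝ) ^ j = r * r := by
    rw [hr, ← Real.rpow_add (by norm_num), add_halves, Real.rpow_natCast]
  have e : (r : ℂ) * transferFunction φ ψ j x - a 0 = (r : ℂ) * (transferFunction φ ψ j x -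
      (r : ℂ) * (fourier φ x * starRingEnd ℂ (fourier ψ (2 ^ j * x)))) := by
    simp only [ha, Int.cast_zero, mul_zero, add_zero]
    have : (((2 : ℝ) ^ j : ℝ) : ℂ) = r * r := by rw [hrr]; push_cast; ring
    rw [this]; ring
  rw [e, norm_mul, Complex.norm_real, Real.norm_eq_abs, abs_of_pos hr0] at hn
  refine le_of_mul_le_mul_left (hn.trans (le_of_eq ?_)) hr0
  have e2 : C₂ * C₁ * (2 ^ j * (((2 : ℝ) ^ j) ^ (-α) * |x| ^ M)) * S
    = 2 ^ j * (C₂ * C₁ * S * (((2 : ℝ) ^ j) ^ (-α) * |x| ^ M)) := by ring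
  rw [e2]
  generalize ((2 : ℝ) ^ j) ^ (-α) = q
  rw [hrr]; ring

/-- If some transfer function does not vanish, neither does the Fourier transform of `ψ`. -/
lemma WaveletAssumptions.exists_fourier_ne_zero (h : WaveletAssumptions φ ψ M α)
    (hφ : Function.support φ ⊆ Set.Ioo (-(T : ℝ)) 0) (hψ : Function.support ψ ⊆ Set.Ioo 0 (T : ℝ))
    (hH : ∃ x : ℝ, transferFunction φ ψ 0 x ≠ 0) : ∃ ξ : ℝ, ξ ≠ 0 ∧ fourier ψ ξ ≠ 0 := by
  obtain ⟨x, hx⟩ := hH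
  by_contra! hc
  have hzero : ∀ ξ, fourier ψ ξ = 0 := by
    have hd : Dense {ξ : ℝ | ξ ≠ 0} := dense_compl_singleton 0
    have := (continuous_fourier h.integrable_wavelet).ext_on hd continuous_const
      (fun ξ hξ => hc ξ hξ)
    exact fun ξ => congrFun this ξ
  have hs := hasSum_transferFunction h.memLp_scaling h.memLp_wavelet h.integrable_scaling
    h.integrable_wavelet hφ hψ 0 x
  simp only [hzero, map_zero, mul_zero] at hs
  have := hs.unique hasSum_zero
  simp at this
  exact hx this

/-- Since `φ` is real with integral 1, the real part of `φ̂(x)` is `1 + O(x²)` by the cosine bound.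
The imaginary part is `O(|x|)` and enters squared. The absence of a first order term is what allows
`β` up to 2. -/
lemma WaveletAssumptions.exists_scaling_bound (h : WaveletAssumptions φ ψ M α)
    (hφ : Function.support φ ⊆ Set.Ioo (-(T : ℝ)) 0) :
    ∃ C : ℝ, 0 ≤ C ∧ ∀ x : ℝ, ‖fourier φ x‖ ≤ C ∧ |‖fourier φ x‖ ^ 2 - 1| ≤ C * |x| ^ 2 := by
  set I : ℝ := ∫ t, |φ t| with hI
  have hI0 : 0 ≤ I := integral_nonneg fun t => abs_nonneg _
  have hφi := h.integrable_scaling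
  refine ⟨I + T ^ 2 * I * (I + 1) + (T * I) ^ 2, by positivity, fun x => ⟨?_, ?_⟩⟩
  · have := norm_fourier_le (g := φ) x
    have : 0 ≤ T ^ 2 * I * (I + 1) + (T * I) ^ 2 := by positivity
    linarith
  · have hi := integrable_mul_exp (g := fun t => (φ t : ℂ)) hφi.ofReal x
    have hre : (fourier φ x).re = ∫ t, φ t * Real.cos (x * t) := by
      have := integral_re (𝕜 := ℂ) hi
      simp only [RCLike.re_to_complex] at this
      rw [fourier, ← this]
      refine integral_congr_ae (.of_forall fun t => ?_)
      simp [Complex.exp_re]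
    have him : (fourier φ x).im = -∫ t, φ t * Real.sin (x * t) := by
      have := integral_im (𝕜 := ℂ) hi
      simp only [RCLike.im_to_complex] at this
      rw [fourier, ← this, ← integral_neg]
      refine integral_congr_ae (.of_forall fun t => ?_)
      simp [Complex.exp_im]
    have hci : Integrable fun t => φ t * Real.cos (x * t) :=
      hφi.mul_bdd (c := 1) (by fun_prop) (.of_forall fun t => Real.abs_cos_le_one _)
    have hT : ∀ t, φ t ≠ 0 → t ^ 2 ≤ T ^ 2 := fun t ht => by
      rw [← sq_abs]; gcongr; exact abs_le_of_support_neg hφ t ht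
    have hre1 : |(fourier φ x).re - 1| ≤ T ^ 2 * I * |x| ^ 2 := by
      rw [hre, ← h.integral_scaling, ← integral_sub hci hφi]
      have hb : ∀ t, ‖φ t * Real.cos (x * t) - φ t‖ ≤ (T : ℝ) ^ 2 * |x| ^ 2 * ‖φ t‖ := by
        intro t
        rw [show φ t * Real.cos (x * t) - φ t = φ t * (Real.cos (x * t) - 1) by ring, norm_mul,
          mul_comm]
        rcases eq_or_ne (φ t) 0 with h0 | h0
        · simp [h0]
        · gcongr
          have h1 := Real.one_sub_sq_div_two_le_cos (x := x * t)
          have h2 := Real.cos_le_one (x * t)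
          rw [Real.norm_eq_abs, abs_sub_comm, abs_of_nonneg (by linarith), sq_abs]
          have h3 : (x * t) ^ 2 ≤ T ^ 2 * x ^ 2 := by
            rw [mul_pow, mul_comm]; exact mul_le_mul_of_nonneg_right (hT t h0) (sq_nonneg x)
          nlinarith [sq_nonneg (x * t)]
      refine (norm_integral_le_of_norm_le (hφi.norm.const_mul _) (.of_forall hb)).trans (le_of_eq ?_)
      rw [integral_const_mul]; simp only [Real.norm_eq_abs, ← hI]; ring
    have him1 : |(fourier φ x).im| ≤ T * I * |x| := by
      rw [him, abs_neg]
      have hb : ∀ t, ‖φ t * Real.sin (x * t)‖ ≤ (T : ℝ) * |x| * ‖φ t‖ := by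
        intro t
        rw [norm_mul, mul_comm]
        rcases eq_or_ne (φ t) 0 with h0 | h0
        · simp [h0]
        · gcongr
          have h1 := Real.abs_sin_le_abs (x := x * t)
          rw [abs_mul] at h1
          refine h1.trans ?_
          rw [mul_comm]
          gcongr
          exact abs_le_of_support_neg hφ t h0
      refine (norm_integral_le_of_norm_le (hφi.norm.const_mul _) (.of_forall hb)).trans (le_of_eq ?_)
      rw [integral_const_mul]; simp only [Real.norm_eq_abs, ← hI]; ring
    have hre2 : |(fourier φ x).re + 1| ≤ I + 1 := by
      refine (abs_add_le _ _).trans ?_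
      rw [abs_one]
      gcongr
      exact (Complex.abs_re_le_norm _).trans (norm_fourier_le x)
    rw [← Complex.normSq_eq_norm_sq, Complex.normSq_apply]
    have e : (fourier φ x).re * (fourier φ x).re + (fourier φ x).im * (fourier φ x).im - 1
      = ((fourier φ x).re - 1) * ((fourier φ x).re + 1)
        + (fourier φ x).im * (fourier φ x).im := by ring
    rw [e]
    refine (abs_add_le _ _).trans ?_
    rw [abs_mul, abs_mul]
    have h3 : |(fourier φ x).re - 1| * |(fourier φ x).re + 1|
        ≤ T ^ 2 * I * |x| ^ 2 * (I + 1) := by gcongr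
    have h4 : |(fourier φ x).im| * |(fourier φ x).im| ≤ (T * I * |x|) * (T * I * |x|) := by gcongr
    have h5 : 0 ≤ I * |x| ^ 2 := by positivity
    nlinarith

end Decay

/-! ### Gain of the difference filter -/

section DifferenceFilter

/-- The gain of the difference filter, compared with `|x|`. -/
lemma norm_one_sub_exp (x : ℝ) :
    ‖1 - Complex.exp (-(Complex.I * (x : ℂ)))‖ = 2 * |Real.sin (x / 2)| := by
  have h := Complex.norm_exp_I_mul_ofReal_sub_one (-x)
  rw [norm_sub_rev]
  have e : -(Complex.I * (x : ℂ)) = Complex.I * ((-x : ℝ) : ℂ) := by push_cast; ring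
  rw [e, h, Real.norm_eq_abs, abs_mul, neg_div, Real.sin_neg, abs_neg, abs_of_pos two_pos]

/-- The gain equals `2 sin(|x|/2)`. Jordan's inequality bounds it below and the cubic Taylor bound
of the sine gives the relative error `O(x²)`; for `|x| > 2` the last inequality is trivial. -/
lemma norm_one_sub_exp_bounds {x : ℝ} (hx : |x| ≤ Real.pi) :
    2 / Real.pi * |x| ≤ ‖1 - Complex.exp (-(Complex.I * (x : ℂ)))‖ ∧
    ‖1 - Complex.exp (-(Complex.I * (x : ℂ)))‖ ≤ |x| ∧
    |x| - ‖1 - Complex.exp (-(Complex.I * (x : ℂ)))‖ ≤ |x| * |x| ^ 2 := by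
  have e : |Real.sin (x / 2)| = Real.sin (|x| / 2) := by
    have h0 : 0 ≤ Real.sin (|x| / 2) :=
      Real.sin_nonneg_of_nonneg_of_le_pi (by positivity) (by linarith [Real.pi_pos])
    rcases abs_choice x with h | h
    · rw [h] at h0 ⊢; exact abs_of_nonneg h0
    · rw [h, neg_div, Real.sin_neg] at h0 ⊢; exact abs_of_nonpos (by linarith)
  rw [norm_one_sub_exp, e]
  have hy : 0 ≤ |x| / 2 := by positivity
  have h1 := Real.mul_le_sin hy (by linarith)
  have h2 := Real.sin_le hy
  refine ⟨by linarith, by linarith, ?_⟩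
  rcases le_or_gt |x| 2 with h3 | h3
  · rcases eq_or_lt_of_le (abs_nonneg x) with h4 | h4
    · rw [← h4]; simp
    · have := Real.sin_gt_sub_cube (x := |x| / 2) (by linarith)
      have h5 : 0 ≤ |x| ^ 3 := by positivity
      nlinarith
  · have h6 : 0 ≤ Real.sin (|x| / 2) :=
      Real.sin_nonneg_of_nonneg_of_le_pi (by positivity) (by linarith [Real.pi_pos])
    nlinarith

/-- Powers of the gain of the difference filter, compared with powers of `|x|`. -/
lemma exists_rpow_gain_bound (D : ℝ) : ∃ C : ℝ, 0 ≤ C ∧ ∀ p x : ℝ, |p| ≤ D → x ≠ 0 →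
    |x| ≤ Real.pi →
    ‖1 - Complex.exp (-(Complex.I * (x : ℂ)))‖ ^ p ≤ C * |x| ^ p ∧
    |‖1 - Complex.exp (-(Complex.I * (x : ℂ)))‖ ^ p - |x| ^ p| ≤ C * |x| ^ 2 * |x| ^ p := by
  set E : ℝ := Real.exp (D * Real.log (Real.pi / 2)) with hE
  have hpi : 0 < Real.pi := Real.pi_pos
  have hl0 : 0 ≤ Real.log (Real.pi / 2) := Real.log_nonneg (by linarith [Real.pi_gt_three])
  refine ⟨E + |D| * (Real.pi / 2) * E, by positivity, fun p x hp hx0 hx => ?_⟩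
  obtain ⟨h1, h2, h3⟩ := norm_one_sub_exp_bounds hx
  set e := ‖1 - Complex.exp (-(Complex.I * (x : ℂ)))‖
  have hy : 0 < |x| := abs_pos.mpr hx0
  have he : 0 < e := lt_of_lt_of_le (by positivity) h1
  -- The ratio lies in `[2/π, 1]` and `log ρ = O(x²)`, so `ρ^p = exp(p log ρ)` is bounded and `1 +
  -- O(x²)`, uniformly in `|p| ≤ D`.
  set ρ := e / |x| with hρ
  have hρ0 : 0 < ρ := by positivity
  have hρ1 : ρ ≤ 1 := by rw [hρ, div_le_one hy]; exact h2
  have hρ2 : 2 / Real.pi ≤ ρ := by rw [hρ, le_div_iff₀ hy]; exact h1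
  have hρ3 : 1 - ρ ≤ |x| ^ 2 := by
    have : 1 - ρ = (|x| - e) / |x| := by rw [hρ]; field_simp
    rw [this, div_le_iff₀ hy]; linarith
  have hρi : ρ⁻¹ ≤ Real.pi / 2 := by
    rw [inv_le_comm₀ hρ0 (by positivity), inv_div]; exact hρ2
  have hep : e ^ p = ρ ^ p * |x| ^ p := by
    rw [← Real.mul_rpow hρ0.le hy.le, hρ, div_mul_cancel₀ _ hy.ne']
  have hxp : 0 < |x| ^ p := Real.rpow_pos_of_pos hy _
  have hD : 0 ≤ D := (abs_nonneg p).trans hp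
  -- logarithm of the ratio
  have hlog : |Real.log ρ| ≤ Real.pi / 2 * |x| ^ 2 := by
    rw [abs_of_nonpos (Real.log_nonpos hρ0.le hρ1)]
    have := Real.one_sub_inv_le_log_of_pos hρ0
    have e1 : ρ⁻¹ - 1 = ρ⁻¹ * (1 - ρ) := by field_simp
    have e2 : ρ⁻¹ * (1 - ρ) ≤ Real.pi / 2 * |x| ^ 2 := by
      have : 0 ≤ 1 - ρ := by linarith
      gcongr
    linarith
  have hlog2 : |Real.log ρ| ≤ Real.log (Real.pi / 2) := by
    rw [abs_of_nonpos (Real.log_nonpos hρ0.le hρ1), ← Real.log_inv]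
    exact Real.log_le_log (by positivity) hρi
  have hpl : |Real.log ρ * p| ≤ D * Real.log (Real.pi / 2) := by
    rw [abs_mul, mul_comm]; gcongr
  have hE1 : ρ ^ p ≤ E := by
    rw [Real.rpow_def_of_pos hρ0, hE]
    exact Real.exp_le_exp.mpr ((le_abs_self _).trans hpl)
  have hE2 : |ρ ^ p - 1| ≤ |D| * (Real.pi / 2) * E * |x| ^ 2 := by
    rw [Real.rpow_def_of_pos hρ0]
    set z := Real.log ρ * p with hz
    have hb : |Real.exp z - 1| ≤ |z| * Real.exp |z| := by
      have h5 := Complex.norm_exp_sub_sum_le_norm_mul_exp (z : ℂ) 1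
      simp only [Finset.range_one, Finset.sum_singleton, pow_zero, Nat.factorial_zero,
        Nat.cast_one, div_one, pow_one, Complex.norm_real, Real.norm_eq_abs] at h5
      rw [← Complex.ofReal_exp, ← Complex.ofReal_one, ← Complex.ofReal_sub, Complex.norm_real,
        Real.norm_eq_abs] at h5
      exact h5
    refine hb.trans ?_
    have h6 : |z| ≤ Real.pi / 2 * |x| ^ 2 * D := by
      rw [hz, abs_mul]; gcongr
    calc |z| * Real.exp |z| ≤ (Real.pi / 2 * |x| ^ 2 * D) * E := by
          gcongr
          exact Real.exp_le_exp.mpr hpl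
      _ = _ := by rw [abs_of_nonneg hD]; ring
  have hE0 : 0 ≤ E := (Real.exp_pos _).le
  constructor
  · rw [hep]
    gcongr
    have : 0 ≤ |D| * (Real.pi / 2) * E := by positivity
    linarith
  · rw [hep, show ρ ^ p * |x| ^ p - |x| ^ p = (ρ ^ p - 1) * |x| ^ p by ring, abs_mul,
      abs_of_pos hxp]
    gcongr
    refine hE2.trans ?_
    rw [add_mul]
    have : 0 ≤ E * |x| ^ 2 := by positivity
    linarith

end DifferenceFilter

/-! ### Comparison of the spectral density with its limit -/

section Comparison

variable {φ ψ : ℝ → ℝ} {T M : ℕ} {α : ℝ}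

/-- The zero of order `M` of `ψ̂` compensates the singularity `y^{-2d}`: as `d ≤ M`, the power
`y^{2M-2d}` has a nonnegative exponent and is at most `(1 + y)^{2M-2d}`. -/
lemma sq_envelope_le {y d : ℝ} (hy : 0 < y) (hd : d ≤ M) :
    (y ^ M * (1 + y) ^ (-(α + M))) ^ 2 * y ^ (-2 * d) ≤ (1 + y) ^ (-(2 * α + 2 * d)) := by
  have hy1 : 0 < 1 + y := by linarith
  have e : (y ^ M * (1 + y) ^ (-(α + M))) ^ 2 * y ^ (-2 * d)
      = y ^ (2 * (M : ℝ) - 2 * d) * (1 + y) ^ (-(2 * (α + M))) := by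
    rw [mul_pow, ← Real.rpow_natCast y M, ← Real.rpow_natCast, ← Real.rpow_natCast,
      ← Real.rpow_mul hy.le, ← Real.rpow_mul hy1.le, mul_right_comm, ← Real.rpow_add hy]
    push_cast
    congr 2 <;> ring
  rw [e]
  calc y ^ (2 * (M : ℝ) - 2 * d) * (1 + y) ^ (-(2 * (α + M)))
      ≤ (1 + y) ^ (2 * (M : ℝ) - 2 * d) * (1 + y) ^ (-(2 * (α + M))) := by
        gcongr
        · linarith
        · linarith
    _ = (1 + y) ^ (-(2 * α + 2 * d)) := by
        rw [← Real.rpow_add hy1]; congr 1; ring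

/-- With `u = 2^j` and `y = 2^j |x|`, the restriction `|x| ≤ π` reads `y ≤ πu`, and then `1 + y ≤ (1
+ π) u`. Negative powers of `2^j` can thus be exchanged for decay in `y`. -/
lemma rpow_neg_scale_le {u y γ : ℝ} (hu : 1 ≤ u) (hy : 0 ≤ y) (hyu : y ≤ Real.pi * u)
    (hγ : 0 ≤ γ) : u ^ (-γ) ≤ (1 + Real.pi) ^ γ * (1 + y) ^ (-γ) := by
  have hpi := Real.pi_pos
  have h1 : ((1 + Real.pi) * u) ^ (-γ) ≤ (1 + y) ^ (-γ) :=
    Real.rpow_le_rpow_of_nonpos (by linarith) (by nlinarith) (by linarith)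
  rw [Real.mul_rpow (by linarith) (by linarith)] at h1
  calc u ^ (-γ) = (1 + Real.pi) ^ γ * ((1 + Real.pi) ^ (-γ) * u ^ (-γ)) := by
        rw [← mul_assoc, ← Real.rpow_add (by linarith)]; simp
    _ ≤ _ := by gcongr

set_option maxHeartbeats 1000000 in
/-- The spectral density of the wavelet coefficients, compared with its limit. -/
theorem WaveletAssumptions.exists_spectral_comparison (h : WaveletAssumptions φ ψ M α)
    (hM : 1 ≤ M)
    (hφ : Function.support φ ⊆ Set.Ioo (-(T : ℝ)) 0) (hψ : Function.support ψ ⊆ Set.Ioo 0 (T : ℝ))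
    {β L dmin dmax : ℝ} (hβ₀ : 0 < β) (hβ₂ : β ≤ 2) (hL : 0 < L)
    (hdM : ∀ d ∈ Set.Icc dmin dmax, d ≤ M) :
    ∃ C : ℝ, 0 < C ∧ ∀ (j : ℕ) (d F F₀ x : ℝ), d ∈ Set.Icc dmin dmax → 0 ≤ F₀ → x ≠ 0 →
      |x| ≤ Real.pi → |F - F₀| ≤ L * F₀ * |x| ^ β →
      ‖transferFunction φ ψ j x‖ ^ 2 * ‖1 - Complex.exp (-(Complex.I * (x : ℂ)))‖ ^ (-2 * d) * F
        ≤ C * F₀ * (2 ^ j * (((2 : ℝ) ^ j) ^ (2 * d) *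
          (1 + |2 ^ j * x|) ^ (-(2 * α + 2 * dmin - β)))) ∧
      |‖transferFunction φ ψ j x‖ ^ 2 * ‖1 - Complex.exp (-(Complex.I * (x : ℂ)))‖ ^ (-2 * d) * F
        - F₀ * (2 ^ j * (‖fourier ψ (2 ^ j * x)‖ ^ 2 * |x| ^ (-2 * d)))|
        ≤ C * F₀ * ((2 : ℝ) ^ j) ^ (-β) * (2 ^ j * (((2 : ℝ) ^ j) ^ (2 * d) *
          (1 + |2 ^ j * x|) ^ (-(2 * α + 2 * dmin - β)))) := by
  obtain ⟨C₁, hC₁, h1⟩ := h.exists_wavelet_bound hψ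
  obtain ⟨C₂, hC₂, h2⟩ := h.exists_scaling_bound hφ
  obtain ⟨C₃, hC₃, h3⟩ := h.exists_transfer_approx hφ hψ
  obtain ⟨C₇, hC₇, h7⟩ := exists_rpow_gain_bound (2 * (|dmin| + |dmax|))
  have hα := h.one_lt_exponent
  have hpi := Real.pi_pos
  have hM1 : (1 : ℝ) ≤ M := by exact_mod_cast hM
  set K : ℝ := (1 + Real.pi) ^ (α + M) with hK
  have hK0 : 0 < K := by positivity
  set C₅ : ℝ := C₂ * C₁ + C₃ * K with hC₅
  have hC₅0 : 0 ≤ C₅ := by positivity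
  set C₈ : ℝ := 1 + L * Real.pi ^ β with hC₈
  have hC₈0 : 0 < C₈ := by positivity
  set E₁ : ℝ := C₅ ^ 2 * C₇ * C₈ with hE₁
  set E₂ : ℝ := C₃ * K * (C₅ + C₂ * C₁) * C₇ * C₈ + (C₂ * C₁) ^ 2 * (C₇ * Real.pi ^ 2) * C₈
    + (C₂ * C₁) ^ 2 * L + C₁ ^ 2 * (C₂ * Real.pi ^ 2) with hE₂
  have hE₁0 : 0 ≤ E₁ := by positivity
  have hE₂0 : 0 ≤ E₂ := by positivity
  refine ⟨E₁ + E₂ + 1, by positivity, ?_⟩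
  intro j d F F₀ x hd hF₀ hx0 hx hF
  have hy0 : 0 < |x| := abs_pos.mpr hx0
  specialize h1 (2 ^ j * x)
  obtain ⟨h2a, h2b⟩ := h2 x
  specialize h3 j x hx
  set u : ℝ := 2 ^ j with hu
  have hu1 : 1 ≤ u := one_le_pow₀ (by norm_num)
  have hu0 : 0 < u := by linarith
  set r : ℝ := (2 : ℝ) ^ ((j : ℝ) / 2) with hr
  have hr0 : 0 < r := Real.rpow_pos_of_pos (by norm_num) _
  have hrr : r * r = u := by
    rw [hr, ← Real.rpow_add (by norm_num), add_halves, Real.rpow_natCast]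
  have hyx : |u * x| = u * |x| := by rw [abs_mul, abs_of_pos hu0]
  have hdD : |-2 * d| ≤ 2 * (|dmin| + |dmax|) := by
    rw [abs_mul, abs_neg, abs_two]
    have : |d| ≤ |dmin| + |dmax| := by
      rw [abs_le]
      have := neg_abs_le dmin; have := le_abs_self dmax
      have := abs_nonneg dmin; have := abs_nonneg dmax
      constructor <;> linarith [hd.1, hd.2]
    linarith
  obtain ⟨h7a, h7b⟩ := h7 (-2 * d) x hdD hx0 hx
  rw [hyx] at h1 ⊢
  set y : ℝ := u * |x| with hy
  have hy1 : 0 < y := by positivity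
  have hyu : y ≤ Real.pi * u := by rw [hy, mul_comm]; gcongr
  set b : ℝ := y ^ M * (1 + y) ^ (-(α + M)) with hb
  have hb0 : 0 < b := by positivity
  set e := ‖1 - Complex.exp (-(Complex.I * (x : ℂ)))‖ with he
  have hep : 0 ≤ e ^ (-2 * d) := by positivity
  set w : ℝ := |x| ^ (-2 * d) with hw
  have hw0 : 0 < w := by positivity
  set A := ‖(r : ℂ) * (fourier φ x * starRingEnd ℂ (fourier ψ (u * x)))‖ with hA
  have hAe : A = r * (‖fourier φ x‖ * ‖fourier ψ (u * x)‖) := by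
    rw [hA, norm_mul, norm_mul, RCLike.norm_conj, Complex.norm_real, Real.norm_eq_abs,
      abs_of_pos hr0]
  have hA0 : 0 ≤ A := norm_nonneg _
  have hAb : A ≤ r * (C₂ * C₁ * b) := by
    rw [hAe, mul_assoc C₂]; gcongr
  set H := ‖transferFunction φ ψ j x‖ with hH
  have hH0 : 0 ≤ H := norm_nonneg _
  set q : ℝ := u ^ (-α) * |x| ^ M with hq
  have hq0 : 0 < q := by positivity
  have hqe : q = u ^ (-(α + M)) * y ^ M := by
    rw [hq, hy, mul_pow, neg_add, Real.rpow_add hu0, Real.rpow_neg hu0.le (M : ℝ),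
      Real.rpow_natCast]
    field_simp
  have hqb : q ≤ K * b := by
    rw [hqe, hb, hK]
    have := rpow_neg_scale_le hu1 hy1.le hyu (by linarith : 0 ≤ α + M)
    calc u ^ (-(α + M)) * y ^ M ≤ ((1 + Real.pi) ^ (α + M) * (1 + y) ^ (-(α + M))) * y ^ M := by
          gcongr
      _ = _ := by ring
  -- The common size of all relative errors: `t` dominates `|x|^β` and, because `β ≤ 2` and `|x| ≤
  -- π`, also `|x|²` up to `π²`. Its factor `(1 + y)^β` is the loss of `β` in the exponent of the
  -- envelope.
  set t : ℝ := u ^ (-β) * (1 + y) ^ β with ht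
  have ht0 : 0 < t := by positivity
  -- The exchange leaves the exponent `α + M - β`, which is nonnegative because `α > 1`, `M ≥ 1` and
  -- `β ≤ 2`.
  have hqt : q ≤ K * (b * t) := by
    rw [hqe, hb, hK, ht]
    have h4 := rpow_neg_scale_le hu1 hy1.le hyu (by linarith : 0 ≤ α + M - β)
    have h5 : (1 + Real.pi) ^ (α + M - β) ≤ (1 + Real.pi) ^ (α + M) :=
      Real.rpow_le_rpow_of_exponent_le (by linarith) (by linarith)
    calc u ^ (-(α + M)) * y ^ M = u ^ (-(α + M - β)) * u ^ (-β) * y ^ M := by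
          rw [← Real.rpow_add hu0]; congr 2; ring
      _ ≤ ((1 + Real.pi) ^ (α + M) * (1 + y) ^ (-(α + M - β))) * u ^ (-β) * y ^ M := by
          gcongr
          exact h4.trans (by gcongr)
      _ = _ := by
          have e3 : (1 + y) ^ (-(α + M - β)) = (1 + y) ^ (-(α + M)) * (1 + y) ^ β := by
            rw [← Real.rpow_add (by linarith)]; congr 1; ring
          rw [e3]; ring
  have hHA : |H - A| ≤ C₃ * (r * q) := (abs_norm_sub_norm_le _ _).trans h3
  have hHb : H ≤ r * (C₅ * b) := by
    have h4 : H ≤ A + C₃ * (r * q) := by linarith [le_abs_self (H - A)]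
    have h5 : C₃ * (r * q) ≤ C₃ * (r * (K * b)) := by gcongr
    have h6 : r * (C₅ * b) = r * (C₂ * C₁ * b) + C₃ * (r * (K * b)) := by rw [hC₅]; ring
    linarith
  have hxβ : |x| ^ β ≤ t := by
    have e1 : |x| ^ β = u ^ (-β) * y ^ β := by
      rw [hy, Real.mul_rpow hu0.le hy0.le, ← mul_assoc, ← Real.rpow_add hu0]; simp
    rw [e1, ht]
    gcongr
    linarith
  have hx2 : |x| ^ 2 ≤ Real.pi ^ 2 * t := by
    have e1 : |x| ^ 2 = |x| ^ (2 - β) * |x| ^ β := by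
      rw [← Real.rpow_add hy0, ← Real.rpow_natCast]; congr 1; push_cast; ring
    have e2 : |x| ^ (2 - β) ≤ Real.pi ^ 2 := by
      calc |x| ^ (2 - β) ≤ Real.pi ^ (2 - β) := by gcongr
        _ ≤ Real.pi ^ (2 : ℝ) :=
          Real.rpow_le_rpow_of_exponent_le (by linarith [Real.pi_gt_three]) (by linarith)
        _ = Real.pi ^ 2 := by norm_cast
    rw [e1]; gcongr
  have hFabs : |F| ≤ C₈ * F₀ := by
    have e1 : |F| ≤ |F - F₀| + F₀ := by
      have := abs_add_le (F - F₀) F₀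
      rwa [sub_add_cancel, abs_of_nonneg hF₀] at this
    have e2 : L * F₀ * |x| ^ β ≤ L * F₀ * Real.pi ^ β := by gcongr
    rw [hC₈]; linarith
  -- the common envelope
  have henv : b ^ 2 * (1 + y) ^ β * w ≤ u ^ (2 * d) * (1 + y) ^ (-(2 * α + 2 * dmin - β)) := by
    have e1 : w = u ^ (2 * d) * y ^ (-2 * d) := by
      rw [hw, hy, Real.mul_rpow hu0.le hy0.le, ← mul_assoc, ← Real.rpow_add hu0]; simp
    have e2 := sq_envelope_le (α := α) hy1 (hdM d hd)
    rw [← hb] at e2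
    calc b ^ 2 * (1 + y) ^ β * w = u ^ (2 * d) * ((b ^ 2 * y ^ (-2 * d)) * (1 + y) ^ β) := by
          rw [e1]; ring
      _ ≤ u ^ (2 * d) * ((1 + y) ^ (-(2 * α + 2 * d)) * (1 + y) ^ β) := by gcongr
      _ = u ^ (2 * d) * (1 + y) ^ (-(2 * α + 2 * d - β)) := by
          rw [← Real.rpow_add (by linarith)]; congr 2; ring
      _ ≤ _ := by
          gcongr
          · linarith
          · exact hd.1
  set V : ℝ := u ^ (2 * d) * (1 + y) ^ (-(2 * α + 2 * dmin - β)) with hV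
  have hV0 : 0 < V := by positivity
  have hbw : b ^ 2 * w ≤ V := by
    refine le_trans ?_ henv
    have : 1 ≤ (1 + y) ^ β := Real.one_le_rpow (by linarith) hβ₀.le
    calc b ^ 2 * w = b ^ 2 * 1 * w := by ring
      _ ≤ b ^ 2 * (1 + y) ^ β * w := by gcongr
  have hbtw : b ^ 2 * t * w ≤ u ^ (-β) * V := by
    calc b ^ 2 * t * w = u ^ (-β) * (b ^ 2 * (1 + y) ^ β * w) := by rw [ht]; ring
      _ ≤ _ := by gcongr
  constructor
  · calc H ^ 2 * e ^ (-2 * d) * F ≤ H ^ 2 * e ^ (-2 * d) * |F| := by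
          gcongr; exact le_abs_self F
      _ ≤ (r * (C₅ * b)) ^ 2 * (C₇ * w) * (C₈ * F₀) := by gcongr
      _ = E₁ * F₀ * (u * (b ^ 2 * w)) := by rw [hE₁, ← hrr]; ring
      _ ≤ E₁ * F₀ * (u * V) := by gcongr
      _ ≤ (E₁ + E₂ + 1) * F₀ * (u * V) := by gcongr; linarith
  · set p : ℝ := ‖fourier ψ (u * x)‖ with hp
    have hp0 : 0 ≤ p := norm_nonneg _
    have hA2 : A ^ 2 = u * (‖fourier φ x‖ ^ 2 * p ^ 2) := by rw [hAe, ← hrr]; ring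
    -- The four errors in turn: aliasing (`H` against `A`), the gain against `|x|`, `F` against
    -- `F₀`, and `|φ̂|²` against 1.
    have esplit : H ^ 2 * e ^ (-2 * d) * F - F₀ * (u * (p ^ 2 * w))
        = (H - A) * (H + A) * e ^ (-2 * d) * F + A ^ 2 * (e ^ (-2 * d) - w) * F
          + A ^ 2 * w * (F - F₀) + F₀ * w * (u * p ^ 2 * (‖fourier φ x‖ ^ 2 - 1)) := by
      linear_combination F₀ * w * hA2
    have t1 : |(H - A) * (H + A) * e ^ (-2 * d) * F|
        ≤ C₃ * K * (C₅ + C₂ * C₁) * C₇ * C₈ * (F₀ * (u * (b ^ 2 * t * w))) := by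
      rw [abs_mul, abs_mul, abs_mul, abs_of_nonneg hep, abs_of_nonneg (add_nonneg hH0 hA0)]
      calc |H - A| * (H + A) * e ^ (-2 * d) * |F|
          ≤ (C₃ * (r * (K * (b * t)))) * (r * (C₅ * b) + r * (C₂ * C₁ * b)) * (C₇ * w)
            * (C₈ * F₀) := by
            gcongr
            exact hHA.trans (by gcongr)
        _ = _ := by rw [← hrr]; ring
    have hA2b : A ^ 2 ≤ (C₂ * C₁) ^ 2 * (u * b ^ 2) := by
      calc A ^ 2 ≤ (r * (C₂ * C₁ * b)) ^ 2 := by gcongr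
        _ = _ := by rw [← hrr]; ring
    have t2 : |A ^ 2 * (e ^ (-2 * d) - w) * F|
        ≤ (C₂ * C₁) ^ 2 * (C₇ * Real.pi ^ 2) * C₈ * (F₀ * (u * (b ^ 2 * t * w))) := by
      rw [abs_mul, abs_mul, abs_of_nonneg (sq_nonneg A)]
      calc A ^ 2 * |e ^ (-2 * d) - w| * |F|
          ≤ ((C₂ * C₁) ^ 2 * (u * b ^ 2)) * (C₇ * (Real.pi ^ 2 * t) * w) * (C₈ * F₀) := by
            gcongr
            exact h7b.trans (by gcongr)
        _ = _ := by ring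
    have t3 : |A ^ 2 * w * (F - F₀)| ≤ (C₂ * C₁) ^ 2 * L * (F₀ * (u * (b ^ 2 * t * w))) := by
      rw [abs_mul, abs_mul, abs_of_nonneg (sq_nonneg A), abs_of_pos hw0]
      calc A ^ 2 * w * |F - F₀| ≤ ((C₂ * C₁) ^ 2 * (u * b ^ 2)) * w * (L * F₀ * t) := by
            gcongr
            exact hF.trans (by gcongr)
        _ = _ := by ring
    have t4 : |F₀ * w * (u * p ^ 2 * (‖fourier φ x‖ ^ 2 - 1))|
        ≤ C₁ ^ 2 * (C₂ * Real.pi ^ 2) * (F₀ * (u * (b ^ 2 * t * w))) := by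
      rw [abs_mul, abs_mul (u * p ^ 2), abs_of_nonneg (by positivity : 0 ≤ F₀ * w),
        abs_of_nonneg (by positivity : 0 ≤ u * p ^ 2)]
      calc F₀ * w * (u * p ^ 2 * |‖fourier φ x‖ ^ 2 - 1|)
          ≤ F₀ * w * (u * (C₁ * b) ^ 2 * (C₂ * (Real.pi ^ 2 * t))) := by
            gcongr
            exact h2b.trans (by gcongr)
        _ = _ := by ring
    rw [esplit]
    refine (abs_add_le _ _).trans ((add_le_add ((abs_add_le _ _).trans
      (add_le_add ((abs_add_le _ _).trans (add_le_add t1 t2)) t3)) t4).trans ?_)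
    calc _ = E₂ * F₀ * (u * (b ^ 2 * t * w)) := by rw [hE₂]; ring
      _ ≤ E₂ * F₀ * (u * (u ^ (-β) * V)) := by gcongr
      _ = E₂ * F₀ * u ^ (-β) * (u * V) := by ring
      _ ≤ _ := by gcongr; linarith

end Comparison

/-! ### The filters as polynomials in the shift -/

section FilterPolynomial

variable {φ ψ : ℝ → ℝ} {T M : ℕ} {α : ℝ}

/-- The polynomial `P` with `H_j(λ) = P(e^{iλ})`. -/
noncomputable def filterPoly (φ ψ : ℝ → ℝ) (T j : ℕ) : Polynomial ℝ :=
  ∑ i ∈ Finset.range (2 ^ j * T + T + 1),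
    Polynomial.C (filterCoeff φ ψ j (-(i : ℤ))) * Polynomial.X ^ i

lemma natDegree_filterPoly_le (φ ψ : ℝ → ℝ) (T j : ℕ) :
    (filterPoly φ ψ T j).natDegree ≤ 2 ^ j * T + T := by
  refine Polynomial.natDegree_sum_le_of_forall_le _ _ fun i hi => ?_
  refine (Polynomial.natDegree_C_mul_X_pow_le _ _).trans ?_
  rw [Finset.mem_range] at hi
  omega

lemma shift_mem_range
    (hφ : Function.support φ ⊆ Set.Ioo (-(T : ℝ)) 0) (hψ : Function.support ψ ⊆ Set.Ioo 0 (T : ℝ))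
    {j : ℕ} {t : ℝ} {l : ℤ} (h : φ (t - l) * ψ (t / 2 ^ j) ≠ 0) :
    ∃ i ∈ Finset.range (2 ^ j * T + T + 1), l = (i : ℤ) := by
  have h2j : (0 : ℝ) < 2 ^ j := by positivity
  obtain ⟨h1, h2⟩ := hφ (left_ne_zero_of_mul h)
  obtain ⟨h3, h4⟩ := hψ (right_ne_zero_of_mul h)
  have h5 : 0 < t := by simpa [h2j] using h3
  rw [div_lt_iff₀ h2j] at h4
  have h6 : (0 : ℝ) ≤ l := by linarith
  have h7 : (l : ℝ) ≤ 2 ^ j * T + T := by linarith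
  have h6' : 0 ≤ l := by exact_mod_cast h6
  lift l to ℕ using h6'
  refine ⟨l, ?_, rfl⟩
  rw [Finset.mem_range, Nat.lt_succ_iff]
  exact_mod_cast h7

lemma filterCoeff_eq_zero
    (hφ : Function.support φ ⊆ Set.Ioo (-(T : ℝ)) 0) (hψ : Function.support ψ ⊆ Set.Ioo 0 (T : ℝ))
    {j : ℕ} {l : ℤ} (hl : ∀ i ∈ Finset.range (2 ^ j * T + T + 1), l ≠ (i : ℤ)) :
    filterCoeff φ ψ j (-l) = 0 := by
  have : ∀ t, φ (t + (-l : ℤ)) * ψ (t / 2 ^ j) = 0 := by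
    intro t
    by_contra hne
    rw [Int.cast_neg, ← sub_eq_add_neg] at hne
    obtain ⟨i, hi, h⟩ := shift_mem_range hφ hψ hne
    exact hl i hi h
  simp only [filterCoeff, this]
  simp

lemma transferFunction_eq_aeval
    (hφ : Function.support φ ⊆ Set.Ioo (-(T : ℝ)) 0) (hψ : Function.support ψ ⊆ Set.Ioo 0 (T : ℝ))
    (j : ℕ) (x : ℝ) :
    transferFunction φ ψ j x
      = Polynomial.aeval (Complex.exp (Complex.I * (x : ℂ))) (filterPoly φ ψ T j) := by
  rw [transferFunction, filterPoly, map_sum, ← (Equiv.neg ℤ).tsum_eq,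
    tsum_eq_sum (s := (Finset.range (2 ^ j * T + T + 1)).map Nat.castEmbedding)]
  · rw [Finset.sum_map]
    refine Finset.sum_congr rfl fun i _ => ?_
    simp only [Equiv.neg_apply, Nat.castEmbedding_apply, map_mul, Polynomial.aeval_C, map_pow,
      Polynomial.aeval_X, Complex.coe_algebraMap, ← Complex.exp_nat_mul]
    congr 2
    push_cast
    ring
  · intro l hl
    rw [Equiv.neg_apply, filterCoeff_eq_zero hφ hψ, Complex.ofReal_zero, zero_mul]
    rintro i hi rfl
    exact hl (by simpa using hi)

/-- The wavelet coefficients as linear functionals of the sequence. -/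
lemma waveletCoeff_eq_sum (hφ2 : MemLp φ 2) (hψ2 : MemLp ψ 2) (hψi : Integrable ψ)
    (hφ : Function.support φ ⊆ Set.Ioo (-(T : ℝ)) 0) (hψ : Function.support ψ ⊆ Set.Ioo 0 (T : ℝ))
    (x : ℤ → ℝ) (j : ℕ) (k : ℤ) :
    waveletCoeff φ ψ x j k = ∑ i ∈ Finset.range (2 ^ j * T + T + 1),
      filterCoeff φ ψ j (-(i : ℤ)) * x (2 ^ j * k + i) := by
  have h2j : (0 : ℝ) < 2 ^ j := by positivity
  have hψd2 : MemLp (fun t => ψ (t / 2 ^ j)) 2 :=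
    (memLp_two_iff_integrable_sq (hψi.comp_div h2j.ne').aestronglyMeasurable).mpr
      (hψ2.integrable_sq.comp_div h2j.ne')
  have hi : ∀ i : ℕ, Integrable fun t => φ (t + (-(i : ℤ) : ℤ)) * ψ (t / 2 ^ j) := fun i =>
    (hφ2.comp_measurePreserving (measurePreserving_add_right volume _)).integrable_mul hψd2
  rw [waveletCoeff, ← integral_add_right_eq_self _ ((2 : ℝ) ^ j * k)]
  have e : ∀ t : ℝ, interpolate φ x (t + 2 ^ j * k) * dilated ψ j k (t + 2 ^ j * k)
      = ∑ i ∈ Finset.range (2 ^ j * T + T + 1), (2 : ℝ) ^ (-(j : ℝ) / 2) * x (2 ^ j * k + i) *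
        (φ (t + (-(i : ℤ) : ℤ)) * ψ (t / 2 ^ j)) := by
    intro t
    have e1 : (t + 2 ^ j * k) / 2 ^ j - (k : ℝ) = t / 2 ^ j := by
      rw [add_div, mul_div_cancel_left₀ _ h2j.ne', add_sub_cancel_right]
    rw [interpolate, dilated, e1, ← (Equiv.addLeft ((2 : ℤ) ^ j * k)).tsum_eq, ← tsum_mul_right,
      tsum_eq_sum (s := (Finset.range (2 ^ j * T + T + 1)).map Nat.castEmbedding), Finset.sum_map]
    · refine Finset.sum_congr rfl fun i _ => ?_
      have e2 : t + 2 ^ j * k - (((2 : ℤ) ^ j * k + (i : ℤ) : ℤ) : ℝ) = t + ((-(i : ℤ) : ℤ) : ℝ) := by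
        push_cast; ring
      simp only [Equiv.coe_addLeft, Nat.castEmbedding_apply]
      rw [e2]; ring
    · intro l hl
      have e2 : t + 2 ^ j * k - (((2 : ℤ) ^ j * k + l : ℤ) : ℝ) = t - l := by
        push_cast; ring
      simp only [Equiv.coe_addLeft]
      rw [e2]
      by_contra hne
      have h0 : φ (t - l) * ψ (t / 2 ^ j) ≠ 0 := by
        intro h0
        apply hne
        rw [show ∀ a b c d : ℝ, a * b * (c * d) = a * c * (b * d) by intros; ring, h0, mul_zero]
      obtain ⟨i, hi, rfl⟩ := shift_mem_range hφ hψ h0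
      exact hl (by simpa using hi)
  simp_rw [e]
  rw [integral_finsetSum _ fun i _ => (hi i).const_mul _]
  refine Finset.sum_congr rfl fun i _ => ?_
  rw [integral_const_mul, filterCoeff]; ring

/-- The forward shift on sequences. -/
def shift : (ℤ → ℝ) →ₗ[ℝ] (ℤ → ℝ) where
  toFun x k := x (k + 1)
  map_add' _ _ := rfl
  map_smul' _ _ := rfl

lemma shift_pow_apply (i : ℕ) (x : ℤ → ℝ) (k : ℤ) : (shift ^ i) x k = x (k + i) := by
  induction i generalizing k with
  | zero => simp
  | succ i ih =>
    rw [pow_succ', Module.End.mul_apply]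
    change (shift ^ i) x (k + 1) = _
    rw [ih]; push_cast; congr 1; ring

lemma aeval_shift_apply (p : Polynomial ℝ) (x : ℤ → ℝ) (k : ℤ) :
    Polynomial.aeval shift p x k
      = ∑ i ∈ Finset.range (p.natDegree + 1), p.coeff i * x (k + i) := by
  rw [Polynomial.aeval_eq_sum_range, LinearMap.sum_apply, Finset.sum_apply]
  refine Finset.sum_congr rfl fun i _ => ?_
  rw [LinearMap.smul_apply, Pi.smul_apply, shift_pow_apply, smul_eq_mul]

/-- `shift - 1` is the forward difference while `iterDiff` is the backward one, whence the
displacement by `M`. In the spectral domain it is a factor of modulus 1. -/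
lemma shift_sub_one_pow_apply {Ω : Type*} (X : ℤ → Ω → ℝ) (ω : Ω) (M : ℕ) (k : ℤ) :
    ((shift - 1) ^ M) (fun k => X k ω) k = iterDiff M X (k + M) ω := by
  induction M generalizing k with
  | zero => simp [iterDiff]
  | succ M ih =>
    rw [pow_succ', Module.End.mul_apply, LinearMap.sub_apply, Pi.sub_apply]
    change ((shift - 1) ^ M) (fun k => X k ω) (k + 1) - ((shift - 1) ^ M) (fun k => X k ω) k = _
    rw [ih, ih, iterDiff, iterDiff, Function.iterate_succ_apply', diff]
    push_cast
    congr 2 <;> ring_nf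

lemma aeval_shift_filterPoly (φ ψ : ℝ → ℝ) (T j : ℕ) (x : ℤ → ℝ) (k : ℤ) :
    Polynomial.aeval shift (filterPoly φ ψ T j) x k = ∑ i ∈ Finset.range (2 ^ j * T + T + 1),
      filterCoeff φ ψ j (-(i : ℤ)) * x (k + i) := by
  rw [filterPoly, map_sum, LinearMap.sum_apply, Finset.sum_apply]
  refine Finset.sum_congr rfl fun i _ => ?_
  rw [map_mul, Polynomial.aeval_C, map_pow, Polynomial.aeval_X, Module.End.mul_apply,
    Module.algebraMap_end_apply, Pi.smul_apply, shift_pow_apply, smul_eq_mul]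

/-- If `(z - 1) ^ M` divides the filter, the wavelet coefficients are linear functionals of the
`M`-th difference. -/
lemma waveletCoeff_eq_sum_iterDiff (hφ2 : MemLp φ 2) (hψ2 : MemLp ψ 2) (hψi : Integrable ψ)
    (hφ : Function.support φ ⊆ Set.Ioo (-(T : ℝ)) 0) (hψ : Function.support ψ ⊆ Set.Ioo 0 (T : ℝ))
    {j : ℕ} {B : Polynomial ℝ} (hB : filterPoly φ ψ T j = (Polynomial.X - 1) ^ M * B)
    {Ω : Type*} (X : ℤ → Ω → ℝ) (ω : Ω) (k : ℤ) :
    waveletCoeff φ ψ (fun k => X k ω) j k = ∑ i ∈ Finset.range (B.natDegree + 1),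
      B.coeff i * iterDiff M X (2 ^ j * k + i + M) ω := by
  rw [waveletCoeff_eq_sum hφ2 hψ2 hψi hφ hψ, ← aeval_shift_filterPoly φ ψ T j (fun k => X k ω), hB,
    mul_comm, map_mul, Module.End.mul_apply, aeval_shift_apply]
  simp only [map_pow, map_sub, Polynomial.aeval_X, map_one, shift_sub_one_pow_apply]

/-- The transfer functions have a zero of order `M` at the origin. -/
lemma WaveletAssumptions.dvd_filterPoly (h : WaveletAssumptions φ ψ M α)
    (hφ : Function.support φ ⊆ Set.Ioo (-(T : ℝ)) 0) (hψ : Function.support ψ ⊆ Set.Ioo 0 (T : ℝ))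
    (j : ℕ) : (Polynomial.X - 1) ^ M ∣ filterPoly φ ψ T j := by
  set p := filterPoly φ ψ T j with hp
  rcases eq_or_ne p 0 with hp0 | hp0
  · rw [hp0]; exact dvd_zero _
  have hbound : ∃ C : ℝ, ∀ x : ℝ, |x| ≤ Real.pi → ‖transferFunction φ ψ j x‖ ≤ C * |x| ^ M := by
    obtain ⟨C₁, hC₁, h1⟩ := h.exists_wavelet_bound hψ
    obtain ⟨C₂, hC₂, h2⟩ := h.exists_scaling_bound hφ
    obtain ⟨C₃, hC₃, h3⟩ := h.exists_transfer_approx hφ hψ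
    have hα := h.one_lt_exponent
    set r : ℝ := (2 : ℝ) ^ ((j : ℝ) / 2) with hr
    have hr0 : 0 < r := Real.rpow_pos_of_pos (by norm_num) _
    refine ⟨r * (C₂ * (C₁ * ((2 : ℝ) ^ j) ^ M)) + C₃ * (r * ((2 : ℝ) ^ j) ^ (-α)), fun x hx => ?_⟩
    have e1 := h3 j x hx
    have e2 := norm_sub_norm_le (transferFunction φ ψ j x)
      ((r : ℂ) * (fourier φ x * starRingEnd ℂ (fourier ψ (2 ^ j * x))))
    have e3 : ‖(r : ℂ) * (fourier φ x * starRingEnd ℂ (fourier ψ (2 ^ j * x)))‖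
        ≤ r * (C₂ * (C₁ * ((2 : ℝ) ^ j) ^ M)) * |x| ^ M := by
      rw [norm_mul, norm_mul, RCLike.norm_conj, Complex.norm_real, Real.norm_eq_abs,
        abs_of_pos hr0]
      have e4 : ‖fourier ψ (2 ^ j * x)‖ ≤ C₁ * (((2 : ℝ) ^ j) ^ M * |x| ^ M) := by
        refine (h1 _).trans (mul_le_mul_of_nonneg_left ?_ hC₁.le)
        rw [abs_mul, abs_of_pos (by positivity : (0 : ℝ) < 2 ^ j), mul_pow]
        refine mul_le_of_le_one_right (by positivity) ?_
        refine Real.rpow_le_one_of_one_le_of_nonpos ?_ ?_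
        · have : 0 ≤ (2 : ℝ) ^ j * |x| := by positivity
          linarith
        · have : (0 : ℝ) ≤ M := Nat.cast_nonneg M
          linarith
      calc r * (‖fourier φ x‖ * ‖fourier ψ (2 ^ j * x)‖)
          ≤ r * (C₂ * (C₁ * (((2 : ℝ) ^ j) ^ M * |x| ^ M))) := by
            gcongr
            exact (h2 x).1
        _ = _ := by ring
    have e5 : C₃ * (r * (((2 : ℝ) ^ j) ^ (-α) * |x| ^ M))
      = C₃ * (r * ((2 : ℝ) ^ j) ^ (-α)) * |x| ^ M := by ring
    rw [add_mul]
    linarith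
  obtain ⟨C, hC⟩ := hbound
  -- Write `p = (z - 1)^k q` with `q(1) ≠ 0`. If `k < M`, dividing the bound `C |x|^M` by `|e^{ix} -
  -- 1|^k ≥ (2|x|/π)^k` forces `q(e^{ix}) → 0` as `x → 0`, a contradiction.
  obtain ⟨q, hq, hq1⟩ := Polynomial.exists_eq_pow_rootMultiplicity_mul_and_not_dvd p hp0 1
  set k := p.rootMultiplicity 1 with hk
  rw [Polynomial.dvd_iff_isRoot, Polynomial.IsRoot.def] at hq1
  rw [map_one] at hq
  by_cases hkM : M ≤ k
  · rw [hq]; exact (pow_dvd_pow _ hkM).mul_right q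
  exfalso
  push Not at hkM
  have hcont : Filter.Tendsto (fun x : ℝ => ‖Polynomial.aeval (Complex.exp (Complex.I * (x : ℂ))) q‖)
      (nhdsWithin 0 {0}ᶜ) (nhds ‖Polynomial.aeval (1 : ℂ) q‖) := by
    have : Continuous (fun x : ℝ => ‖Polynomial.aeval (Complex.exp (Complex.I * (x : ℂ))) q‖) := by
      have := (Polynomial.continuous_aeval (A := ℂ) q)
      fun_prop
    have h0 := this.tendsto 0
    simp only [Complex.ofReal_zero, mul_zero, Complex.exp_zero] at h0
    exact h0.mono_left nhdsWithin_le_nhds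
  have hupper : Filter.Tendsto (fun x : ℝ => C * (2 / Real.pi)⁻¹ ^ k * |x| ^ (M - k))
      (nhdsWithin 0 {0}ᶜ) (nhds 0) := by
    have : Continuous (fun x : ℝ => C * (2 / Real.pi)⁻¹ ^ k * |x| ^ (M - k)) := by fun_prop
    have h0 := this.tendsto 0
    simp only [abs_zero, zero_pow (by omega : M - k ≠ 0), mul_zero] at h0
    exact h0.mono_left nhdsWithin_le_nhds
  have hle : ∀ᶠ x : ℝ in nhdsWithin (0 : ℝ) {0}ᶜ,
      ‖Polynomial.aeval (Complex.exp (Complex.I * (x : ℂ))) q‖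
        ≤ C * (2 / Real.pi)⁻¹ ^ k * |x| ^ (M - k) := by
    have h1 : ∀ᶠ x : ℝ in nhdsWithin (0 : ℝ) {0}ᶜ, |x| < Real.pi := by
      exact (((continuous_abs.tendsto' (0 : ℝ) 0 abs_zero).eventually
        (Iio_mem_nhds Real.pi_pos)).filter_mono nhdsWithin_le_nhds)
    filter_upwards [h1, self_mem_nhdsWithin] with x hx hx0
    have hx0' : 0 < |x| := abs_pos.mpr hx0
    have h2 := hC x hx.le
    rw [transferFunction_eq_aeval hφ hψ, ← hp, hq, map_mul, map_pow, map_sub, Polynomial.aeval_X,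
      map_one, norm_mul, norm_pow] at h2
    have h3 : 2 / Real.pi * |x| ≤ ‖Complex.exp (Complex.I * (x : ℂ)) - 1‖ := by
      have := (norm_one_sub_exp_bounds (x := -x) (by rw [abs_neg]; exact hx.le)).1
      rw [abs_neg, norm_sub_rev] at this
      convert! this using 4
      push_cast; ring
    set v := ‖Polynomial.aeval (Complex.exp (Complex.I * (x : ℂ))) q‖
    have hv : 0 ≤ v := norm_nonneg _
    have h4 : (2 / Real.pi * |x|) ^ k * v ≤ C * |x| ^ M := le_trans (by gcongr) h2
    have hpos : 0 < (2 / Real.pi * |x|) ^ k := by have := Real.pi_pos; positivity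
    refine le_of_mul_le_mul_left (h4.trans (le_of_eq ?_)) hpos
    have e1 : |x| ^ M = |x| ^ k * |x| ^ (M - k) := by rw [← pow_add]; congr 1; omega
    rw [e1, mul_pow, inv_pow]
    have := Real.pi_pos
    field_simp
  have := le_of_tendsto_of_tendsto hcont hupper hle
  have h5 := norm_le_zero_iff.mp this
  apply hq1
  have h6 : Polynomial.aeval (1 : ℂ) q = ((q.eval 1 : ℝ) : ℂ) := by
    have := Polynomial.aeval_algebraMap_apply ℂ (1 : ℝ) q
    simpa using this
  rw [h6] at h5
  exact_mod_cast h5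

end FilterPolynomial

/-! ### Spectral representation of the wavelet coefficients -/

section SpectralRepresentation

variable {Ω : Type*} [MeasurableSpace Ω] {P : Measure Ω}

lemma norm_sum_sq_eq {ι : Type*} (s : Finset ι) (c : ι → ℝ) (a : ι → ℤ) (x : ℝ) :
    (((‖∑ i ∈ s, (c i : ℂ) * Complex.exp (Complex.I * (x : ℂ) * (a i : ℂ))‖ ^ 2 : ℝ)) : ℂ)
      = ∑ i ∈ s, ∑ k ∈ s, (c i : ℂ) * (c k : ℂ) *
          Complex.exp (Complex.I * (x : ℂ) * ((a i : ℂ) - (a k : ℂ))) := by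
  rw [Complex.ofReal_pow, ← Complex.mul_conj', map_sum, Finset.sum_mul_sum]
  refine Finset.sum_congr rfl fun i _ => Finset.sum_congr rfl fun k _ => ?_
  rw [map_mul, Complex.conj_ofReal, ← Complex.exp_conj, map_mul, map_mul, Complex.conj_I,
    Complex.conj_ofReal, map_intCast, mul_mul_mul_comm, ← Complex.exp_add]
  congr 2
  ring

lemma HasSpectralDensity.variance_sum [IsProbabilityMeasure P] {Y : ℤ → Ω → ℝ} {f : ℝ → ℝ}
    (h : HasSpectralDensity Y P f) {ι : Type*} (s : Finset ι) (c : ι → ℝ) (a : ι → ℤ) :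
    Var[fun ω => ∑ i ∈ s, c i * Y (a i) ω; P] = ∫ x in Set.Ioo (-Real.pi) Real.pi,
      ‖∑ i ∈ s, (c i : ℂ) * Complex.exp (Complex.I * (x : ℂ) * (a i : ℂ))‖ ^ 2 * f x := by
  have hm : ∀ i, MemLp (fun ω => c i * Y (a i) ω) 2 P := fun i => (h.memLp _).const_mul _
  have hint : ∀ i k, IntegrableOn (fun x : ℝ => (c i : ℂ) * (c k : ℂ) *
      (Complex.exp (Complex.I * (x : ℂ) * ((a i : ℂ) - (a k : ℂ))) * (f x : ℂ)))
      (Set.Ioo (-Real.pi) Real.pi) := fun i k => by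
    refine Integrable.const_mul ?_ _
    refine h.integrable.ofReal.bdd_mul (c := 1) (by fun_prop) (.of_forall fun x => ?_)
    rw [Complex.norm_exp]
    simp
  rw [← covariance_self (memLp_finsetSum _ fun i _ => hm i).aemeasurable,
    covariance_fun_sum_fun_sum' (fun i _ => hm i) (fun i _ => hm i)]
  apply Complex.ofReal_injective
  rw [← integral_complex_ofReal]
  have e : ∀ x : ℝ, ((‖∑ i ∈ s, (c i : ℂ) * Complex.exp (Complex.I * (x : ℂ) * (a i : ℂ))‖ ^ 2 * f x
      : ℝ) : ℂ) = ∑ i ∈ s, ∑ k ∈ s, (c i : ℂ) * (c k : ℂ) *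
        (Complex.exp (Complex.I * (x : ℂ) * ((a i : ℂ) - (a k : ℂ))) * (f x : ℂ)) := fun x => by
    rw [Complex.ofReal_mul, norm_sum_sq_eq, Finset.sum_mul]
    refine Finset.sum_congr rfl fun i _ => ?_
    rw [Finset.sum_mul]
    exact Finset.sum_congr rfl fun k _ => by ring
  simp_rw [e]
  rw [integral_finsetSum _ fun i _ => integrable_finsetSum _ fun k _ => hint i k]
  push_cast
  refine Finset.sum_congr rfl fun i _ => ?_
  rw [integral_finsetSum _ fun k _ => hint i k]
  refine Finset.sum_congr rfl fun k _ => ?_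
  rw [integral_const_mul, ← h.cov, covariance_const_mul_left, covariance_const_mul_right]
  push_cast
  ring

/-- The trigonometric polynomial `∑ x_k e^{ikξ}`. -/
noncomputable def trigPoly {n : ℕ} (x : Fin n → ℝ) (ξ : ℝ) : ℂ :=
  ∑ k, (x k : ℂ) * Complex.exp (Complex.I * (ξ : ℂ) * ((k : ℕ) : ℂ))

variable {φ ψ : ℝ → ℝ} {T M : ℕ} {α d : ℝ} {fstar : ℝ → ℝ} {X : ℤ → Ω → ℝ}

/-- The spectral representation of linear combinations of wavelet coefficients. -/
lemma WaveletAssumptions.variance_sum_waveletCoeff [IsProbabilityMeasure P]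
    (h : WaveletAssumptions φ ψ M α)
    (hφ : Function.support φ ⊆ Set.Ioo (-(T : ℝ)) 0) (hψ : Function.support ψ ⊆ Set.Ioo 0 (T : ℝ))
    (hX : HasMemoryParameter X P d fstar) (hd : d ≤ M) (j : ℕ) {n : ℕ} (x : Fin n → ℝ) :
    Var[fun ω => ∑ k, x k * waveletCoeff φ ψ (fun i => X i ω) j (k : ℕ); P]
      = ∫ y in Set.Ioo (-Real.pi) Real.pi,
        ‖trigPoly x (2 ^ j * y)‖ ^ 2 *
          (‖transferFunction φ ψ j y‖ ^ 2 *
            ‖1 - Complex.exp (-(Complex.I * (y : ℂ)))‖ ^ (-2 * d) * fstar y) := by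
  obtain ⟨B, hB⟩ := h.dvd_filterPoly hφ hψ j
  -- `d ≤ M` implies `d - 1/2 < M`, so the `M`-th difference is stationary.
  have hsp := hX.spectral M (by linarith)
  have e1 : (fun ω => ∑ k, x k * waveletCoeff φ ψ (fun i => X i ω) j (k : ℕ))
      = fun ω => ∑ p ∈ (Finset.univ : Finset (Fin n)) ×ˢ Finset.range (B.natDegree + 1),
        (x p.1 * B.coeff p.2) * iterDiff M X (2 ^ j * ((p.1 : ℕ) : ℤ) + (p.2 : ℤ) + M) ω := by
    ext ω
    rw [Finset.sum_product]
    refine Finset.sum_congr rfl fun k _ => ?_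
    rw [waveletCoeff_eq_sum_iterDiff h.memLp_scaling h.memLp_wavelet h.integrable_wavelet hφ hψ hB,
      Finset.mul_sum]
    exact Finset.sum_congr rfl fun i _ => by ring
  rw [e1, hsp.variance_sum _ (fun p : Fin n × ℕ => x p.1 * B.coeff p.2)
    (fun p => 2 ^ j * ((p.1 : ℕ) : ℤ) + (p.2 : ℤ) + M)]
  have h0 : ∀ᵐ y : ℝ ∂(volume.restrict (Set.Ioo (-Real.pi) Real.pi)), y ≠ 0 :=
    ae_restrict_of_ae (by simp [ae_iff])
  refine integral_congr_ae ?_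
  filter_upwards [h0, ae_restrict_mem measurableSet_Ioo] with y hy0 hy
  have hyπ : |y| ≤ Real.pi := (abs_lt.mpr hy).le
  set ε := ‖1 - Complex.exp (-(Complex.I * (y : ℂ)))‖ with hε
  have hε0 : 0 < ε := by
    have := (norm_one_sub_exp_bounds hyπ).1
    have h1 : 0 < 2 / Real.pi * |y| := by have := Real.pi_pos; positivity
    linarith
  set z := Complex.exp (Complex.I * (y : ℂ)) with hz
  have hz1 : ‖z‖ = 1 := by rw [hz, Complex.norm_exp]; simp
  have hzε : ‖z - 1‖ = ε := by
    rw [hε, Complex.exp_neg, ← hz]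
    have hz0 : z ≠ 0 := Complex.exp_ne_zero _
    rw [show 1 - z⁻¹ = (z - 1) * z⁻¹ by field_simp, norm_mul, norm_inv, hz1, inv_one, mul_one]
  have hsum : ∑ p ∈ (Finset.univ : Finset (Fin n)) ×ˢ Finset.range (B.natDegree + 1),
      ((x p.1 * B.coeff p.2 : ℝ) : ℂ) * Complex.exp (Complex.I * (y : ℂ) *
        ((2 ^ j * ((p.1 : ℕ) : ℤ) + (p.2 : ℤ) + M : ℤ) : ℂ))
      = trigPoly x (2 ^ j * y) *
        Polynomial.aeval z B * z ^ M := by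
    rw [trigPoly, Finset.sum_product, Polynomial.aeval_eq_sum_range, Finset.sum_mul, Finset.sum_mul]
    refine Finset.sum_congr rfl fun k _ => ?_
    rw [Finset.mul_sum, Finset.sum_mul]
    refine Finset.sum_congr rfl fun i _ => ?_
    rw [hz, ← Complex.exp_nat_mul, ← Complex.exp_nat_mul, Complex.real_smul]
    rw [show Complex.I * (y : ℂ) * ((2 ^ j * ((k : ℕ) : ℤ) + (i : ℤ) + M : ℤ) : ℂ)
      = Complex.I * ((2 ^ j * y : ℝ) : ℂ) * ((k : ℕ) : ℂ) + (i : ℂ) * (Complex.I * (y : ℂ))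
        + (M : ℂ) * (Complex.I * (y : ℂ)) by push_cast; ring, Complex.exp_add, Complex.exp_add]
    push_cast
    ring
  have hH : ‖transferFunction φ ψ j y‖ = ε ^ M * ‖Polynomial.aeval z B‖ := by
    rw [transferFunction_eq_aeval hφ hψ, hB, map_mul, map_pow, map_sub, Polynomial.aeval_X,
      map_one, norm_mul, norm_pow, ← hz, hzε]
  -- The factor `ε^{2M}` in the spectral density of `Δ^M X` turns `|B|²` into `|H_j|²` and leaves
  -- `ε^{-2d}`.
  rw [hsum, hH, norm_mul, norm_mul, norm_pow, hz1, one_pow, mul_one,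
    show 2 * ((M : ℝ) - d) = ((2 * M : ℕ) : ℝ) + (-2 * d) by push_cast; ring,
    Real.rpow_add hε0, Real.rpow_natCast, pow_mul']
  ring

lemma WaveletAssumptions.integral_waveletCoeff [IsProbabilityMeasure P]
    (h : WaveletAssumptions φ ψ M α)
    (hφ : Function.support φ ⊆ Set.Ioo (-(T : ℝ)) 0) (hψ : Function.support ψ ⊆ Set.Ioo 0 (T : ℝ))
    (hX : HasMemoryParameter X P d fstar) (hd : d ≤ M) (hmean : ∀ k, ∫ ω, iterDiff M X k ω ∂P = 0)
    (j : ℕ) (k : ℤ) : ∫ ω, waveletCoeff φ ψ (fun i => X i ω) j k ∂P = 0 := by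
  obtain ⟨B, hB⟩ := h.dvd_filterPoly hφ hψ j
  have hsp := hX.spectral M (by linarith)
  simp_rw [waveletCoeff_eq_sum_iterDiff h.memLp_scaling h.memLp_wavelet h.integrable_wavelet hφ hψ hB]
  rw [integral_finsetSum _ fun i _ => ((hsp.memLp _).integrable one_le_two).const_mul _]
  exact Finset.sum_eq_zero fun i _ => by rw [integral_const_mul, hmean, mul_zero]

lemma WaveletAssumptions.hasGaussianLaw_waveletCoeff (h : WaveletAssumptions φ ψ M α)
    (hφ : Function.support φ ⊆ Set.Ioo (-(T : ℝ)) 0) (hψ : Function.support ψ ⊆ Set.Ioo 0 (T : ℝ))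
    (hX : IsGaussianProcess X P) (j n : ℕ) :
    HasGaussianLaw (fun ω (k : Fin n) => waveletCoeff φ ψ (fun i => X i ω) j (k : ℕ)) P := by
  classical
  have hp : IsGaussianProcess (fun (k : Fin n) ω => waveletCoeff φ ψ (fun i => X i ω) j (k : ℕ)) P := by
    refine hX.of_isGaussianProcess fun k => ?_
    set s := (Finset.range (2 ^ j * T + T + 1)).image fun i : ℕ => 2 ^ j * ((k : ℕ) : ℤ) + (i : ℤ)
      with hs
    refine ⟨s, ∑ i ∈ (Finset.range (2 ^ j * T + T + 1)).attach, filterCoeff φ ψ j (-((i : ℕ) : ℤ)) •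
      ContinuousLinearMap.proj (R := ℝ) (φ := fun _ : s => ℝ) ⟨2 ^ j * ((k : ℕ) : ℤ) + ((i : ℕ) : ℤ),
        Finset.mem_image_of_mem _ i.2⟩, fun ω => ?_⟩
    rw [waveletCoeff_eq_sum h.memLp_scaling h.memLp_wavelet h.integrable_wavelet hφ hψ,
      ← Finset.sum_attach]
    simp
  have hL := hp.hasGaussianLaw Finset.univ
  let L : ({k // k ∈ (Finset.univ : Finset (Fin n))} → ℝ) →L[ℝ] (Fin n → ℝ) :=
    ContinuousLinearMap.pi fun k =>
      ContinuousLinearMap.proj (R := ℝ) (φ := fun _ : {k // k ∈ (Finset.univ : Finset (Fin n))} => ℝ)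
        ⟨k, Finset.mem_univ k⟩
  exact hL.map L

end SpectralRepresentation

/-! ### Trigonometric polynomials against decaying weights -/

section WeightedParseval

lemma continuous_trigPoly {n : ℕ} (x : Fin n → ℝ) : Continuous (trigPoly x) := by
  unfold trigPoly
  fun_prop

lemma norm_trigPoly_le {n : ℕ} (x : Fin n → ℝ) (ξ : ℝ) : ‖trigPoly x ξ‖ ≤ ∑ k, |x k| := by
  refine (norm_sum_le _ _).trans (Finset.sum_le_sum fun k _ => ?_)
  rw [norm_mul, Complex.norm_real, Complex.norm_exp, Real.norm_eq_abs]
  simp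

lemma norm_trigPoly_sq_le {n : ℕ} (x : Fin n → ℝ) (ξ : ℝ) :
    ‖‖trigPoly x ξ‖ ^ 2‖ ≤ (∑ k, |x k|) ^ 2 := by
  rw [Real.norm_of_nonneg (by positivity)]
  gcongr
  exact norm_trigPoly_le x ξ

lemma integral_norm_trigPoly_sq {n : ℕ} (x : Fin n → ℝ) (u : ℝ) :
    ∫ η in (0 : ℝ)..2 * Real.pi, ‖trigPoly x (u - η)‖ ^ 2 = 2 * Real.pi * ∑ k, x k ^ 2 := by
  apply Complex.ofReal_injective
  rw [← intervalIntegral.integral_ofReal]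
  have e : ∀ η : ℝ, ((‖trigPoly x (u - η)‖ ^ 2 : ℝ) : ℂ) = ∑ i, ∑ k, (x i : ℂ) * (x k : ℂ) *
      Complex.exp (Complex.I * ((u - η : ℝ) : ℂ) * (((i : ℕ) : ℂ) - ((k : ℕ) : ℂ))) := fun η => by
    simpa [trigPoly] using norm_sum_sq_eq Finset.univ x (fun i => ((i : ℕ) : ℤ)) (u - η)
  simp_rw [e]
  rw [intervalIntegral.integral_finsetSum fun i _ =>
    Continuous.intervalIntegrable (by fun_prop) _ _]
  push_cast
  rw [Finset.mul_sum]
  refine Finset.sum_congr rfl fun i _ => ?_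
  rw [intervalIntegral.integral_finsetSum fun k _ =>
    Continuous.intervalIntegrable (by fun_prop) _ _, Finset.sum_eq_single i]
  · simp
    ring
  · intro k _ hki
    have hc : (-(Complex.I * (((i : ℕ) : ℂ) - ((k : ℕ) : ℂ)))) ≠ 0 := by
      rw [neg_ne_zero]
      refine mul_ne_zero Complex.I_ne_zero (sub_ne_zero.mpr ?_)
      intro hik
      exact hki (Fin.ext (by exact_mod_cast hik.symm))
    have e2 : ∀ η : ℝ, Complex.exp (Complex.I * ((u : ℂ) - (η : ℂ)) * (((i : ℕ) : ℂ) - ((k : ℕ) : ℂ)))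
        = Complex.exp (Complex.I * u * (((i : ℕ) : ℂ) - ((k : ℕ) : ℂ))) *
          Complex.exp (-(Complex.I * (((i : ℕ) : ℂ) - ((k : ℕ) : ℂ))) * η) := fun η => by
      rw [← Complex.exp_add]; congr 1; ring
    simp_rw [e2]
    rw [intervalIntegral.integral_const_mul, intervalIntegral.integral_const_mul,
      integral_exp_mul_complex hc]
    have e3 : Complex.exp (-(Complex.I * (((i : ℕ) : ℂ) - ((k : ℕ) : ℂ))) * ((2 * Real.pi : ℝ) : ℂ))
        = 1 := by
      rw [Complex.exp_eq_one_iff]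
      refine ⟨((k : ℕ) : ℤ) - ((i : ℕ) : ℤ), ?_⟩
      push_cast; ring
    rw [e3]
    simp
  · simp

lemma integrable_weight {s : ℝ} (hs : 1 < s) : Integrable fun ξ : ℝ => (1 + |ξ|) ^ (-s) := by
  have := integrable_one_add_norm (E := ℝ) (μ := volume) (r := s) (by simpa using hs)
  simpa using this

lemma integrable_weight_mul_norm_trigPoly {s : ℝ} (hs : 1 < s) {n : ℕ} (x : Fin n → ℝ) (η : ℝ) :
    Integrable fun ξ : ℝ => (1 + |ξ|) ^ (-s) * ‖trigPoly x (ξ - η)‖ ^ 2 := by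
  refine (integrable_weight hs).mul_bdd (c := (∑ k, |x k|) ^ 2) ?_
    (.of_forall fun ξ => norm_trigPoly_sq_le x _)
  have := continuous_trigPoly x
  exact Continuous.aestronglyMeasurable (by fun_prop)

/-- Integrals of trigonometric polynomials against integrable polynomially decaying weights. -/
lemma integral_weight_mul_norm_trigPoly_le {s : ℝ} (hs : 1 < s) {n : ℕ} (x : Fin n → ℝ) :
    ∫ ξ : ℝ, (1 + |ξ|) ^ (-s) * ‖trigPoly x ξ‖ ^ 2
      ≤ ((1 + 2 * Real.pi) ^ s * ∫ ξ : ℝ, (1 + |ξ|) ^ (-s)) * ∑ k, x k ^ 2 := by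
  have hpi := Real.pi_pos
  set w : ℝ → ℝ := fun ξ => (1 + |ξ|) ^ (-s) with hw
  have hw1 : ∀ ξ η : ℝ, 0 ≤ η → η ≤ 2 * Real.pi → w (ξ - η) ≤ (1 + 2 * Real.pi) ^ s * w ξ := by
    intro ξ η h0 h1
    have h2 : 1 + |ξ| ≤ (1 + 2 * Real.pi) * (1 + |ξ - η|) := by
      have h3 : |ξ| ≤ |ξ - η| + η := by
        have := abs_add_le (ξ - η) η
        rwa [sub_add_cancel, abs_of_nonneg h0] at this
      nlinarith [abs_nonneg (ξ - η)]
    have h4 : (1 + |ξ|) ^ s ≤ (1 + 2 * Real.pi) ^ s * (1 + |ξ - η|) ^ s := by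
      rw [← Real.mul_rpow (by positivity) (by positivity)]
      exact Real.rpow_le_rpow (by positivity) h2 (by linarith)
    simp only [hw]
    rw [Real.rpow_neg (by positivity), Real.rpow_neg (by positivity), ← div_eq_mul_inv,
      le_div_iff₀ (by positivity), inv_mul_le_iff₀ (by positivity), mul_comm]
    exact h4
  set I := ∫ ξ : ℝ, w ξ * ‖trigPoly x ξ‖ ^ 2 with hI
  -- A translation by at most one period changes the weight by a bounded factor. Averaging this
  -- inequality over `η` and exchanging the integrals replaces `|p|²` by its integral over a period,
  -- which Parseval evaluates.
  have hle : ∀ η ∈ Set.Icc (0 : ℝ) (2 * Real.pi),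
      I ≤ ∫ ξ : ℝ, (1 + 2 * Real.pi) ^ s * (w ξ * ‖trigPoly x (ξ - η)‖ ^ 2) := by
    intro η hη
    rw [hI, ← integral_sub_right_eq_self _ η]
    have h0 := integrable_weight_mul_norm_trigPoly hs x 0
    simp only [sub_zero] at h0
    refine integral_mono (h0.comp_sub_right η)
      ((integrable_weight_mul_norm_trigPoly hs x η).const_mul _) fun ξ => ?_
    dsimp only
    rw [← mul_assoc]
    exact mul_le_mul_of_nonneg_right (hw1 ξ η hη.1 hη.2) (by positivity)
  have hprod : Integrable (Function.uncurry fun (η ξ : ℝ) =>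
      (1 + 2 * Real.pi) ^ s * (w ξ * ‖trigPoly x (ξ - η)‖ ^ 2))
      ((volume.restrict (Set.Ioc 0 (2 * Real.pi))).prod volume) := by
    refine Integrable.const_mul ?_ _
    have h1 : Integrable (fun p : ℝ × ℝ => (1 : ℝ) * w p.2)
        ((volume.restrict (Set.Ioc 0 (2 * Real.pi))).prod volume) :=
      Integrable.mul_prod (f := fun _ : ℝ => (1 : ℝ)) (integrable_const _) (integrable_weight hs)
    simp only [one_mul] at h1
    refine h1.mul_bdd (c := (∑ k, |x k|) ^ 2) ?_ (.of_forall fun p => norm_trigPoly_sq_le x _)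
    have := continuous_trigPoly x
    exact Continuous.aestronglyMeasurable (by fun_prop)
  have h1 : 2 * Real.pi * I ≤ ∫ η in (0 : ℝ)..2 * Real.pi,
      ∫ ξ : ℝ, (1 + 2 * Real.pi) ^ s * (w ξ * ‖trigPoly x (ξ - η)‖ ^ 2) := by
    have h2 := intervalIntegral.integral_mono_on (a := 0) (b := 2 * Real.pi) (f := fun _ => I)
      (by positivity) (by simp)
      ((intervalIntegrable_iff_integrableOn_Ioc_of_le (by positivity)).mpr hprod.integral_prod_left)
      hle
    simpa using h2
  rw [intervalIntegral.integral_of_le (by positivity), integral_integral_swap hprod] at h1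
  simp_rw [integral_const_mul, ← intervalIntegral.integral_of_le
    (by positivity : (0 : ℝ) ≤ 2 * Real.pi), integral_norm_trigPoly_sq] at h1
  rw [integral_mul_const] at h1
  have h2 : 0 < 2 * Real.pi := by positivity
  refine le_of_mul_le_mul_left (h1.trans (le_of_eq ?_)) h2
  ring

/-- The rescaled version of `integral_weight_mul_norm_trigPoly_le`. -/
lemma integral_dilated_weight_mul_norm_trigPoly_le {s : ℝ} (hs : 1 < s) {n : ℕ} (x : Fin n → ℝ)
    (j : ℕ) :
    Integrable (fun y : ℝ => ‖trigPoly x (2 ^ j * y)‖ ^ 2 * (2 ^ j * (1 + |2 ^ j * y|) ^ (-s))) ∧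
    ∫ y : ℝ, ‖trigPoly x (2 ^ j * y)‖ ^ 2 * (2 ^ j * (1 + |2 ^ j * y|) ^ (-s))
      ≤ ((1 + 2 * Real.pi) ^ s * ∫ ξ : ℝ, (1 + |ξ|) ^ (-s)) * ∑ k, x k ^ 2 := by
  have h2j : (0 : ℝ) < 2 ^ j := by positivity
  have h0 := integrable_weight_mul_norm_trigPoly hs x 0
  simp only [sub_zero] at h0
  have e : (fun y : ℝ => ‖trigPoly x (2 ^ j * y)‖ ^ 2 * (2 ^ j * (1 + |2 ^ j * y|) ^ (-s)))
      = fun y => 2 ^ j * (fun ξ : ℝ => (1 + |ξ|) ^ (-s) * ‖trigPoly x ξ‖ ^ 2) (2 ^ j * y) := by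
    ext y; ring
  rw [e]
  refine ⟨(h0.comp_mul_left' h2j.ne').const_mul _, ?_⟩
  rw [integral_const_mul, Measure.integral_comp_mul_left (fun ξ : ℝ =>
    (1 + |ξ|) ^ (-s) * ‖trigPoly x ξ‖ ^ 2), abs_of_pos (inv_pos.mpr h2j), smul_eq_mul, ← mul_assoc,
    mul_inv_cancel₀ h2j.ne', one_mul]
  exact integral_weight_mul_norm_trigPoly_le hs x

lemma integral_dilated_weight {s : ℝ} (hs : 1 < s) (j : ℕ) :
    Integrable (fun y : ℝ => 2 ^ j * (1 + |2 ^ j * y|) ^ (-s)) ∧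
    ∫ y : ℝ, 2 ^ j * (1 + |2 ^ j * y|) ^ (-s) = ∫ ξ : ℝ, (1 + |ξ|) ^ (-s) := by
  have h2j : (0 : ℝ) < 2 ^ j := by positivity
  refine ⟨((integrable_weight hs).comp_mul_left' h2j.ne').const_mul _, ?_⟩
  rw [integral_const_mul, Measure.integral_comp_mul_left (fun ξ : ℝ => (1 + |ξ|) ^ (-s)),
    abs_of_pos (inv_pos.mpr h2j), smul_eq_mul, ← mul_assoc, mul_inv_cancel₀ h2j.ne', one_mul]

end WeightedParseval

/-! ### The limiting variance constant -/

section WaveletEnergy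

variable {φ ψ : ℝ → ℝ} {T M : ℕ} {α β L dmin dmax : ℝ}

/-- The quantity `u/(1 + u²)` is below both `u` and `u⁻¹`, hence its `D`-th power minorises every
`u^e` with `|e| ≤ D`. This minorant does not depend on `e` and extends continuously to `u = 0`. -/
lemma ratio_rpow_le_rpow {u D e : ℝ} (hu : 0 < u) (he : |e| ≤ D) :
    (u / (1 + u ^ 2)) ^ D ≤ u ^ e := by
  have hD : 0 ≤ D := (abs_nonneg _).trans he
  have hm : 0 < u / (1 + u ^ 2) := by positivity
  rcases le_total u 1 with h | h
  · refine (Real.rpow_le_rpow hm.le (div_le_self hu.le (by nlinarith)) hD).trans ?_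
    exact Real.rpow_le_rpow_of_exponent_ge hu h (abs_le.mp he).2
  · have h1 : u / (1 + u ^ 2) ≤ u⁻¹ := by
      rw [div_le_iff₀ (by positivity)]
      field_simp
      nlinarith
    refine (Real.rpow_le_rpow hm.le h1 hD).trans ?_
    rw [Real.inv_rpow hu.le, ← Real.rpow_neg hu.le]
    exact Real.rpow_le_rpow_of_exponent_le h (abs_le.mp he).1

lemma abs_neg_two_mul_le {d : ℝ} (hd : d ∈ Set.Icc dmin dmax) :
    |-2 * d| ≤ 2 * (|dmin| + |dmax|) := by
  have h1 := neg_abs_le dmin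
  have h2 := le_abs_self dmax
  have h3 := abs_nonneg dmin
  have h4 := abs_nonneg dmax
  rw [abs_le]
  constructor <;> linarith [hd.1, hd.2]

/-- The wavelet energy at memory parameter `d`. -/
noncomputable def waveletEnergy (ψ : ℝ → ℝ) (d : ℝ) : ℝ := ∫ ξ : ℝ, ‖fourier ψ ξ‖ ^ 2 * |ξ| ^ (-2 * d)

lemma WaveletAssumptions.exists_energy_envelope (h : WaveletAssumptions φ ψ M α)
    (hψ : Function.support ψ ⊆ Set.Ioo 0 (T : ℝ)) (hdM : ∀ d ∈ Set.Icc dmin dmax, d ≤ M) :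
    ∃ C : ℝ, 0 < C ∧ ∀ d ∈ Set.Icc dmin dmax, ∀ ξ : ℝ, ξ ≠ 0 →
      ‖fourier ψ ξ‖ ^ 2 * |ξ| ^ (-2 * d) ≤ C * (1 + |ξ|) ^ (-(2 * α + 2 * dmin)) := by
  obtain ⟨C, hC, h1⟩ := h.exists_wavelet_bound hψ
  refine ⟨C ^ 2, by positivity, fun d hd ξ hξ => ?_⟩
  have h2 := sq_envelope_le (α := α) (abs_pos.mpr hξ) (hdM d hd)
  calc ‖fourier ψ ξ‖ ^ 2 * |ξ| ^ (-2 * d)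
      ≤ (C * (|ξ| ^ M * (1 + |ξ|) ^ (-(α + M)))) ^ 2 * |ξ| ^ (-2 * d) := by
        gcongr
        exact h1 ξ
    _ = C ^ 2 * ((|ξ| ^ M * (1 + |ξ|) ^ (-(α + M))) ^ 2 * |ξ| ^ (-2 * d)) := by ring
    _ ≤ C ^ 2 * (1 + |ξ|) ^ (-(2 * α + 2 * d)) := by gcongr
    _ ≤ C ^ 2 * (1 + |ξ|) ^ (-(2 * α + 2 * dmin)) := by
        gcongr
        · linarith [abs_nonneg ξ]
        · exact hd.1

lemma ae_ne_zero : ∀ᵐ ξ : ℝ, ξ ≠ 0 := by simp [ae_iff]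

lemma WaveletAssumptions.integrable_energy (h : WaveletAssumptions φ ψ M α)
    (hψ : Function.support ψ ⊆ Set.Ioo 0 (T : ℝ)) (hdM : ∀ d ∈ Set.Icc dmin dmax, d ≤ M)
    (hs : 1 < 2 * α + 2 * dmin) {d : ℝ} (hd : d ∈ Set.Icc dmin dmax) :
    Integrable fun ξ : ℝ => ‖fourier ψ ξ‖ ^ 2 * |ξ| ^ (-2 * d) := by
  obtain ⟨C, hC, h1⟩ := h.exists_energy_envelope hψ hdM
  refine ((integrable_weight hs).const_mul C).mono' ?_ ?_
  · have h2 : Measurable (fourier ψ) := (continuous_fourier h.integrable_wavelet).measurable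
    exact Measurable.aestronglyMeasurable (by fun_prop)
  · filter_upwards [ae_ne_zero] with ξ hξ
    rw [Real.norm_of_nonneg (by positivity)]
    exact h1 d hd ξ hξ

/-- The integral of the minorant from `ratio_rpow_le_rpow` bounds all the energies at once, so no
continuity in `d` is needed. It is positive because `ψ̂` is continuous and nonzero at some `ξ ≠ 0`.
-/
lemma WaveletAssumptions.exists_le_waveletEnergy (h : WaveletAssumptions φ ψ M α)
    (hφ : Function.support φ ⊆ Set.Ioo (-(T : ℝ)) 0) (hψ : Function.support ψ ⊆ Set.Ioo 0 (T : ℝ))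
    (hH : ∃ x : ℝ, transferFunction φ ψ 0 x ≠ 0)
    (hdM : ∀ d ∈ Set.Icc dmin dmax, d ≤ M) (hs : 1 < 2 * α + 2 * dmin) :
    ∃ κ : ℝ, 0 < κ ∧ ∀ d ∈ Set.Icc dmin dmax, κ ≤ waveletEnergy ψ d := by
  rcases Set.eq_empty_or_nonempty (Set.Icc dmin dmax) with he | ⟨d₀, hd₀⟩
  · exact ⟨1, one_pos, fun d hd => by simp [he] at hd⟩
  set D := 2 * (|dmin| + |dmax|)
  have hD : 0 ≤ D := by positivity
  have hle : ∀ d ∈ Set.Icc dmin dmax, ∀ ξ : ℝ, ξ ≠ 0 →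
      ‖fourier ψ ξ‖ ^ 2 * (|ξ| / (1 + |ξ| ^ 2)) ^ D ≤ ‖fourier ψ ξ‖ ^ 2 * |ξ| ^ (-2 * d) := by
    intro d hd ξ hξ
    gcongr
    exact ratio_rpow_le_rpow (abs_pos.mpr hξ) (abs_neg_two_mul_le hd)
  have hcf := continuous_fourier h.integrable_wavelet
  have hcont : Continuous fun ξ : ℝ => ‖fourier ψ ξ‖ ^ 2 * (|ξ| / (1 + |ξ| ^ 2)) ^ D := by
    refine (by fun_prop : Continuous fun ξ => ‖fourier ψ ξ‖ ^ 2).mul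
      (Continuous.rpow_const ?_ fun _ => Or.inr hD)
    exact continuous_abs.div (by fun_prop) fun ξ => by positivity
  have hint : Integrable fun ξ : ℝ => ‖fourier ψ ξ‖ ^ 2 * (|ξ| / (1 + |ξ| ^ 2)) ^ D := by
    refine (h.integrable_energy hψ hdM hs hd₀).mono' hcont.aestronglyMeasurable ?_
    filter_upwards [ae_ne_zero] with ξ hξ
    rw [Real.norm_of_nonneg (by positivity)]
    exact hle d₀ hd₀ ξ hξ
  refine ⟨∫ ξ : ℝ, ‖fourier ψ ξ‖ ^ 2 * (|ξ| / (1 + |ξ| ^ 2)) ^ D, ?_, fun d hd => ?_⟩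
  · rw [integral_pos_iff_support_of_nonneg (fun ξ => by positivity) hint]
    refine hcont.isOpen_support.measure_pos _ ?_
    obtain ⟨ξ, hξ, hξ'⟩ := h.exists_fourier_ne_zero hφ hψ hH
    refine ⟨ξ, ?_⟩
    have h1 := abs_pos.mpr hξ
    have h2 := norm_pos_iff.mpr hξ'
    exact ne_of_gt (by positivity)
  · refine integral_mono_ae hint (h.integrable_energy hψ hdM hs hd) ?_
    filter_upwards [ae_ne_zero] with ξ hξ using hle d hd ξ hξ

end WaveletEnergy

/-! ### Uniform bounds for the spectral integrals -/

section SpectralIntegrals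

variable {φ ψ : ℝ → ℝ} {T M : ℕ} {α β L dmin dmax : ℝ}

/-- The spectral density, up to periodization, of the wavelet coefficients at scale `j`. -/
noncomputable def waveletDensity (φ ψ : ℝ → ℝ) (j : ℕ) (d : ℝ) (F : ℝ → ℝ) (y : ℝ) : ℝ :=
  ‖transferFunction φ ψ j y‖ ^ 2 * ‖1 - Complex.exp (-(Complex.I * (y : ℂ)))‖ ^ (-2 * d) * F y

/-- The class of short-memory parts, with the measurability needed for integration. -/
structure IsRegularPart (β L : ℝ) (F : ℝ → ℝ) : Prop where
  aestronglyMeasurable :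
    AEStronglyMeasurable F (volume.restrict (Set.Ioo (-Real.pi) Real.pi))
  pos : 0 < F 0
  nonneg : ∀ y : ℝ, |y| ≤ Real.pi → 0 ≤ F y
  holder : ∀ y : ℝ, |y| ≤ Real.pi → |F y - F 0| ≤ L * F 0 * |y| ^ β

lemma continuous_transferFunction
    (hφ : Function.support φ ⊆ Set.Ioo (-(T : ℝ)) 0) (hψ : Function.support ψ ⊆ Set.Ioo 0 (T : ℝ))
    (j : ℕ) : Continuous (transferFunction φ ψ j) := by
  have : transferFunction φ ψ j = fun x : ℝ =>
      Polynomial.aeval (Complex.exp (Complex.I * (x : ℂ))) (filterPoly φ ψ T j) :=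
    funext fun x => transferFunction_eq_aeval hφ hψ j x
  rw [this]
  have := Polynomial.continuous_aeval (A := ℂ) (filterPoly φ ψ T j)
  fun_prop

lemma waveletDensity_nonneg {F : ℝ → ℝ} (hF : IsRegularPart β L F) (j : ℕ) (d : ℝ) {y : ℝ}
    (hy : |y| ≤ Real.pi) : 0 ≤ waveletDensity φ ψ j d F y :=
  mul_nonneg (by positivity) (hF.nonneg y hy)

lemma aestronglyMeasurable_waveletDensity
    (hφ : Function.support φ ⊆ Set.Ioo (-(T : ℝ)) 0) (hψ : Function.support ψ ⊆ Set.Ioo 0 (T : ℝ))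
    {F : ℝ → ℝ} (hF : IsRegularPart β L F) (j : ℕ) (d : ℝ) :
    AEStronglyMeasurable (waveletDensity φ ψ j d F)
      (volume.restrict (Set.Ioo (-Real.pi) Real.pi)) := by
  have h1 : Measurable (transferFunction φ ψ j) := (continuous_transferFunction hφ hψ j).measurable
  have h2 : Measurable fun y : ℝ => ‖transferFunction φ ψ j y‖ ^ 2 *
      ‖1 - Complex.exp (-(Complex.I * (y : ℂ)))‖ ^ (-2 * d) := by fun_prop
  exact h2.aestronglyMeasurable.mul hF.aestronglyMeasurable

/-- Uniform bounds for the spectral integrals of the wavelet coefficients. -/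
lemma WaveletAssumptions.exists_spectral_integral_bounds (h : WaveletAssumptions φ ψ M α)
    (hM : 1 ≤ M)
    (hφ : Function.support φ ⊆ Set.Ioo (-(T : ℝ)) 0) (hψ : Function.support ψ ⊆ Set.Ioo 0 (T : ℝ))
    (hβ₀ : 0 < β) (hβ₂ : β ≤ 2) (hL : 0 < L) (hdM : ∀ d ∈ Set.Icc dmin dmax, d ≤ M)
    (hs : 1 < 2 * α + 2 * dmin - β) :
    ∃ C : ℝ, 0 < C ∧ ∀ (j : ℕ) (d : ℝ) (F : ℝ → ℝ), d ∈ Set.Icc dmin dmax → IsRegularPart β L F →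
      IntegrableOn (waveletDensity φ ψ j d F) (Set.Ioo (-Real.pi) Real.pi) ∧
      (∀ (n : ℕ) (x : Fin n → ℝ), ∫ y in Set.Ioo (-Real.pi) Real.pi,
        ‖trigPoly x (2 ^ j * y)‖ ^ 2 * waveletDensity φ ψ j d F y
          ≤ C * F 0 * ((2 : ℝ) ^ j) ^ (2 * d) * ∑ k, x k ^ 2) ∧
      |(∫ y in Set.Ioo (-Real.pi) Real.pi, waveletDensity φ ψ j d F y)
        - F 0 * ((2 : ℝ) ^ j) ^ (2 * d) * waveletEnergy ψ d|
          ≤ C * F 0 * ((2 : ℝ) ^ j) ^ (2 * d) * ((2 : ℝ) ^ j) ^ (-β) := by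
  obtain ⟨C₁, hC₁, h1⟩ := h.exists_spectral_comparison hM hφ hψ hβ₀ hβ₂ hL hdM
  obtain ⟨C₂, hC₂, h2⟩ := h.exists_energy_envelope hψ hdM
  have hpi := Real.pi_pos
  set s := 2 * α + 2 * dmin - β with hs_def
  set W := ∫ ξ : ℝ, (1 + |ξ|) ^ (-s) with hW
  have hW0 : 0 ≤ W := integral_nonneg fun ξ => by positivity
  refine ⟨C₁ * ((1 + 2 * Real.pi) ^ s * W) + (C₁ + C₂) * W + 1, by positivity,
    fun j d F hd hF => ?_⟩
  have h2j : (0 : ℝ) < 2 ^ j := by positivity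
  have hF0 := hF.pos
  set q : ℝ := ((2 : ℝ) ^ j) ^ (2 * d) with hq
  have hq0 : 0 < q := by positivity
  set r : ℝ := ((2 : ℝ) ^ j) ^ (-β) with hr
  have hr0 : 0 < r := by positivity
  have hmeas := aestronglyMeasurable_waveletDensity hφ hψ hF j d
  have hne : ∀ᵐ y : ℝ ∂(volume.restrict (Set.Ioo (-Real.pi) Real.pi)), y ≠ 0 ∧ |y| ≤ Real.pi := by
    filter_upwards [ae_restrict_of_ae ae_ne_zero, ae_restrict_mem measurableSet_Ioo] with y hy hy'
    exact ⟨hy, (abs_lt.mpr hy').le⟩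
  have hupper : ∀ y : ℝ, y ≠ 0 → |y| ≤ Real.pi → waveletDensity φ ψ j d F y
      ≤ C₁ * F 0 * q * (2 ^ j * (1 + |2 ^ j * y|) ^ (-s)) := fun y hy hyπ => by
    refine ((h1 j d (F y) (F 0) y hd hF0.le hy hyπ (hF.holder y hyπ)).1).trans (le_of_eq ?_)
    ring
  obtain ⟨hw1, hw2⟩ := integral_dilated_weight hs j
  have hint : IntegrableOn (waveletDensity φ ψ j d F) (Set.Ioo (-Real.pi) Real.pi) := by
    refine ((hw1.const_mul (C₁ * F 0 * q)).integrableOn (s := Set.Ioo (-Real.pi) Real.pi)).mono'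
      hmeas ?_
    filter_upwards [hne] with y hy
    rw [Real.norm_of_nonneg (waveletDensity_nonneg hF j d hy.2)]
    exact hupper y hy.1 hy.2
  refine ⟨hint, fun n x => ?_, ?_⟩
  · obtain ⟨ht1, ht2⟩ := integral_dilated_weight_mul_norm_trigPoly_le hs x j
    have hx2 : 0 ≤ ∑ k, x k ^ 2 := Finset.sum_nonneg fun k _ => sq_nonneg _
    calc ∫ y in Set.Ioo (-Real.pi) Real.pi,
          ‖trigPoly x (2 ^ j * y)‖ ^ 2 * waveletDensity φ ψ j d F y
        ≤ ∫ y in Set.Ioo (-Real.pi) Real.pi, C₁ * F 0 * q *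
          (‖trigPoly x (2 ^ j * y)‖ ^ 2 * (2 ^ j * (1 + |2 ^ j * y|) ^ (-s))) := by
          refine integral_mono_of_nonneg ?_ (ht1.const_mul _).integrableOn ?_
          · filter_upwards [hne] with y hy
            exact mul_nonneg (by positivity) (waveletDensity_nonneg hF j d hy.2)
          · filter_upwards [hne] with y hy
            refine (mul_le_mul_of_nonneg_left (hupper y hy.1 hy.2) (by positivity)).trans
              (le_of_eq ?_)
            ring
      _ ≤ ∫ y : ℝ, C₁ * F 0 * q *
          (‖trigPoly x (2 ^ j * y)‖ ^ 2 * (2 ^ j * (1 + |2 ^ j * y|) ^ (-s))) :=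
          setIntegral_le_integral (ht1.const_mul _) (.of_forall fun y => by positivity)
      _ ≤ C₁ * F 0 * q * (((1 + 2 * Real.pi) ^ s * W) * ∑ k, x k ^ 2) := by
          rw [integral_const_mul]
          exact mul_le_mul_of_nonneg_left ht2 (by positivity)
      _ = (C₁ * ((1 + 2 * Real.pi) ^ s * W)) * (F 0 * q * ∑ k, x k ^ 2) := by ring
      _ ≤ (C₁ * ((1 + 2 * Real.pi) ^ s * W) + (C₁ + C₂) * W + 1) * (F 0 * q * ∑ k, x k ^ 2) := by
          refine mul_le_mul_of_nonneg_right ?_ (by positivity)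
          have : 0 ≤ (C₁ + C₂) * W := by positivity
          linarith
      _ = _ := by ring
  · set A : ℝ → ℝ := fun y => F 0 * (2 ^ j * (‖fourier ψ (2 ^ j * y)‖ ^ 2 * |y| ^ (-2 * d))) with hA
    have hAeq : ∀ y, A y = F 0 * q * (2 ^ j *
        (fun ξ : ℝ => ‖fourier ψ ξ‖ ^ 2 * |ξ| ^ (-2 * d)) (2 ^ j * y)) := fun y => by
      simp only [hA]
      rw [abs_mul, abs_of_pos h2j, Real.mul_rpow h2j.le (abs_nonneg y), hq,
        show -2 * d = -(2 * d) by ring, Real.rpow_neg h2j.le]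
      field_simp
    have hs' : 1 < 2 * α + 2 * dmin := by linarith
    have hE := h.integrable_energy hψ hdM hs' hd
    have hAint : Integrable A := by
      have : A = fun y => F 0 * q * (2 ^ j *
        (fun ξ : ℝ => ‖fourier ψ ξ‖ ^ 2 * |ξ| ^ (-2 * d)) (2 ^ j * y)) := funext hAeq
      rw [this]
      exact ((hE.comp_mul_left' h2j.ne').const_mul _).const_mul _
    have hAI : ∫ y, A y = F 0 * q * waveletEnergy ψ d := by
      simp_rw [hAeq]
      rw [integral_const_mul, integral_const_mul, Measure.integral_comp_mul_left (fun ξ : ℝ =>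
        ‖fourier ψ ξ‖ ^ 2 * |ξ| ^ (-2 * d)), abs_of_pos (inv_pos.mpr h2j), smul_eq_mul,
        ← mul_assoc (2 ^ j : ℝ), mul_inv_cancel₀ h2j.ne', one_mul, waveletEnergy]
    rw [← hAI, ← integral_indicator measurableSet_Ioo, ← integral_sub
      (hint.integrable_indicator measurableSet_Ioo) hAint, ← Real.norm_eq_abs]
    have hbound : ∀ᵐ y : ℝ, ‖(Set.Ioo (-Real.pi) Real.pi).indicator (waveletDensity φ ψ j d F) y
        - A y‖ ≤ (C₁ + C₂) * F 0 * q * r * (2 ^ j * (1 + |2 ^ j * y|) ^ (-s)) := by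
      filter_upwards [ae_ne_zero] with y hy
      set g : ℝ := 2 ^ j * (1 + |2 ^ j * y|) ^ (-s) with hg
      have hg0 : 0 ≤ g := by positivity
      by_cases hyI : y ∈ Set.Ioo (-Real.pi) Real.pi
      · rw [Set.indicator_of_mem hyI, Real.norm_eq_abs]
        have hyπ : |y| ≤ Real.pi := (abs_lt.mpr hyI).le
        refine ((h1 j d (F y) (F 0) y hd hF0.le hy hyπ (hF.holder y hyπ)).2).trans ?_
        calc C₁ * F 0 * r * (2 ^ j * (q * (1 + |2 ^ j * y|) ^ (-s)))
            = C₁ * (F 0 * q * r * g) := by rw [hg]; ring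
          _ ≤ (C₁ + C₂) * (F 0 * q * r * g) := by
            refine mul_le_mul_of_nonneg_right ?_ (by positivity)
            linarith
          _ = _ := by ring
      · rw [Set.indicator_of_notMem hyI, zero_sub, norm_neg, Real.norm_of_nonneg (by
          simp only [hA]; positivity), hAeq]
        have hyπ : Real.pi ≤ |y| := by
          by_contra hc
          exact hyI (abs_lt.mp (not_le.mp hc))
        have h3 := h2 d hd (2 ^ j * y) (mul_ne_zero h2j.ne' hy)
        -- Outside the period `|2^j y| ≥ 2^j`, so `β` powers of the decay are worth `2^{-βj}`: the
        -- tail is of the same order as the approximation error.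
        have h4 : (1 + |2 ^ j * y|) ^ (-(2 * α + 2 * dmin)) ≤ r * (1 + |2 ^ j * y|) ^ (-s) := by
          rw [show -(2 * α + 2 * dmin) = -β + -s by rw [hs_def]; ring,
            Real.rpow_add (by positivity)]
          refine mul_le_mul_of_nonneg_right ?_ (by positivity)
          refine Real.rpow_le_rpow_of_nonpos h2j ?_ (by linarith)
          rw [abs_mul, abs_of_pos h2j]
          nlinarith [Real.pi_gt_three]
        calc F 0 * q * (2 ^ j * (‖fourier ψ (2 ^ j * y)‖ ^ 2 * |2 ^ j * y| ^ (-2 * d)))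
            ≤ F 0 * q * (2 ^ j * (C₂ * (r * (1 + |2 ^ j * y|) ^ (-s)))) := by
              refine mul_le_mul_of_nonneg_left (mul_le_mul_of_nonneg_left ?_ h2j.le) (by positivity)
              exact h3.trans (mul_le_mul_of_nonneg_left h4 hC₂.le)
          _ = C₂ * (F 0 * q * r * g) := by rw [hg]; ring
          _ ≤ (C₁ + C₂) * (F 0 * q * r * g) := by
            refine mul_le_mul_of_nonneg_right ?_ (by positivity)
            linarith
          _ = _ := by ring
    refine (norm_integral_le_of_norm_le (hw1.const_mul _) hbound).trans ?_
    rw [integral_const_mul, hw2]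
    calc (C₁ + C₂) * F 0 * q * r * W = ((C₁ + C₂) * W) * (F 0 * q * r) := by ring
      _ ≤ (C₁ * ((1 + 2 * Real.pi) ^ s * W) + (C₁ + C₂) * W + 1) * (F 0 * q * r) := by
        refine mul_le_mul_of_nonneg_right ?_ (by positivity)
        have : 0 ≤ C₁ * ((1 + 2 * Real.pi) ^ s * W) := by positivity
        linarith
      _ = _ := by ring

end SpectralIntegrals

/-! ### Lower bounds and logarithms of the variances -/

section LowerBound

variable {φ ψ : ℝ → ℝ} {T M : ℕ} {α β L dmin dmax : ℝ}

/-- The transfer function is a polynomial in `e^{iy}`, and a nonzero polynomial cannot vanish at the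
infinitely many points of an arc. -/
lemma exists_transferFunction_ne_zero
    (hφ : Function.support φ ⊆ Set.Ioo (-(T : ℝ)) 0) (hψ : Function.support ψ ⊆ Set.Ioo 0 (T : ℝ))
    {j : ℕ} (hH : ∃ x : ℝ, transferFunction φ ψ j x ≠ 0) {δ : ℝ} (hδ : 0 < δ) (hδπ : δ ≤ Real.pi) :
    ∃ y ∈ Set.Ioo 0 δ, transferFunction φ ψ j y ≠ 0 := by
  by_contra! hc
  obtain ⟨x, hx⟩ := hH
  set p := (filterPoly φ ψ T j).map (algebraMap ℝ ℂ) with hp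
  have hev : ∀ y : ℝ, transferFunction φ ψ j y = p.eval (Complex.exp (Complex.I * (y : ℂ))) :=
    fun y => by rw [transferFunction_eq_aeval hφ hψ, hp, Polynomial.eval_map_algebraMap]
  have hinj : Set.InjOn (fun y : ℝ => Complex.exp (Complex.I * (y : ℂ))) (Set.Ioo 0 δ) := by
    intro a ha b hb hab
    have h1 := congrArg Complex.re hab
    simp only [mul_comm Complex.I, Complex.exp_ofReal_mul_I_re] at h1
    exact Real.injOn_cos ⟨ha.1.le, ha.2.le.trans hδπ⟩ ⟨hb.1.le, hb.2.le.trans hδπ⟩ h1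
  have hinf : ((fun y : ℝ => Complex.exp (Complex.I * (y : ℂ))) '' Set.Ioo 0 δ).Infinite :=
    (Set.Ioo_infinite hδ).image hinj
  have hp0 : p = 0 := by
    refine Polynomial.eq_zero_of_infinite_isRoot p (hinf.mono ?_)
    rintro _ ⟨y, hy, rfl⟩
    change p.eval _ = 0
    rw [← hev, hc y hy]
  exact hx (by rw [hev, hp0, Polynomial.eval_zero])

/-- On `|y| ≤ δ` the Hölder condition then gives `F(y) ≥ F(0)/2`; beyond this neighbourhood `F` may
vanish. -/
lemma exists_radius (hβ₀ : 0 < β) (L : ℝ) :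
    ∃ δ : ℝ, 0 < δ ∧ δ < Real.pi ∧ L * δ ^ β ≤ 1 / 2 := by
  have h1 : Filter.Tendsto (fun y : ℝ => L * y ^ β) (nhdsWithin 0 (Set.Ioi 0)) (nhds (L * 0 ^ β)) :=
    ((Real.continuous_rpow_const hβ₀.le).const_mul L).continuousWithinAt
  rw [Real.zero_rpow hβ₀.ne', mul_zero] at h1
  have h2 := (h1.eventually (Iic_mem_nhds (by norm_num : (0 : ℝ) < 1 / 2))).and
    ((Ioo_mem_nhdsGT Real.pi_pos : Set.Ioo 0 Real.pi ∈ nhdsWithin (0 : ℝ) (Set.Ioi 0)))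
  obtain ⟨δ, h3, h4⟩ := h2.exists
  exact ⟨δ, h4.1, h4.2, h3⟩

/-- At a fixed scale the variance of the wavelet coefficients is bounded away from zero. -/
lemma exists_le_integral_waveletDensity
    (hφ : Function.support φ ⊆ Set.Ioo (-(T : ℝ)) 0) (hψ : Function.support ψ ⊆ Set.Ioo 0 (T : ℝ))
    (hβ₀ : 0 < β) (hL : 0 < L) {j : ℕ} (hH : ∃ x : ℝ, transferFunction φ ψ j x ≠ 0) :
    ∃ c : ℝ, 0 < c ∧ ∀ (d : ℝ) (F : ℝ → ℝ), d ∈ Set.Icc dmin dmax → IsRegularPart β L F →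
      IntegrableOn (waveletDensity φ ψ j d F) (Set.Ioo (-Real.pi) Real.pi) →
      c * F 0 ≤ ∫ y in Set.Ioo (-Real.pi) Real.pi, waveletDensity φ ψ j d F y := by
  have hpi := Real.pi_pos
  obtain ⟨δ, hδ, hδπ, hδL⟩ := exists_radius hβ₀ L
  set D := 2 * (|dmin| + |dmax|)
  have hD : 0 ≤ D := by positivity
  set ε : ℝ → ℝ := fun y => ‖1 - Complex.exp (-(Complex.I * (y : ℂ)))‖ with hε
  set G : ℝ → ℝ := fun y => ‖transferFunction φ ψ j y‖ ^ 2 * (ε y / (1 + ε y ^ 2)) ^ D with hG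
  have hεpos : ∀ y : ℝ, y ≠ 0 → |y| ≤ Real.pi → 0 < ε y := fun y hy hyπ => by
    have h1 := (norm_one_sub_exp_bounds hyπ).1
    have h2 : 0 < 2 / Real.pi * |y| := by positivity
    exact h2.trans_le h1
  have hGc : Continuous G := by
    have h1 := continuous_transferFunction hφ hψ j
    have h2 : Continuous ε := by fun_prop
    refine (by fun_prop : Continuous fun y => ‖transferFunction φ ψ j y‖ ^ 2).mul
      (Continuous.rpow_const ?_ fun _ => Or.inr hD)
    exact h2.div (by fun_prop) fun ξ => by positivity
  have hG0 : ∀ y, 0 ≤ G y := fun y => by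
    have : 0 ≤ ε y := norm_nonneg _
    positivity
  obtain ⟨y₀, hy₀, hHy₀⟩ := exists_transferFunction_ne_zero hφ hψ hH hδ hδπ.le
  have hpos : 0 < ∫ y in (0 : ℝ)..δ, G y := by
    refine intervalIntegral.integral_pos hδ hGc.continuousOn (fun y _ => hG0 y)
      ⟨y₀, ⟨hy₀.1.le, hy₀.2.le⟩, ?_⟩
    have h1 := hεpos y₀ hy₀.1.ne' (by rw [abs_of_pos hy₀.1]; exact (hy₀.2.trans hδπ).le)
    have h2 := norm_pos_iff.mpr hHy₀
    positivity
  rw [intervalIntegral.integral_of_le hδ.le] at hpos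
  refine ⟨(∫ y in Set.Ioc 0 δ, G y) / 2, half_pos hpos, fun d F hd hF hint => ?_⟩
  have hsub : Set.Ioc 0 δ ⊆ Set.Ioo (-Real.pi) Real.pi := fun y hy =>
    ⟨by linarith [hy.1], by linarith [hy.2]⟩
  calc (∫ y in Set.Ioc 0 δ, G y) / 2 * F 0 = ∫ y in Set.Ioc 0 δ, (F 0 / 2) * G y := by
        rw [integral_const_mul]; ring
    _ ≤ ∫ y in Set.Ioc 0 δ, waveletDensity φ ψ j d F y := by
        refine setIntegral_mono_on ((hGc.integrableOn_Ioc).const_mul _) (hint.mono_set hsub)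
          measurableSet_Ioc fun y hy => ?_
        have hy0 : 0 < y := hy.1
        have hyπ : |y| ≤ Real.pi := by rw [abs_of_pos hy0]; linarith [hy.2]
        have h1 := hF.holder y hyπ
        have h2 : L * |y| ^ β ≤ 1 / 2 := by
          refine le_trans ?_ hδL
          rw [abs_of_pos hy0]
          gcongr
          exact hy.2
        have h3 : F 0 / 2 ≤ F y := by
          have h4 : L * F 0 * |y| ^ β ≤ F 0 / 2 := by nlinarith [hF.pos]
          linarith [(abs_le.mp h1).1]
        have h5 := ratio_rpow_le_rpow (hεpos y hy0.ne' hyπ) (abs_neg_two_mul_le hd)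
        have h6 : G y ≤ ‖transferFunction φ ψ j y‖ ^ 2 *
            ‖1 - Complex.exp (-(Complex.I * (y : ℂ)))‖ ^ (-2 * d) :=
          mul_le_mul_of_nonneg_left h5 (by positivity)
        rw [waveletDensity, mul_comm]
        exact mul_le_mul h6 h3 (by linarith [hF.pos]) ((hG0 y).trans h6)
    _ ≤ _ := setIntegral_mono_set hint (by
        filter_upwards [ae_restrict_mem measurableSet_Ioo] with y hy
        exact waveletDensity_nonneg hF j d (abs_lt.mpr hy).le) hsub.eventuallyLE

lemma exists_pos_le_of_lt (f : ℕ → ℝ) (hf : ∀ j, 0 < f j) (N : ℕ) :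
    ∃ c : ℝ, 0 < c ∧ ∀ j < N, c ≤ f j := by
  induction N with
  | zero => exact ⟨1, one_pos, by simp⟩
  | succ N ih =>
    obtain ⟨c, hc, h⟩ := ih
    refine ⟨min c (f N), lt_min hc (hf N), fun j hj => ?_⟩
    rcases Nat.lt_succ_iff_lt_or_eq.mp hj with h1 | rfl
    · exact (min_le_left _ _).trans (h j h1)
    · exact min_le_right _ _

lemma abs_log_sub_log_le {a b m : ℝ} (hm : 0 < m) (ha : m ≤ a) (hb : m ≤ b) :
    |Real.log a - Real.log b| ≤ |a - b| / m := by
  have key : ∀ u v : ℝ, m ≤ u → m ≤ v → Real.log u - Real.log v ≤ |u - v| / m := by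
    intro u v hu hv
    have hu0 := hm.trans_le hu
    have hv0 := hm.trans_le hv
    rw [← Real.log_div hu0.ne' hv0.ne']
    refine (Real.log_le_sub_one_of_pos (by positivity)).trans ?_
    rw [show u / v - 1 = (u - v) / v by field_simp]
    calc (u - v) / v ≤ |u - v| / v := by gcongr; exact le_abs_self _
      _ ≤ |u - v| / m := by gcongr
  rw [abs_le]
  constructor
  · have := key b a hb ha
    rw [abs_sub_comm] at this
    linarith
  · exact key a b ha hb

/-- The log-variances of the wavelet coefficients are affine in the scale up to an exponentially
small error. -/
lemma WaveletAssumptions.exists_log_variance_bounds (h : WaveletAssumptions φ ψ M α)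
    (hM : 1 ≤ M)
    (hφ : Function.support φ ⊆ Set.Ioo (-(T : ℝ)) 0) (hψ : Function.support ψ ⊆ Set.Ioo 0 (T : ℝ))
    (hH : ∀ j, ∃ x : ℝ, transferFunction φ ψ j x ≠ 0)
    (hβ₀ : 0 < β) (hβ₂ : β ≤ 2) (hL : 0 < L) (hdM : ∀ d ∈ Set.Icc dmin dmax, d ≤ M)
    (hs : 1 < 2 * α + 2 * dmin - β) :
    ∃ C : ℝ, 0 < C ∧ ∀ (d : ℝ) (F : ℝ → ℝ), d ∈ Set.Icc dmin dmax → IsRegularPart β L F →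
      ∃ a : ℝ, ∀ j : ℕ,
        0 < ∫ y in Set.Ioo (-Real.pi) Real.pi, waveletDensity φ ψ j d F y ∧
        (∀ (n : ℕ) (x : Fin n → ℝ), ∫ y in Set.Ioo (-Real.pi) Real.pi,
          ‖trigPoly x (2 ^ j * y)‖ ^ 2 * waveletDensity φ ψ j d F y
            ≤ C * (∫ y in Set.Ioo (-Real.pi) Real.pi, waveletDensity φ ψ j d F y) *
              ∑ k, x k ^ 2) ∧
        |Real.log (∫ y in Set.Ioo (-Real.pi) Real.pi, waveletDensity φ ψ j d F y)
          - (a + 2 * Real.log 2 * d * j)| ≤ C * ((2 : ℝ) ^ j) ^ (-β) := by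
  obtain ⟨C, hC, h1⟩ := h.exists_spectral_integral_bounds hM hφ hψ hβ₀ hβ₂ hL hdM hs
  obtain ⟨κ, hκ, h2⟩ := h.exists_le_waveletEnergy hφ hψ (hH 0) hdM (by linarith)
  choose c hc h3 using fun j => exists_le_integral_waveletDensity (dmin := dmin) (dmax := dmax)
    hφ hψ hβ₀ hL (hH j)
  -- From scale `N` on, the approximation error takes away at most half of the energy. The finitely
  -- many smaller scales are treated one by one, using that each `H_j` is not identically zero.
  obtain ⟨N, hN⟩ : ∃ N : ℕ, ∀ j ≥ N, C * ((2 : ℝ) ^ j) ^ (-β) ≤ κ / 2 := by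
    have h4 : Filter.Tendsto (fun j : ℕ => C * ((2 : ℝ) ^ j) ^ (-β)) Filter.atTop (nhds (C * 0)) :=
      ((tendsto_rpow_neg_atTop hβ₀).comp
        (tendsto_pow_atTop_atTop_of_one_lt (one_lt_two : (1 : ℝ) < 2))).const_mul C
    rw [mul_zero] at h4
    exact Filter.eventually_atTop.mp (h4.eventually (Iic_mem_nhds (by positivity)))
  set D := 2 * (|dmin| + |dmax|)
  have hD : 0 ≤ D := by positivity
  obtain ⟨c₀, hc₀, h5⟩ := exists_pos_le_of_lt (fun j => c j / ((2 : ℝ) ^ j) ^ D)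
    (fun j => by have := hc j; positivity) N
  set m := min c₀ (κ / 2) with hm_def
  have hm : 0 < m := lt_min hc₀ (by positivity)
  -- Both the variance and its limit are at least `m F(0) 2^{2dj}`, so passing to relative errors,
  -- hence to logarithms, costs the factor `1/m`. The intercept depends on `d` and `F` but not on
  -- `j`.
  refine ⟨C / m, by positivity, fun d F hd hF => ⟨Real.log (F 0 * waveletEnergy ψ d), fun j => ?_⟩⟩
  obtain ⟨h6, h7, h8⟩ := h1 j d F hd hF
  have hF0 := hF.pos
  set v := ∫ y in Set.Ioo (-Real.pi) Real.pi, waveletDensity φ ψ j d F y with hv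
  have h2j : (0 : ℝ) < 2 ^ j := by positivity
  set q : ℝ := ((2 : ℝ) ^ j) ^ (2 * d) with hq
  have hq0 : 0 < q := by positivity
  have hE := h2 d hd
  have hE0 := hκ.trans_le hE
  have hb : m * (F 0 * q) ≤ F 0 * q * waveletEnergy ψ d := by
    rw [mul_comm m]
    gcongr
    exact (min_le_right _ _).trans (by linarith)
  have ha : m * (F 0 * q) ≤ v := by
    by_cases hj : j < N
    · have h9 := h3 j d F hd hF h6
      have h10 := h5 j hj
      rw [le_div_iff₀ (by positivity)] at h10
      have h11 : q ≤ ((2 : ℝ) ^ j) ^ D := by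
        refine Real.rpow_le_rpow_of_exponent_le (one_le_pow₀ one_le_two) ?_
        have := (abs_le.mp (abs_neg_two_mul_le hd)).1
        linarith
      calc m * (F 0 * q) ≤ c₀ * (F 0 * ((2 : ℝ) ^ j) ^ D) := by
            gcongr
            exact min_le_left _ _
        _ = c₀ * ((2 : ℝ) ^ j) ^ D * F 0 := by ring
        _ ≤ c j * F 0 := by gcongr
        _ ≤ v := h9
    · have h9 := hN j (not_lt.mp hj)
      have h10 := (abs_le.mp h8).1
      have h11 : C * F 0 * q * ((2 : ℝ) ^ j) ^ (-β) ≤ F 0 * q * (κ / 2) := by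
        calc C * F 0 * q * ((2 : ℝ) ^ j) ^ (-β) = F 0 * q * (C * ((2 : ℝ) ^ j) ^ (-β)) := by ring
          _ ≤ _ := by gcongr
      have h12 : F 0 * q * κ ≤ F 0 * q * waveletEnergy ψ d := by gcongr
      have h13 : m * (F 0 * q) ≤ F 0 * q * (κ / 2) := by
        rw [mul_comm m]
        gcongr
        exact min_le_right _ _
      linarith
  have hv0 : 0 < v := lt_of_lt_of_le (by positivity) ha
  refine ⟨hv0, fun n x => (h7 n x).trans ?_, ?_⟩
  · have hx2 : 0 ≤ ∑ k, x k ^ 2 := Finset.sum_nonneg fun k _ => sq_nonneg _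
    refine mul_le_mul_of_nonneg_right ?_ hx2
    rw [div_mul_eq_mul_div, le_div_iff₀ hm]
    calc C * F 0 * q * m = C * (m * (F 0 * q)) := by ring
      _ ≤ C * v := by gcongr
  · have e : Real.log (F 0 * waveletEnergy ψ d) + 2 * Real.log 2 * d * j
        = Real.log (F 0 * q * waveletEnergy ψ d) := by
      rw [Real.log_mul hF0.ne' hE0.ne', Real.log_mul (by positivity) hE0.ne',
        Real.log_mul hF0.ne' hq0.ne', hq, Real.log_rpow h2j, Real.log_pow]
      ring
    rw [e]
    refine (abs_log_sub_log_le (by positivity : 0 < m * (F 0 * q)) ha hb).trans ?_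
    rw [div_le_iff₀ (by positivity)]
    refine h8.trans (le_of_eq ?_)
    field_simp

end LowerBound

/-! ### Log empirical variance at one scale -/

section EmpiricalVariance

variable {φ ψ : ℝ → ℝ} {T M : ℕ} {α β L dmin dmax : ℝ}

/-- The definitions do not ask for `fstar` to be measurable. Measurability is recovered by dividing
the integrable spectral density of `Δ^M X` by the gain, which is nonzero off the origin. -/
lemma isRegularPart_of_hasMemoryParameter {Ω : Type*} [MeasurableSpace Ω] {P : Measure Ω}
    {X : ℤ → Ω → ℝ} {d : ℝ} {fstar : ℝ → ℝ} (hX : HasMemoryParameter X P d fstar) (hd : d ≤ M)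
    (hf : fstar ∈ HolderClass β L) (hf0 : 0 < fstar 0) : IsRegularPart β L fstar where
  aestronglyMeasurable := by
    have h1 := (hX.spectral M (by linarith)).integrable.aestronglyMeasurable
    have h2 : Measurable fun y : ℝ =>
        ‖1 - Complex.exp (-(Complex.I * (y : ℂ)))‖ ^ (-(2 * ((M : ℝ) - d))) := by fun_prop
    refine (h2.aestronglyMeasurable.mul h1).congr ?_
    filter_upwards [ae_restrict_of_ae ae_ne_zero, ae_restrict_mem measurableSet_Ioo] with y hy hy'
    have hpos : 0 < ‖1 - Complex.exp (-(Complex.I * (y : ℂ)))‖ := by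
      have h3 := (norm_one_sub_exp_bounds (abs_lt.mpr hy').le).1
      have h4 : 0 < 2 / Real.pi * |y| := by
        have := Real.pi_pos
        have := abs_pos.mpr hy
        positivity
      linarith
    rw [Pi.mul_apply, ← mul_assoc, ← Real.rpow_add hpos, neg_add_cancel, Real.rpow_zero, one_mul]
  pos := hf0
  nonneg y hy := (hf y (abs_le.mp hy)).1
  holder y hy := (hf y (abs_le.mp hy)).2.2

lemma variance_le_integral_sub_sq {Ω : Type*} [MeasurableSpace Ω] {P : Measure Ω}
    [IsProbabilityMeasure P] {Z : Ω → ℝ} (hZ : MemLp Z 2 P) (c : ℝ) :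
    Var[Z; P] ≤ ∫ ω, (Z ω - c) ^ 2 ∂P := by
  rw [← variance_sub_const hZ.aestronglyMeasurable c]
  exact variance_le_expectation_sq (hZ.sub (memLp_const c)).aestronglyMeasurable

/-- Mean and variance of the logarithm of the empirical variance at a given scale. -/
lemma WaveletAssumptions.exists_log_empiricalVariance_bounds (h : WaveletAssumptions φ ψ M α)
    (hM : 1 ≤ M)
    (hφ : Function.support φ ⊆ Set.Ioo (-(T : ℝ)) 0) (hψ : Function.support ψ ⊆ Set.Ioo 0 (T : ℝ))
    (hH : ∀ j, ∃ x : ℝ, transferFunction φ ψ j x ≠ 0)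
    (hβ₀ : 0 < β) (hβ₂ : β ≤ 2) (hL : 0 < L) (hdM : ∀ d ∈ Set.Icc dmin dmax, d ≤ M)
    (hs : 1 < 2 * α + 2 * dmin - β) :
    ∃ C : ℝ, 0 < C ∧ ∀ d ∈ Set.Icc dmin dmax, ∀ fstar ∈ HolderClass β L, 0 < fstar 0 →
      ∀ (Ω : Type*) [MeasurableSpace Ω] (P : Measure Ω) [IsProbabilityMeasure P]
        (X : ℤ → Ω → ℝ), IsGaussianProcess X P → HasMemoryParameter X P d fstar →
        (∀ k, ∫ ω, iterDiff M X k ω ∂P = 0) →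
        ∃ a : ℝ, ∀ n j : ℕ, numCoeff T n j ≠ 0 →
          MemLp (fun ω => Real.log (empiricalVariance φ ψ T n (fun k => X k ω) j)) 2 P ∧
          |(∫ ω, Real.log (empiricalVariance φ ψ T n (fun k => X k ω) j) ∂P)
            - (a + 2 * Real.log 2 * d * j)|
            ≤ C * (((2 : ℝ) ^ j) ^ (-β) + (numCoeff T n j : ℝ)⁻¹) ∧
          Var[fun ω => Real.log (empiricalVariance φ ψ T n (fun k => X k ω) j); P]
            ≤ C * (numCoeff T n j : ℝ)⁻¹ := by
  obtain ⟨C, hC, h1⟩ := h.exists_log_variance_bounds hM hφ hψ hH hβ₀ hβ₂ hL hdM hs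
  obtain ⟨D, hD, h2⟩ := log_mean_square_bounds C
  refine ⟨C + D, by positivity, fun d hd fstar hf hf0 Ω _ P _ X hG hX hmean => ?_⟩
  have hF := isRegularPart_of_hasMemoryParameter hX (hdM d hd) hf hf0
  obtain ⟨a, h3⟩ := h1 d fstar hd hF
  refine ⟨a, fun n j hn => ?_⟩
  obtain ⟨hv, h4, h5⟩ := h3 j
  set v := ∫ y in Set.Ioo (-Real.pi) Real.pi, waveletDensity φ ψ j d fstar y with hv_def
  set N := numCoeff T n j with hN
  set W : Fin N → Ω → ℝ := fun k ω => waveletCoeff φ ψ (fun i => X i ω) j (k : ℕ) with hW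
  have hvar : ∀ x : Fin N → ℝ, Var[fun ω => ∑ i, x i * W i ω; P]
      = ∫ y in Set.Ioo (-Real.pi) Real.pi,
        ‖trigPoly x (2 ^ j * y)‖ ^ 2 * waveletDensity φ ψ j d fstar y :=
    fun x => h.variance_sum_waveletCoeff hφ hψ hX (hdM d hd) j x
  have hvar1 : ∀ i, Var[W i; P] = v := fun i => by
    -- A single exponential has modulus 1, so every coefficient at scale `j` has the variance `v`,
    -- whatever its position.
    have h6 := hvar (Pi.single i 1)
    have h7 : ∀ ξ : ℝ, ‖trigPoly (Pi.single i 1 : Fin N → ℝ) ξ‖ = 1 := fun ξ => by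
      rw [trigPoly, Finset.sum_eq_single i]
      · rw [Pi.single_eq_same, norm_mul, Complex.norm_exp]; simp
      · intro k _ hk
        simp [Pi.single_eq_of_ne hk]
      · simp
    simp only [h7, one_pow, one_mul] at h6
    rw [hv_def, ← h6]
    congr 1
    ext ω
    simp [Pi.single_apply]
  obtain ⟨h6, -, h7, h8⟩ := h2 Ω P N W v hn hv (h.hasGaussianLaw_waveletCoeff hφ hψ hG j N)
    (fun i => h.integral_waveletCoeff hφ hψ hX (hdM d hd) hmean j _) hvar1
    (fun x => by rw [hvar]; exact h4 N x)
  have e : (fun ω => Real.log (empiricalVariance φ ψ T n (fun k => X k ω) j))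
      = fun ω => Real.log ((N : ℝ)⁻¹ * ∑ i, W i ω ^ 2) := by
    ext ω
    rw [empiricalVariance, ← hN, Finset.sum_range]
  have hN0 : (0 : ℝ) ≤ (N : ℝ)⁻¹ := by positivity
  have h2j : (0 : ℝ) ≤ ((2 : ℝ) ^ j) ^ (-β) := by positivity
  refine ⟨e ▸ h6, ?_, ?_⟩
  · rw [e]
    rw [integral_sub (h6.integrable one_le_two) (integrable_const _), integral_const] at h7
    simp only [probReal_univ, smul_eq_mul, one_mul] at h7
    refine (abs_sub_le _ (Real.log v) _).trans ?_
    rw [div_eq_mul_inv] at h7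
    have h9 := mul_nonneg hC.le hN0
    have h10 := mul_nonneg hD.le h2j
    linarith [add_mul C D (((2 : ℝ) ^ j) ^ (-β) + (N : ℝ)⁻¹)]
  · rw [e]
    refine (variance_le_integral_sub_sq h6 (Real.log v)).trans (h8.trans ?_)
    rw [div_eq_mul_inv]
    nlinarith

end EmpiricalVariance

/-! ### Orders of magnitude of the sample sizes -/

section SampleSizes

variable {T ℓ n J₀ : ℕ}

/-- Since `Real.logb` takes the value 0 at 0 and ignores signs, `maxScale` is also defined when `n -
T + 1 ≤ 0`. In that case it is at most 0, because `|n - T + 1| ≤ T`, and `1 ≤ j` excludes it. -/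
lemma two_pow_mul_le_of_le_maxScale (hT : 1 ≤ T) {j : ℕ} (hj : 1 ≤ j)
    (h : (j : ℤ) ≤ maxScale T n) : (2 : ℝ) ^ j * T ≤ (n : ℝ) - T + 1 := by
  have hT' : (1 : ℝ) ≤ T := by exact_mod_cast hT
  have hT0 : (0 : ℝ) < T := by linarith
  rw [maxScale, Int.le_floor, Int.cast_natCast] at h
  have hj' : (1 : ℝ) ≤ j := by exact_mod_cast hj
  have hlogT : 0 ≤ Real.logb 2 T := Real.logb_nonneg one_lt_two hT'
  set A : ℝ := (n : ℝ) - T + 1 with hA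
  rcases lt_trichotomy A 0 with hneg | hzero | hpos
  · exfalso
    have h1 : Real.logb 2 A ≤ Real.logb 2 T := by
      rw [← Real.logb_neg_eq_logb]
      refine Real.logb_le_logb_of_le one_lt_two (by linarith) ?_
      have : (0 : ℝ) ≤ n := Nat.cast_nonneg n
      linarith
    linarith
  · exfalso
    rw [hzero, Real.logb_zero] at h
    linarith
  · rw [← Real.logb_div hpos.ne' hT0.ne', Real.le_logb_iff_rpow_le one_lt_two (by positivity),
      Real.rpow_natCast, le_div_iff₀ hT0] at h
    exact h

lemma numCoeff_bounds (hT : 1 ≤ T) {j : ℕ} (h : (2 : ℝ) ^ j * T ≤ (n : ℝ) - T + 1) :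
    1 ≤ numCoeff T n j ∧ (n : ℝ) ≤ 2 * (T + 1) * 2 ^ j * numCoeff T n j ∧
      (numCoeff T n j : ℝ) ≤ n / 2 ^ j := by
  have hT' : (1 : ℝ) ≤ T := by exact_mod_cast hT
  have h2j : (1 : ℝ) ≤ 2 ^ j := one_le_pow₀ one_le_two
  have h2j0 : (0 : ℝ) < 2 ^ j := by positivity
  set A : ℝ := (n : ℝ) - T + 1 with hA
  have hy : (T : ℝ) ≤ A / 2 ^ j := by rwa [le_div_iff₀ h2j0, mul_comm]
  have hyA : A / 2 ^ j * 2 ^ j = A := div_mul_cancel₀ _ h2j0.ne'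
  have hN1 : 1 ≤ numCoeff T n j := by
    rw [numCoeff, Nat.le_floor_iff (by linarith)]
    push_cast
    linarith
  have hN1' : (1 : ℝ) ≤ numCoeff T n j := by exact_mod_cast hN1
  have hN2 : A / 2 ^ j - T < numCoeff T n j := by
    have := Nat.lt_floor_add_one (A / 2 ^ j - T + 1)
    rw [numCoeff]
    linarith
  have hN3 : (numCoeff T n j : ℝ) ≤ A / 2 ^ j - T + 1 := by
    rw [numCoeff]
    exact Nat.floor_le (by linarith)
  refine ⟨hN1, ?_, ?_⟩
  -- The floor loses less than `T`, which is at most `T` times `numCoeff`, an integer at least 1.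
  -- Also `n = A + T - 1 ≤ 2A` since `A ≥ T`.
  · have h1 : A / 2 ^ j ≤ (T + 1) * numCoeff T n j := by nlinarith
    have h2 : (n : ℝ) ≤ 2 * A := by nlinarith
    calc (n : ℝ) ≤ 2 * (A / 2 ^ j * 2 ^ j) := by rw [hyA]; exact h2
      _ ≤ 2 * ((T + 1) * numCoeff T n j * 2 ^ j) := by gcongr
      _ = _ := by ring
  · refine hN3.trans ?_
    have : A / 2 ^ j ≤ n / 2 ^ j := by gcongr; linarith
    linarith

lemma two_pow_mul_le_of_le (hT : 1 ≤ T) (hℓ : 1 ≤ ℓ) (h : ((J₀ + ℓ : ℕ) : ℤ) ≤ maxScale T n)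
    {j : ℕ} (hj : j ≤ J₀ + ℓ) : (2 : ℝ) ^ j * T ≤ (n : ℝ) - T + 1 := by
  refine le_trans ?_ (two_pow_mul_le_of_le_maxScale hT (by omega) h)
  gcongr
  exact one_le_two

/-- Every `n_j` in the window is of the order `n 2^{-J₀}`, and so is `m`, up to constants in `T` and
`ℓ`. This converts `2^{-βJ₀}` and `1/n_j` into `(m/n)^β` and `1/m`. -/
lemma totalCoeff_bounds (hT : 1 ≤ T) (hℓ : 1 ≤ ℓ) (h : ((J₀ + ℓ : ℕ) : ℤ) ≤ maxScale T n) :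
    (0 : ℝ) < n ∧ (1 : ℝ) ≤ totalCoeff T ℓ n J₀ ∧
      (totalCoeff T ℓ n J₀ : ℝ) ≤ (ℓ + 1) * (n / 2 ^ J₀) ∧
      (n : ℝ) / 2 ^ J₀ ≤ 2 * (T + 1) * totalCoeff T ℓ n J₀ ∧
      ∀ i ≤ ℓ, numCoeff T n (J₀ + i) ≠ 0 ∧ (numCoeff T n (J₀ + i) : ℝ)⁻¹
        ≤ 2 * (T + 1) * 2 ^ ℓ * (ℓ + 1) * (totalCoeff T ℓ n J₀ : ℝ)⁻¹ := by
  have hb : ∀ j ≤ J₀ + ℓ, _ := fun j hj => numCoeff_bounds hT (two_pow_mul_le_of_le hT hℓ h hj)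
  have h2 : (0 : ℝ) < 2 ^ J₀ := by positivity
  have hle : numCoeff T n J₀ ≤ totalCoeff T ℓ n J₀ :=
    Finset.single_le_sum (f := fun j => numCoeff T n j) (fun _ _ => Nat.zero_le _)
      (Finset.mem_Icc.mpr ⟨le_rfl, by omega⟩)
  have hle' : (numCoeff T n J₀ : ℝ) ≤ totalCoeff T ℓ n J₀ := by exact_mod_cast hle
  obtain ⟨h3, h4, h5⟩ := hb J₀ (by omega)
  have h3' : (1 : ℝ) ≤ numCoeff T n J₀ := by exact_mod_cast h3
  have hn : (0 : ℝ) < n := by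
    have := h3'.trans h5
    by_contra hc
    have hn0 : (n : ℝ) = 0 := le_antisymm (not_lt.mp hc) (Nat.cast_nonneg n)
    rw [hn0, zero_div] at this
    linarith
  have hm : (totalCoeff T ℓ n J₀ : ℝ) ≤ (ℓ + 1) * (n / 2 ^ J₀) := by
    rw [totalCoeff]
    push_cast
    refine (Finset.sum_le_card_nsmul _ _ ((n : ℝ) / 2 ^ J₀) fun j hj => ?_).trans ?_
    · rw [Finset.mem_Icc] at hj
      refine (hb j hj.2).2.2.trans ?_
      gcongr
      · exact one_le_two
      · exact hj.1
    · rw [Nat.card_Icc, nsmul_eq_mul, show J₀ + ℓ + 1 - J₀ = ℓ + 1 by omega]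
      push_cast
      exact le_rfl
  refine ⟨hn, h3'.trans hle', hm, ?_, fun i hi => ?_⟩
  · rw [div_le_iff₀ h2]
    calc (n : ℝ) ≤ 2 * (T + 1) * 2 ^ J₀ * numCoeff T n J₀ := h4
      _ ≤ 2 * (T + 1) * 2 ^ J₀ * totalCoeff T ℓ n J₀ := by gcongr
      _ = _ := by ring
  · obtain ⟨h6, h7, -⟩ := hb (J₀ + i) (by omega)
    refine ⟨by omega, ?_⟩
    have h6' : (0 : ℝ) < numCoeff T n (J₀ + i) := by exact_mod_cast h6
    have hm0 : (0 : ℝ) < totalCoeff T ℓ n J₀ := lt_of_lt_of_le one_pos (h3'.trans hle')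
    rw [inv_le_iff_one_le_mul₀ h6', ← div_eq_mul_inv, div_mul_eq_mul_div, le_div_iff₀ hm0, one_mul]
    refine hm.trans ?_
    calc (ℓ + 1) * ((n : ℝ) / 2 ^ J₀)
        ≤ (ℓ + 1) * ((2 * (T + 1) * 2 ^ (J₀ + i) * numCoeff T n (J₀ + i)) / 2 ^ J₀) := by gcongr
      _ = 2 * (T + 1) * 2 ^ i * (ℓ + 1) * numCoeff T n (J₀ + i) := by
        rw [pow_add]; field_simp
      _ ≤ 2 * (T + 1) * 2 ^ ℓ * (ℓ + 1) * numCoeff T n (J₀ + i) := by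
        gcongr
        exact one_le_two

end SampleSizes

/-! ### Risk of the regression estimator -/

section Estimator

variable {φ ψ : ℝ → ℝ} {T M ℓ : ℕ} {α β L dmin dmax : ℝ}

/-- Cauchy-Schwarz applied to the centred variables. Coefficients at different scales are dependent,
and their number `ℓ + 1` is fixed, so nothing better is needed. -/
lemma variance_sum_mul_le {Ω : Type*} [MeasurableSpace Ω] {P : Measure Ω} [IsProbabilityMeasure P]
    {ι : Type*} [Fintype ι] (w : ι → ℝ) {Z : ι → Ω → ℝ} (hZ : ∀ i, MemLp (Z i) 2 P) :
    Var[fun ω => ∑ i, w i * Z i ω; P] ≤ (∑ i, w i ^ 2) * ∑ i, Var[Z i; P] := by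
  have hc : ∀ i, MemLp (fun ω => Z i ω - ∫ ω', Z i ω' ∂P) 2 P := fun i =>
    (hZ i).sub (memLp_const _)
  refine (variance_le_integral_sub_sq (memLp_finsetSum _ fun i _ => (hZ i).const_mul (w i))
    (∑ i, w i * ∫ ω', Z i ω' ∂P)).trans ?_
  have e : ∀ i, Var[Z i; P] = ∫ ω, (Z i ω - ∫ ω', Z i ω' ∂P) ^ 2 ∂P := fun i =>
    variance_eq_integral (hZ i).aemeasurable
  simp_rw [e]
  rw [← integral_finsetSum _ fun i _ => (hc i).integrable_sq, ← integral_const_mul]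
  refine integral_mono_of_nonneg (.of_forall fun ω => sq_nonneg _)
    ((integrable_finsetSum _ fun i _ => (hc i).integrable_sq).const_mul _) (.of_forall fun ω => ?_)
  dsimp only
  rw [← Finset.sum_sub_distrib]
  simp_rw [← mul_sub]
  exact Finset.sum_mul_sq_le_sq_mul_sq _ _ _

lemma integral_sub_sq_eq {Ω : Type*} [MeasurableSpace Ω] {P : Measure Ω} [IsProbabilityMeasure P]
    {Z : Ω → ℝ} (hZ : MemLp Z 2 P) (d : ℝ) :
    ∫ ω, (Z ω - d) ^ 2 ∂P = Var[Z; P] + ((∫ ω, Z ω ∂P) - d) ^ 2 := by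
  have h1 := variance_eq_sub (hZ.sub (memLp_const d))
  have h2 := variance_sub_const hZ.aestronglyMeasurable d
  have h3 : ∫ ω, (Z - fun _ : Ω => d) ω ∂P = (∫ ω, Z ω ∂P) - d := by
    simp only [Pi.sub_apply]
    rw [integral_sub (hZ.integrable one_le_two) (integrable_const _)]
    simp
  rw [h3] at h1
  have h4 : Var[Z - fun _ : Ω => d; P] = Var[Z; P] := h2
  rw [h4] at h1
  rw [h1]
  simp

/-- Bias, variance and mean square error of the estimator, for given moment and decay exponents. -/
lemma WaveletAssumptions.exists_estimator_bounds (h : WaveletAssumptions φ ψ M α)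
    (hM : 1 ≤ M) (hT : 1 ≤ T)
    (hφ : Function.support φ ⊆ Set.Ioo (-(T : ℝ)) 0) (hψ : Function.support ψ ⊆ Set.Ioo 0 (T : ℝ))
    (hH : ∀ j, ∃ x : ℝ, transferFunction φ ψ j x ≠ 0)
    (hℓ : 1 ≤ ℓ) (w : Fin (ℓ + 1) → ℝ)
    (hw₀ : ∑ i, w i = 0) (hw₁ : 2 * Real.log 2 * ∑ i : Fin (ℓ + 1), ((i : ℕ) : ℝ) * w i = 1)
    (hβ₀ : 0 < β) (hβ₂ : β ≤ 2) (hL : 0 < L) (hdM : ∀ d ∈ Set.Icc dmin dmax, d ≤ M)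
    (hs : 1 < 2 * α + 2 * dmin - β) :
    ∃ C : ℝ, 0 < C ∧ ∀ n J₀ : ℕ, ((J₀ + ℓ : ℕ) : ℤ) ≤ maxScale T n →
      ∀ d ∈ Set.Icc dmin dmax, ∀ fstar ∈ HolderClass β L, 0 < fstar 0 →
      ∀ (Ω : Type*) [MeasurableSpace Ω] (P : Measure Ω) [IsProbabilityMeasure P]
        (X : ℤ → Ω → ℝ), IsGaussianProcess X P → HasMemoryParameter X P d fstar →
        (∀ k, ∫ ω, iterDiff M X k ω ∂P = 0) →
        MemLp (estimator φ ψ T w n J₀ X) 2 P ∧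
        |(∫ ω, estimator φ ψ T w n J₀ X ω ∂P) - d| ≤
          C * (((totalCoeff T ℓ n J₀ : ℝ) / n) ^ β + (totalCoeff T ℓ n J₀ : ℝ)⁻¹) ∧
        Var[estimator φ ψ T w n J₀ X; P] ≤ C * (totalCoeff T ℓ n J₀ : ℝ)⁻¹ ∧
        ∫ ω, (estimator φ ψ T w n J₀ X ω - d) ^ 2 ∂P ≤
          C * (((totalCoeff T ℓ n J₀ : ℝ) / n) ^ (2 * β) + (totalCoeff T ℓ n J₀ : ℝ)⁻¹) := by
  obtain ⟨C, hC, h1⟩ := h.exists_log_empiricalVariance_bounds hM hφ hψ hH hβ₀ hβ₂ hL hdM hs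
  set A : ℝ := 2 * (T + 1) with hA
  set K : ℝ := 2 * (T + 1) * 2 ^ ℓ * (ℓ + 1) with hK
  have hA0 : 0 < A := by positivity
  have hK0 : 0 < K := by positivity
  set C₁ : ℝ := (∑ i, |w i|) * (C * (A ^ β + K)) with hC₁
  set C₂ : ℝ := (∑ i, w i ^ 2) * ((ℓ + 1) * (C * K)) with hC₂
  have hw1 : 0 ≤ ∑ i, |w i| := Finset.sum_nonneg fun i _ => abs_nonneg _
  have hw2 : 0 ≤ ∑ i, w i ^ 2 := Finset.sum_nonneg fun i _ => sq_nonneg _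
  have hC₁0 : 0 ≤ C₁ := by positivity
  have hC₂0 : 0 ≤ C₂ := by positivity
  refine ⟨C₁ + C₂ + 2 * C₁ ^ 2 + 1, by positivity,
    fun n J₀ hn d hd fstar hf hf0 Ω _ P _ X hG hX hmean => ?_⟩
  obtain ⟨a, h2⟩ := h1 d hd fstar hf hf0 Ω P X hG hX hmean
  obtain ⟨hn0, hm1, -, h3, h4⟩ := totalCoeff_bounds hT hℓ hn
  set m : ℝ := (totalCoeff T ℓ n J₀ : ℝ) with hm
  have hm0 : 0 < m := by linarith
  set u : ℝ := (m / n) ^ β with hu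
  have hu0 : 0 ≤ u := by positivity
  set Z : Fin (ℓ + 1) → Ω → ℝ := fun i ω =>
    Real.log (empiricalVariance φ ψ T n (fun k => X k ω) (J₀ + i)) with hZ
  have h5 : ∀ i : Fin (ℓ + 1), MemLp (Z i) 2 P ∧
      |(∫ ω, Z i ω ∂P) - (a + 2 * Real.log 2 * d * ((J₀ + i : ℕ) : ℝ))|
        ≤ C * (A ^ β + K) * (u + m⁻¹) ∧ Var[Z i; P] ≤ C * K * m⁻¹ := fun i => by
    obtain ⟨h6, h7⟩ := h4 i (Nat.lt_succ_iff.mp i.2)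
    obtain ⟨h8, h9, h10⟩ := h2 n (J₀ + i) h6
    refine ⟨h8, h9.trans ?_, h10.trans ?_⟩
    · have h11 : ((2 : ℝ) ^ (J₀ + (i : ℕ))) ^ (-β) ≤ A ^ β * u := by
        have h12 : ((2 : ℝ) ^ J₀)⁻¹ ≤ A * (m / n) := by
          rw [← mul_div_assoc, le_div_iff₀ hn0, inv_mul_eq_div]
          exact h3
        calc ((2 : ℝ) ^ (J₀ + (i : ℕ))) ^ (-β) ≤ ((2 : ℝ) ^ J₀) ^ (-β) := by
              refine Real.rpow_le_rpow_of_nonpos (by positivity) ?_ (by linarith)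
              gcongr
              · exact one_le_two
              · omega
          _ = (((2 : ℝ) ^ J₀)⁻¹) ^ β := by
              rw [Real.rpow_neg (by positivity), Real.inv_rpow (by positivity)]
          _ ≤ (A * (m / n)) ^ β := by gcongr
          _ = A ^ β * u := Real.mul_rpow hA0.le (by positivity)
      have hAβ : 0 ≤ A ^ β := by positivity
      have hm' : 0 ≤ m⁻¹ := by positivity
      rw [mul_assoc]
      refine mul_le_mul_of_nonneg_left ?_ hC.le
      nlinarith [mul_nonneg hAβ hm', mul_nonneg hK0.le hu0]
    · rw [mul_assoc]
      gcongr
  have hmem : MemLp (estimator φ ψ T w n J₀ X) 2 P :=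
    memLp_finsetSum _ fun i _ => (h5 i).1.const_mul (w i)
  have hbias : |(∫ ω, estimator φ ψ T w n J₀ X ω ∂P) - d| ≤ C₁ * (u + m⁻¹) := by
    have e1 : ∫ ω, estimator φ ψ T w n J₀ X ω ∂P = ∑ i, w i * ∫ ω, Z i ω ∂P := by
      simp only [estimator]
      rw [integral_finsetSum _ fun i _ => ((h5 i).1.integrable one_le_two).const_mul (w i)]
      exact Finset.sum_congr rfl fun i _ => integral_const_mul _ _
    -- Since the weights sum to 0, the intercept and the starting scale `J₀` drop out; the second
    -- condition on the weights turns the slope into `d`.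
    have e2 : ∑ i : Fin (ℓ + 1), w i * (a + 2 * Real.log 2 * d * ((J₀ + i : ℕ) : ℝ)) = d := by
      calc ∑ i : Fin (ℓ + 1), w i * (a + 2 * Real.log 2 * d * ((J₀ + i : ℕ) : ℝ))
          = ∑ i : Fin (ℓ + 1), ((a + 2 * Real.log 2 * d * J₀) * w i
            + d * (2 * Real.log 2) * (((i : ℕ) : ℝ) * w i)) := by
            refine Finset.sum_congr rfl fun i _ => ?_
            push_cast
            ring
        _ = (a + 2 * Real.log 2 * d * J₀) * ∑ i, w i
            + d * (2 * Real.log 2 * ∑ i : Fin (ℓ + 1), ((i : ℕ) : ℝ) * w i) := by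
            rw [Finset.sum_add_distrib, ← Finset.mul_sum, ← Finset.mul_sum]
            ring
        _ = d := by rw [hw₀, hw₁]; ring
    have e3 : (∫ ω, estimator φ ψ T w n J₀ X ω ∂P) - d = ∑ i : Fin (ℓ + 1),
        w i * ((∫ ω, Z i ω ∂P) - (a + 2 * Real.log 2 * d * ((J₀ + i : ℕ) : ℝ))) := by
      simp_rw [mul_sub]
      rw [Finset.sum_sub_distrib, e2, e1]
    rw [e3]
    refine (Finset.abs_sum_le_sum_abs _ _).trans ?_
    calc _ ≤ ∑ i, |w i| * (C * (A ^ β + K) * (u + m⁻¹)) := Finset.sum_le_sum fun i _ => by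
          rw [abs_mul]
          exact mul_le_mul_of_nonneg_left (h5 i).2.1 (abs_nonneg _)
      _ = C₁ * (u + m⁻¹) := by rw [← Finset.sum_mul, hC₁]; ring
  have hvar : Var[estimator φ ψ T w n J₀ X; P] ≤ C₂ * m⁻¹ := by
    refine (variance_sum_mul_le w fun i => (h5 i).1).trans ?_
    rw [hC₂, mul_assoc]
    refine mul_le_mul_of_nonneg_left ?_ hw2
    refine (Finset.sum_le_sum fun i _ => (h5 i).2.2).trans (le_of_eq ?_)
    rw [Finset.sum_const, Finset.card_univ, Fintype.card_fin, nsmul_eq_mul]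
    push_cast
    ring
  have hm' : 0 ≤ m⁻¹ := by positivity
  have hsq : 0 ≤ C₁ ^ 2 := sq_nonneg _
  refine ⟨hmem, hbias.trans ?_, hvar.trans ?_, ?_⟩
  · exact mul_le_mul_of_nonneg_right (by linarith) (by positivity)
  · exact mul_le_mul_of_nonneg_right (by linarith) hm'
  · rw [integral_sub_sq_eq hmem d]
    have e4 : (m / n) ^ (2 * β) = u ^ 2 := by
      rw [hu, mul_comm, Real.rpow_mul (by positivity), Real.rpow_two]
    have h6 : ((∫ ω, estimator φ ψ T w n J₀ X ω ∂P) - d) ^ 2 ≤ (C₁ * (u + m⁻¹)) ^ 2 := by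
      rw [← sq_abs]
      gcongr
    -- As `m ≥ 1`, the squared bias term `m⁻²` is absorbed by the variance term.
    have h7 : m⁻¹ ^ 2 ≤ m⁻¹ := pow_le_of_le_one hm' (inv_le_one_of_one_le₀ hm1) two_ne_zero
    have h8 : (u + m⁻¹) ^ 2 ≤ 2 * (u ^ 2 + m⁻¹) := add_sq_le.trans (by linarith)
    rw [e4]
    calc Var[estimator φ ψ T w n J₀ X; P] + ((∫ ω, estimator φ ψ T w n J₀ X ω ∂P) - d) ^ 2
        ≤ C₂ * m⁻¹ + C₁ ^ 2 * (2 * (u ^ 2 + m⁻¹)) := by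
          refine add_le_add hvar (h6.trans ?_)
          rw [mul_pow]
          exact mul_le_mul_of_nonneg_left h8 hsq
      _ ≤ C₂ * (u ^ 2 + m⁻¹) + 2 * C₁ ^ 2 * (u ^ 2 + m⁻¹) := by
          have := mul_nonneg hC₂0 (sq_nonneg u)
          linarith
      _ ≤ _ := by
          rw [← add_mul]
          exact mul_le_mul_of_nonneg_right (by linarith) (by positivity)

lemma le_maxScale_of_two_pow_mul_le (hT : 1 ≤ T) {n j : ℕ}
    (h : (2 : ℝ) ^ j * T ≤ (n : ℝ) - T + 1) : (j : ℤ) ≤ maxScale T n := by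
  have hT0 : (0 : ℝ) < T := by exact_mod_cast hT
  have hpos : 0 < (n : ℝ) - T + 1 := lt_of_lt_of_le (by positivity) h
  rw [maxScale, Int.le_floor, Int.cast_natCast, ← Real.logb_div hpos.ne' hT0.ne',
    Real.le_logb_iff_rpow_le one_lt_two (by positivity), Real.rpow_natCast, le_div_iff₀ hT0]
  exact h

/-- Balance of the two error terms for the optimal order of the lowest scale. -/
lemma exists_rate_bound (hT : 1 ≤ T) (hℓ : 1 ≤ ℓ) (hβ₀ : 0 < β) {J₀ : ℕ → ℕ}
    (hJ : Asymptotics.IsTheta Filter.atTop (fun n : ℕ => (2 : ℝ) ^ J₀ n)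
      (fun n : ℕ => (n : ℝ) ^ (1 / (1 + 2 * β)))) :
    ∃ K : ℝ, ∀ᶠ n : ℕ in Filter.atTop, ((J₀ n + ℓ : ℕ) : ℤ) ≤ maxScale T n ∧
      (n : ℝ) ^ (2 * β / (1 + 2 * β)) * (((totalCoeff T ℓ n (J₀ n) : ℝ) / n) ^ (2 * β)
        + (totalCoeff T ℓ n (J₀ n) : ℝ)⁻¹) ≤ K := by
  obtain ⟨c₁, hc₁, h1⟩ := hJ.1.exists_pos
  obtain ⟨c₂, hc₂, h2⟩ := hJ.2.exists_pos
  have hβ1 : 0 < 1 + 2 * β := by linarith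
  set γ : ℝ := 1 / (1 + 2 * β) with hγ
  set p : ℝ := 2 * β / (1 + 2 * β) with hp
  have hp0 : 0 < p := by positivity
  -- The two identities express the balance: `(m/n)^{2β}` is of order `n^{-2βγ} = n^{-p}`, and `1/m`
  -- is of order `n^{γ-1} = n^{-p}`.
  have hγp : γ = -p + 1 := by rw [hγ, hp]; field_simp; ring
  have hγβ : γ * (2 * β) = p := by rw [hγ, hp]; ring
  -- Since `γ < 1`, the largest scale `2^{J₀ + ℓ} T` is eventually at most `n/2`, hence at most `n -
  -- T + 1` once `n ≥ 2T`.
  have h3 : ∀ᶠ n : ℕ in Filter.atTop, 2 ^ ℓ * T * c₁ * (n : ℝ) ^ (-p) ≤ 1 / 2 := by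
    have h4 := ((tendsto_rpow_neg_atTop hp0).comp tendsto_natCast_atTop_atTop).const_mul
      ((2 : ℝ) ^ ℓ * T * c₁)
    rw [mul_zero] at h4
    exact h4.eventually (Iic_mem_nhds (by norm_num))
  refine ⟨((ℓ + 1) * c₂) ^ (2 * β) + 2 * (T + 1) * c₁, ?_⟩
  filter_upwards [h1.bound, h2.bound, h3, Filter.eventually_ge_atTop (2 * T)] with n h1 h2 h3 h4
  have h4' : (2 * T : ℝ) ≤ n := by exact_mod_cast h4
  have hT1 : (1 : ℝ) ≤ T := by exact_mod_cast hT
  have hn0 : (0 : ℝ) < n := by linarith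
  have h2J : (0 : ℝ) < 2 ^ J₀ n := by positivity
  rw [Real.norm_of_nonneg h2J.le, Real.norm_of_nonneg (by positivity)] at h1 h2
  have hscale : ((J₀ n + ℓ : ℕ) : ℤ) ≤ maxScale T n := by
    refine le_maxScale_of_two_pow_mul_le hT ?_
    calc (2 : ℝ) ^ (J₀ n + ℓ) * T = 2 ^ ℓ * T * 2 ^ J₀ n := by rw [pow_add]; ring
      _ ≤ 2 ^ ℓ * T * (c₁ * (n : ℝ) ^ γ) := by gcongr
      _ = 2 ^ ℓ * T * c₁ * (n : ℝ) ^ (-p) * n := by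
        rw [hγp, Real.rpow_add hn0, Real.rpow_one]; ring
      _ ≤ 1 / 2 * n := by gcongr
      _ ≤ n - T + 1 := by linarith
  refine ⟨hscale, ?_⟩
  obtain ⟨-, hm1, h5, h6, -⟩ := totalCoeff_bounds hT hℓ hscale
  set m : ℝ := (totalCoeff T ℓ n (J₀ n) : ℝ) with hm
  have hm0 : 0 < m := by linarith
  have h7 : m / n ≤ (ℓ + 1) * c₂ * (n : ℝ) ^ (-γ) := by
    rw [div_le_iff₀ hn0]
    refine h5.trans ?_
    rw [Real.rpow_neg hn0.le, mul_assoc, mul_assoc]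
    refine mul_le_mul_of_nonneg_left ?_ (by positivity)
    rw [div_le_iff₀ h2J]
    have hnγ : 0 < (n : ℝ) ^ γ := by positivity
    calc (n : ℝ) = (n : ℝ) ^ γ * (((n : ℝ) ^ γ)⁻¹ * n) := by field_simp
      _ ≤ (c₂ * 2 ^ J₀ n) * (((n : ℝ) ^ γ)⁻¹ * n) := by gcongr
      _ = _ := by ring
  have h8 : (n : ℝ) ^ p * (m / n) ^ (2 * β) ≤ ((ℓ + 1) * c₂) ^ (2 * β) := by
    calc (n : ℝ) ^ p * (m / n) ^ (2 * β)
        ≤ (n : ℝ) ^ p * ((ℓ + 1) * c₂ * (n : ℝ) ^ (-γ)) ^ (2 * β) := by gcongr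
      _ = (n : ℝ) ^ p * (n : ℝ) ^ (-p) * ((ℓ + 1) * c₂) ^ (2 * β) := by
        rw [Real.mul_rpow (by positivity) (by positivity), ← Real.rpow_mul hn0.le, neg_mul, hγβ]
        ring
      _ = _ := by rw [← Real.rpow_add hn0, add_neg_cancel, Real.rpow_zero, one_mul]
  have h9 : (n : ℝ) ^ p * m⁻¹ ≤ 2 * (T + 1) * c₁ := by
    rw [← div_eq_mul_inv, div_le_iff₀ hm0]
    have hnp : 0 < (n : ℝ) ^ p := by positivity
    have h10 : (n : ℝ) ^ p * (n : ℝ) ^ γ = n := by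
      rw [← Real.rpow_add hn0, hγp, ← add_assoc, add_neg_cancel, zero_add, Real.rpow_one]
    rw [div_le_iff₀ h2J] at h6
    have h11 : (n : ℝ) ^ p * (n : ℝ) ^ γ ≤ 2 * (T + 1) * c₁ * m * (n : ℝ) ^ γ := by
      rw [h10]
      refine h6.trans ?_
      calc 2 * (T + 1) * m * 2 ^ J₀ n ≤ 2 * (T + 1) * m * (c₁ * (n : ℝ) ^ γ) := by gcongr
        _ = _ := by ring
    exact le_of_mul_le_mul_right h11 (by positivity)
  rw [mul_add]
  exact add_le_add h8 h9

/-- The number of vanishing moments is bounded in terms of the supports. -/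
lemma WaveletAssumptions.le_two_mul (h : WaveletAssumptions φ ψ M α)
    (hφ : Function.support φ ⊆ Set.Ioo (-(T : ℝ)) 0) (hψ : Function.support ψ ⊆ Set.Ioo 0 (T : ℝ))
    (hH : ∃ x : ℝ, transferFunction φ ψ 0 x ≠ 0) : M ≤ 2 * T := by
  obtain ⟨x, hx⟩ := hH
  have h0 : filterPoly φ ψ T 0 ≠ 0 := by
    intro h0
    rw [transferFunction_eq_aeval hφ hψ, h0, map_zero] at hx
    exact hx rfl
  have h1 := Polynomial.natDegree_le_of_dvd (h.dvd_filterPoly hφ hψ 0) h0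
  rw [Polynomial.natDegree_pow, show (Polynomial.X - 1 : Polynomial ℝ)
    = Polynomial.X - Polynomial.C 1 by simp, Polynomial.natDegree_X_sub_C, mul_one] at h1
  have h2 := natDegree_filterPoly_le φ ψ T 0
  omega

end Estimator

end LogScaleRegression

/-! ### Uniform risk bounds and the rate of convergence -/

theorem mainTheorem2
    (φ ψ : ℝ → ℝ) (T : ℕ) (hT : 1 ≤ T)
    (hφ : Function.support φ ⊆ Set.Ioo (-(T : ℝ)) 0)
    (hψ : Function.support ψ ⊆ Set.Ioo 0 (T : ℝ))
    (hH : ∀ j : ℕ, ∃ lam : ℝ, LogScaleRegression.transferFunction φ ψ j lam ≠ 0)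
    (ℓ : ℕ) (hℓ : 1 ≤ ℓ) (w : Fin (ℓ + 1) → ℝ)
    (hw₀ : ∑ i, w i = 0) (hw₁ : 2 * Real.log 2 * ∑ i : Fin (ℓ + 1), ((i : ℕ) : ℝ) * w i = 1)
    (β L dmin dmax : ℝ) (hβ₀ : 0 < β) (hβ₂ : β ≤ 2) (hL : 0 < L) (hd : dmin < dmax) :
    ∃ C : ℝ, 0 < C ∧
      ∀ (M : ℕ) (α : ℝ), 1 ≤ M → LogScaleRegression.WaveletAssumptions φ ψ M α →
        Set.Icc dmin dmax ⊆ Set.Ioc ((1 + β) / 2 - α) (M : ℝ) →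
        -- bias, variance and mean square error, uniformly in the process
        (∀ n J₀ : ℕ, ((J₀ + ℓ : ℕ) : ℤ) ≤ LogScaleRegression.maxScale T n →
          ∀ d ∈ Set.Icc dmin dmax,
          ∀ fstar ∈ LogScaleRegression.HolderClass β L, 0 < fstar 0 →
          ∀ (Ω : Type*) [MeasurableSpace Ω] (P : Measure Ω) [IsProbabilityMeasure P]
            (X : ℤ → Ω → ℝ), IsGaussianProcess X P →
            LogScaleRegression.HasMemoryParameter X P d fstar →
            (∀ k, ∫ ω, LogScaleRegression.iterDiff M X k ω ∂P = 0) →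
            MemLp (LogScaleRegression.estimator φ ψ T w n J₀ X) 2 P ∧
            |(∫ ω, LogScaleRegression.estimator φ ψ T w n J₀ X ω ∂P) - d| ≤
              C * (((LogScaleRegression.totalCoeff T ℓ n J₀ : ℝ) / n) ^ β +
                (LogScaleRegression.totalCoeff T ℓ n J₀ : ℝ)⁻¹) ∧
            variance (LogScaleRegression.estimator φ ψ T w n J₀ X) P ≤
              C * ((LogScaleRegression.totalCoeff T ℓ n J₀ : ℝ)⁻¹ +
                if C⁻¹ ≤ (LogScaleRegression.totalCoeff T ℓ n J₀ : ℝ) / n then 1 else 0) ∧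
            ∫ ω, (LogScaleRegression.estimator φ ψ T w n J₀ X ω - d) ^ 2 ∂P ≤
              C * (((LogScaleRegression.totalCoeff T ℓ n J₀ : ℝ) / n) ^ (2 * β) +
                (LogScaleRegression.totalCoeff T ℓ n J₀ : ℝ)⁻¹)) ∧
        -- the rate of convergence when `2 ^ J₀(n)` is of the exact order `n ^ (1 / (1 + 2β))`
        (∀ J₀ : ℕ → ℕ,
          Asymptotics.IsTheta Filter.atTop (fun n : ℕ => (2 : ℝ) ^ J₀ n)
            (fun n : ℕ => (n : ℝ) ^ (1 / (1 + 2 * β))) →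
          ∃ C' : ℝ, ∀ᶠ n : ℕ in Filter.atTop,
            ((J₀ n + ℓ : ℕ) : ℤ) ≤ LogScaleRegression.maxScale T n ∧
            ∀ d ∈ Set.Icc dmin dmax,
            ∀ fstar ∈ LogScaleRegression.HolderClass β L, 0 < fstar 0 →
            ∀ (Ω : Type*) [MeasurableSpace Ω] (P : Measure Ω) [IsProbabilityMeasure P]
              (X : ℤ → Ω → ℝ), IsGaussianProcess X P →
              LogScaleRegression.HasMemoryParameter X P d fstar →
              (∀ k, ∫ ω, LogScaleRegression.iterDiff M X k ω ∂P = 0) →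
              (n : ℝ) ^ (2 * β / (1 + 2 * β)) *
                ∫ ω, (LogScaleRegression.estimator φ ψ T w n (J₀ n) X ω - d) ^ 2 ∂P ≤ C') := by
  -- The conclusion involves `M` only through the mean of `Δ^M X`, and `α` not at all. For each `M`,
  -- the constant of one admissible `α` therefore serves all others; without any admissible `α` the
  -- claim is empty.
  have key : ∀ M : ℕ, ∃ C : ℝ, 0 < C ∧ ∀ α : ℝ, 1 ≤ M → LogScaleRegression.WaveletAssumptions φ ψ M α →
      Set.Icc dmin dmax ⊆ Set.Ioc ((1 + β) / 2 - α) (M : ℝ) →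
      ∀ n J₀ : ℕ, ((J₀ + ℓ : ℕ) : ℤ) ≤ LogScaleRegression.maxScale T n →
      ∀ d ∈ Set.Icc dmin dmax, ∀ fstar ∈ LogScaleRegression.HolderClass β L, 0 < fstar 0 →
      ∀ (Ω : Type _) [MeasurableSpace Ω] (P : Measure Ω) [IsProbabilityMeasure P]
        (X : ℤ → Ω → ℝ), IsGaussianProcess X P →
        LogScaleRegression.HasMemoryParameter X P d fstar →
        (∀ k, ∫ ω, LogScaleRegression.iterDiff M X k ω ∂P = 0) →
        MemLp (LogScaleRegression.estimator φ ψ T w n J₀ X) 2 P ∧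
        |(∫ ω, LogScaleRegression.estimator φ ψ T w n J₀ X ω ∂P) - d| ≤
          C * (((LogScaleRegression.totalCoeff T ℓ n J₀ : ℝ) / n) ^ β +
            (LogScaleRegression.totalCoeff T ℓ n J₀ : ℝ)⁻¹) ∧
        variance (LogScaleRegression.estimator φ ψ T w n J₀ X) P ≤
          C * (LogScaleRegression.totalCoeff T ℓ n J₀ : ℝ)⁻¹ ∧
        ∫ ω, (LogScaleRegression.estimator φ ψ T w n J₀ X ω - d) ^ 2 ∂P ≤
          C * (((LogScaleRegression.totalCoeff T ℓ n J₀ : ℝ) / n) ^ (2 * β) +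
            (LogScaleRegression.totalCoeff T ℓ n J₀ : ℝ)⁻¹) := by
    intro M
    by_cases hadm : ∃ α : ℝ, 1 ≤ M ∧ LogScaleRegression.WaveletAssumptions φ ψ M α ∧
        Set.Icc dmin dmax ⊆ Set.Ioc ((1 + β) / 2 - α) (M : ℝ)
    · obtain ⟨α, hM, h, hα⟩ := hadm
      obtain ⟨C, hC, h1⟩ := h.exists_estimator_bounds hM hT hφ hψ hH hℓ w hw₀ hw₁ hβ₀ hβ₂ hL
        (fun d hd => (hα hd).2) (by linarith [(hα (Set.left_mem_Icc.mpr hd.le)).1])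
      exact ⟨C, hC, fun _ _ _ _ => h1⟩
    · exact ⟨1, one_pos, fun α hM h hα => absurd ⟨α, hM, h, hα⟩ hadm⟩
  choose C hC hbound using key
  -- Admissible `M` satisfy `M ≤ 2T`, so a finite sum dominates all the constants and depends on
  -- neither `M` nor `α`.
  have hle : ∀ M ≤ 2 * T, C M ≤ ∑ N ∈ Finset.range (2 * T + 1), C N := fun M hM =>
    Finset.single_le_sum (fun N _ => (hC N).le) (Finset.mem_range.mpr (Nat.lt_succ_iff.mpr hM))
  refine ⟨∑ N ∈ Finset.range (2 * T + 1), C N,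
    Finset.sum_pos (fun N _ => hC N) ⟨0, by simp⟩, fun M α hM h hα => ⟨?_, ?_⟩⟩
  · intro n J₀ hn d hd fstar hf hf0 Ω _ P _ X hG hX hmean
    obtain ⟨h1, h2, h3, h4⟩ := hbound M α hM h hα n J₀ hn d hd fstar hf hf0 Ω P X hG hX hmean
    have hCM := hle M (h.le_two_mul hφ hψ (hH 0))
    have hC0 := (hC M).le
    refine ⟨h1, h2.trans ?_, h3.trans ?_, h4.trans ?_⟩
    · exact mul_le_mul_of_nonneg_right hCM (by positivity)
    -- The variance is in fact at most a constant times `1/m`; the indicator term is only added as a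
    -- nonnegative quantity.
    · refine mul_le_mul hCM (le_add_of_nonneg_right ?_) (by positivity) (hC0.trans hCM)
      split_ifs <;> norm_num
    · exact mul_le_mul_of_nonneg_right hCM (by positivity)
  · intro J₀ hJ
    obtain ⟨C', hC', h1⟩ := h.exists_estimator_bounds hM hT hφ hψ hH hℓ w hw₀ hw₁ hβ₀ hβ₂ hL
      (fun d hd => (hα hd).2) (by linarith [(hα (Set.left_mem_Icc.mpr hd.le)).1])
    obtain ⟨K, hK⟩ := LogScaleRegression.exists_rate_bound hT hℓ hβ₀ hJ
    refine ⟨C' * K, hK.mono fun n hn => ⟨hn.1, ?_⟩⟩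
    intro d hd fstar hf hf0 Ω _ P _ X hG hX hmean
    obtain ⟨-, -, -, h4⟩ := h1 n (J₀ n) hn.1 d hd fstar hf hf0 Ω P X hG hX hmean
    refine (mul_le_mul_of_nonneg_left h4 (by positivity)).trans ?_
    rw [mul_left_comm]
    exact mul_le_mul_of_nonneg_left hn.2 hC'.le
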